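/- Let $m\ge 1$, let $F=F(a_1,\dots,a_m)$ be the free group of rank $m$, and let $\varphi\in\mathrm{Aut}(F)$ be given by $\varphi(a_1)=a_1$ and $\varphi(a_i)=a_ia_{i-1}$ for $2\le i\le m$. Let $H=F\rtimes_\varphi\mathbb Z=\langle a_1,\dots,a_m,s\mid s^{-1}a_is=\varphi(a_i)\rangle$, and let $|\cdot|_F$, $|\cdot|_H$ be the word lengths with respect to $\{a_1,\dots,a_m\}$ and $\{a_1,\dots,a_m,s\}$. "Word" means word on $a_1^{\pm1},\dots,a_m^{\pm1}$. The rank of a word is the largest $i$ such that $a_i^{\pm1}$ occurs in it ($0$ for the empty word). For a word $w$ and $k\in\mathbb Z$, $\varphi^k(w)$ denotes the reduced word representing $\varphi^k(w)$, and $u_1\varphi^{-p}(u_0)$, $v_1\varphi^{-p}(v_0)$ below denote the reduced words representing these products. Subwords, prefixes and suffixes may be empty. There is a constant $C>0$, depending only on $m$, such that the following holds. Suppose $i\in\{1,\dots,m\}$, $p>0$ are integers and $u_0,v_0,u_1,v_1,x$ are reduced words, where $x$ is non-empty and has rank $i$. Suppose the concatenations $u_0xv_0^{-1}$ and $u_1^{-1}xv_1$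 are reduced words and $$\varphi^{-p}(u_0xv_0^{-1})=u_1^{-1}xv_1\quad\text{in }F.$$ Then there is a word $X$ with $$\varphi^{-p}(u_0Xv_0^{-1})=u_1^{-1}Xv_1\quad\text{in }F$$ of the following form. If $i=1$, then * ($\mathcal X1$) $X=U_1U_2U_3V$ as words, where each of $U_1,U_2,U_3$ is a subword of $u_1\varphi^{-p}(u_0)$ or of its inverse, and $V$ is a suffix of $v_1\varphi^{-p}(v_0)$. If $i>1$, then one of the following holds: * ($\mathcal X2$) $X=x$ is a subword of $\varphi^{-p}(u_0)$ or of $\varphi^{-p}(v_0^{-1})$; * ($\mathcal X3$) $X=L\,S\,M\,P\,R$ as words; * ($\mathcal X4$) $X=x=L\,\hat x\,R$ as words. Here: * $L$ is a subword of $\varphi^{-p}(u_0)$ and $R$ is a subword of $\varphi^{-p}(v_0^{-1})$. * $S$ is one of: * $S_i\cdots S_3S_1$, where $S_1^{-1}$ is a prefix of $\varphi^k(a_t)$ for some $t\le i$ and some $k\in\mathbb Z$ with $|k|\le C(|u_0|_F+|u_1|_F+p)$, and $S_j$ is a subword of $\varphi^{-p}(a_j)$ for $j=3,\dots,i$; *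 a subword of a reduced word $\hat S$ such that $\varphi^{-p}(\hat S)$ is a subword of $(u_1\varphi^{-p}(u_0))^{-1}$; * a subword of $\varphi^{-p}(\hat S)$, where $\hat S$ is a subword of $\varphi^{-p}(u_0)$. * $P$ is one of: * $P_1P_3\cdots P_i$, where $P_1$ is a prefix of $\varphi^{k'}(a_t)$ for some $t\le i$ and some $k'\in\mathbb Z$ with $|k'|\le C(|v_0|_F+|v_1|_F+p)$, and $P_j$ is a subword of $\varphi^{-p}(a_j^{-1})$ for $j=3,\dots,i$; * a subword of $\varphi^{-p}(\hat P)$, where $\hat P$ is a subword of $\varphi^{-p}(v_0^{-1})$; * a subword of a reduced word $\hat P$ such that $\varphi^{-p}(\hat P)$ is a subword of $v_1\varphi^{-p}(v_0)$. * There are an integer $q\ge0$ with $qp\le C(|u_0|_H+|u_1|_H+|v_0|_H+|v_1|_H+p)$ and reduced words $\pi,M_2$ such that, with $M_1=\pi\,\varphi^p(\pi)\cdots\varphi^{p(q-1)}(\pi)$ (empty if $q=0$), either * $M=M_1M_2$, where $\varphi^{-p}(\pi)=WS$ as words for a subword $W$ of $(u_1\varphi^{-p}(u_0))^{-1}$,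 and $\varphi^p(M_2)$ is a subword of $\varphi^{-p}(u_0)$ or of $\varphi^{-p}(v_0^{-1})$; or * $M=M_2^{-1}M_1^{-1}$, where $\varphi^{-p}(\pi)=WP^{-1}$ as words for a subword $W$ of $(v_1\varphi^{-p}(v_0))^{-1}$, and $\varphi^p(M_2^{-1})$ is a subword of $\varphi^{-p}(u_0)$ or of $\varphi^{-p}(v_0^{-1})$. * $\hat x$ has rank less than $i$ and satisfies $\varphi^{-p}(\hat u_0\hat x\hat v_0^{-1})=\hat u_1^{-1}\hat x\hat v_1$ in $F$ for some words $\hat u_0,\hat u_1,\hat v_0,\hat v_1$ such that $\hat u_0\hat u_1$ is reduced and is a subword of $\varphi^{-p}(u_0)$, and $\hat v_0\hat v_1$ is reduced and is a subword of $\varphi^{-p}(v_0)$. -/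

import Mathlib

namespace Hydra

/-- Words on `a_1^{±1}, …, a_m^{±1}`, in the format of Mathlib's free group. The index `t : Fin m`
stands for the generator `a_{t+1}`, and `true` / `false` for the exponent `1` / `-1`. -/
abbrev Word (m : ℕ) : Type := List (Fin m × Bool)

/-- The image of a generator: `a_1 ↦ a_1` and `a_i ↦ a_i a_{i-1}` for `i ≥ 2`. -/
def genImage (m : ℕ) : Fin m → FreeGroup (Fin m)
  | ⟨0, h⟩ => FreeGroup.of ⟨0, h⟩
  | ⟨n + 1, h⟩ => FreeGroup.of ⟨n + 1, h⟩ * FreeGroup.of ⟨n, Nat.lt_of_succ_lt h⟩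

/-- The preimage of a generator, by recursion on its index. -/
def genPreimage (m : ℕ) : (n : ℕ) → n < m → FreeGroup (Fin m)
  | 0, h => FreeGroup.of ⟨0, h⟩
  | n + 1, h => FreeGroup.of ⟨n + 1, h⟩ * (genPreimage m n (Nat.lt_of_succ_lt h))⁻¹

theorem lift_genImage_genPreimage (m : ℕ) : ∀ (n : ℕ) (h : n < m),
    FreeGroup.lift (genImage m) (genPreimage m n h) = FreeGroup.of ⟨n, h⟩
  | 0, h => by simp [genPreimage, genImage]
  | n + 1, h => by
      simp [genPreimage, genImage, lift_genImage_genPreimage m n (Nat.lt_of_succ_lt h)]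

theorem lift_genPreimage_genImage (m : ℕ) : ∀ j : Fin m,
    FreeGroup.lift (fun t : Fin m => genPreimage m t.1 t.2) (genImage m j) = FreeGroup.of j
  | ⟨0, h⟩ => by simp [genPreimage, genImage]
  | ⟨n + 1, h⟩ => by simp [genPreimage, genImage]

/-- The automorphism `φ` of the free group `F = F(a_1, …, a_m)` with `φ(a_1) = a_1` and
`φ(a_i) = a_i a_{i-1}` for `2 ≤ i ≤ m`. -/
def phi (m : ℕ) : MulAut (FreeGroup (Fin m)) :=
  MonoidHom.toMulEquiv (FreeGroup.lift (genImage m))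
    (FreeGroup.lift (fun t : Fin m => genPreimage m t.1 t.2))
    (by
      ext j
      simpa using lift_genPreimage_genImage m j)
    (by
      ext j
      simpa using lift_genImage_genPreimage m j.1 j.2)

/-- `phiWord k w` is the reduced word that represents `φ^k(w)`. -/
def phiWord {m : ℕ} (k : ℤ) (w : Word m) : Word m :=
  ((phi m ^ k) (FreeGroup.mk w)).toWord

/-- The reduced word that represents `u φ^{-p}(v)`. -/
def twistWord {m : ℕ} (p : ℕ) (u v : Word m) : Word m :=
  FreeGroup.reduce (u ++ phiWord (-(p : ℤ)) v)

/-- The rank of a word: the largest `i` such that `a_i` or `a_i^{-1}` occurs in it, and `0` for the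
empty word. -/
def rank {m : ℕ} (w : Word m) : ℕ :=
  (w.map fun l => l.1.val + 1).foldr max 0

/-- The group `H_m = F ⋊ ⟨s⟩` in which `s^{-1} g s = φ(g)` for `g ∈ F`. In Mathlib's semidirect
product the generator of `ℤ` acts by `g ↦ s g s^{-1}`, which is `φ^{-1}`. -/
abbrev HydraGroup (m : ℕ) : Type :=
  FreeGroup (Fin m) ⋊[zpowersHom (MulAut (FreeGroup (Fin m))) (phi m)⁻¹] Multiplicative ℤ

/-- The generating set `a_1, …, a_m, s` of `H_m`. -/
def hydraGens (m : ℕ) : Set (HydraGroup m) :=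
  insert (SemidirectProduct.inr (Multiplicative.ofAdd 1))
    (Set.range fun t : Fin m => SemidirectProduct.inl (FreeGroup.of t))

/-- The length of a shortest word on `S` and its inverses that represents `g`. -/
noncomputable def wordLength {G : Type*} [Group G] (S : Set G) (g : G) : ℕ :=
  sInf {n : ℕ | ∃ l : List G, l.length = n ∧ (∀ y ∈ l, y ∈ S ∨ y⁻¹ ∈ S) ∧ l.prod = g}

/-- `|w|_F`: the length of a shortest word on `a_1^{±1}, …, a_m^{±1}` equal to `w` in `F`. -/
def lenF {m : ℕ} (w : Word m) : ℕ := (FreeGroup.mk w).norm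

/-- `|w|_H`: the length of a shortest word on `a_1^{±1}, …, a_m^{±1}, s^{±1}` equal to `w`
in `H_m`. -/
noncomputable def lenH {m : ℕ} (w : Word m) : ℕ :=
  wordLength (hydraGens m) (SemidirectProduct.inl (FreeGroup.mk w))

/-- The equation `φ^{-p}(u₀ x v₀^{-1}) = u₁^{-1} x v₁` in `F`. -/
def TwistedEq {m : ℕ} (p : ℕ) (u₀ u₁ v₀ v₁ x : Word m) : Prop :=
  (phi m ^ (-(p : ℤ))) (FreeGroup.mk (u₀ ++ x ++ FreeGroup.invRev v₀))
    = FreeGroup.mk (FreeGroup.invRev u₁ ++ x ++ v₁)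

/-- `X = U₁ U₂ U₃ V` with `U₁, U₂, U₃` subwords of `(u₁ φ^{-p}(u₀))^{±1}` and `V` a suffix of
`v₁ φ^{-p}(v₀)`. -/
def FormX1 {m : ℕ} (p : ℕ) (u₀ u₁ v₀ v₁ X : Word m) : Prop :=
  ∃ U₁ U₂ U₃ V : Word m,
    (∀ U ∈ [U₁, U₂, U₃],
      U <:+: twistWord p u₁ u₀ ∨ U <:+: FreeGroup.invRev (twistWord p u₁ u₀)) ∧
    V <:+ twistWord p v₁ v₀ ∧
    X = U₁ ++ U₂ ++ U₃ ++ V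

/-- `X = x` is a subword of `φ^{-p}(u₀)` or of `φ^{-p}(v₀^{-1})`. -/
def FormX2 {m : ℕ} (p : ℕ) (u₀ v₀ x X : Word m) : Prop :=
  X = x ∧ (x <:+: phiWord (-(p : ℤ)) u₀ ∨ x <:+: phiWord (-(p : ℤ)) (FreeGroup.invRev v₀))

/-- `S = S_i ⋯ S_3 S_1`, where `S_1^{-1}` is a prefix of `φ^k(a_t)` with `t ≤ i` and `|k| ≤ B`, and
`S_j` is a subword of `φ^{-p}(a_j)` for `3 ≤ j ≤ i`. The word `T j` below is `S_j`. -/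
def SuffixChunk {m : ℕ} (i p : ℕ) (B : ℝ) (S : Word m) : Prop :=
  ∃ (S₁ : Word m) (T : ℕ → Word m),
    (∃ (t : Fin m) (k : ℤ), t.val + 1 ≤ i ∧ |(k : ℝ)| ≤ B ∧
      FreeGroup.invRev S₁ <+: phiWord k [(t, true)]) ∧
    (∀ j : Fin m, 3 ≤ j.val + 1 → j.val + 1 ≤ i →
      T (j.val + 1) <:+: phiWord (-(p : ℤ)) [(j, true)]) ∧
    S = (List.range' 3 (i - 2)).reverse.flatMap T ++ S₁

/-- `P = P_1 P_3 ⋯ P_i`, where `P_1` is a prefix of `φ^k(a_t)` with `t ≤ i` and `|k| ≤ B`, and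
`P_j` is a subword of `φ^{-p}(a_j^{-1})` for `3 ≤ j ≤ i`. The word `T j` below is `P_j`. -/
def PrefixChunk {m : ℕ} (i p : ℕ) (B : ℝ) (P : Word m) : Prop :=
  ∃ (P₁ : Word m) (T : ℕ → Word m),
    (∃ (t : Fin m) (k : ℤ), t.val + 1 ≤ i ∧ |(k : ℝ)| ≤ B ∧
      P₁ <+: phiWord k [(t, true)]) ∧
    (∀ j : Fin m, 3 ≤ j.val + 1 → j.val + 1 ≤ i →
      T (j.val + 1) <:+: phiWord (-(p : ℤ)) [(j, false)]) ∧
    P = P₁ ++ (List.range' 3 (i - 2)).flatMap T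

/-- The three possibilities for the chunk `S`. -/
def IsS {m : ℕ} (C : ℝ) (i p : ℕ) (u₀ u₁ S : Word m) : Prop :=
  SuffixChunk i p (C * ((lenF u₀ : ℝ) + lenF u₁ + p)) S ∨
  (∃ S' : Word m, FreeGroup.IsReduced S' ∧ S <:+: S' ∧
    phiWord (-(p : ℤ)) S' <:+: FreeGroup.invRev (twistWord p u₁ u₀)) ∨
  (∃ S' : Word m, FreeGroup.IsReduced S' ∧ S <:+: phiWord (-(p : ℤ)) S' ∧
    S' <:+: phiWord (-(p : ℤ)) u₀)

/-- The three possibilities for the chunk `P`. -/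
def IsP {m : ℕ} (C : ℝ) (i p : ℕ) (v₀ v₁ P : Word m) : Prop :=
  PrefixChunk i p (C * ((lenF v₀ : ℝ) + lenF v₁ + p)) P ∨
  (∃ P' : Word m, FreeGroup.IsReduced P' ∧ P <:+: phiWord (-(p : ℤ)) P' ∧
    P' <:+: phiWord (-(p : ℤ)) (FreeGroup.invRev v₀)) ∨
  (∃ P' : Word m, FreeGroup.IsReduced P' ∧ P <:+: P' ∧
    phiWord (-(p : ℤ)) P' <:+: twistWord p v₁ v₀)

/-- The word `π φ^p(π) ⋯ φ^{p(q-1)}(π)`, empty if `q = 0`. -/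
def periodicBlock {m : ℕ} (p q : ℕ) (w : Word m) : Word m :=
  (List.range q).flatMap fun n => phiWord ((p : ℤ) * n) w

/-- The chunk `M`, built from `M₁ = π φ^p(π) ⋯ φ^{p(q-1)}(π)` and a reduced word `M₂`, in one of two
orientations that are exchanged by inverting the equation:
* `M = M₁ M₂`, where `φ^{-p}(π) = W S` with `W` a subword of `(u₁ φ^{-p}(u₀))^{-1}`, and
  `φ^p(M₂)` is a subword of `φ^{-p}(u₀)` or `φ^{-p}(v₀^{-1})`;
* `M = M₂^{-1} M₁^{-1}`, where `φ^{-p}(π) = W P^{-1}` with `W` a subword of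
  `(v₁ φ^{-p}(v₀))^{-1}`, and `φ^p(M₂^{-1})` is a subword of `φ^{-p}(u₀)` or `φ^{-p}(v₀^{-1})`. -/
def IsM {m : ℕ} (C : ℝ) (p : ℕ) (u₀ u₁ v₀ v₁ S P M : Word m) : Prop :=
  ∃ (q : ℕ) (w M₂ : Word m),
    FreeGroup.IsReduced w ∧ FreeGroup.IsReduced M₂ ∧
    (q : ℝ) * p ≤ C * ((lenH u₀ : ℝ) + lenH u₁ + lenH v₀ + lenH v₁ + p) ∧
    ((M = periodicBlock p q w ++ M₂ ∧
        (∃ W : Word m, W <:+: FreeGroup.invRev (twistWord p u₁ u₀) ∧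
          phiWord (-(p : ℤ)) w = W ++ S) ∧
        (phiWord (p : ℤ) M₂ <:+: phiWord (-(p : ℤ)) u₀ ∨
          phiWord (p : ℤ) M₂ <:+: phiWord (-(p : ℤ)) (FreeGroup.invRev v₀))) ∨
      (M = FreeGroup.invRev M₂ ++ FreeGroup.invRev (periodicBlock p q w) ∧
        (∃ W : Word m, W <:+: FreeGroup.invRev (twistWord p v₁ v₀) ∧
          phiWord (-(p : ℤ)) w = W ++ FreeGroup.invRev P) ∧
        (phiWord (p : ℤ) (FreeGroup.invRev M₂) <:+: phiWord (-(p : ℤ)) u₀ ∨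
          phiWord (p : ℤ) (FreeGroup.invRev M₂) <:+:
            phiWord (-(p : ℤ)) (FreeGroup.invRev v₀))))

/-- `X = L S M P R` as words. -/
def FormX3 {m : ℕ} (C : ℝ) (i p : ℕ) (u₀ u₁ v₀ v₁ X : Word m) : Prop :=
  ∃ L S M P R : Word m,
    L <:+: phiWord (-(p : ℤ)) u₀ ∧
    IsS C i p u₀ u₁ S ∧
    IsM C p u₀ u₁ v₀ v₁ S P M ∧
    IsP C i p v₀ v₁ P ∧
    R <:+: phiWord (-(p : ℤ)) (FreeGroup.invRev v₀) ∧
    X = L ++ S ++ M ++ P ++ R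

/-- `X = x = L y R` as words, where `y` (the word called `x̂`) has rank less than `i` and solves an
equation of the same kind. -/
def FormX4 {m : ℕ} (i p : ℕ) (u₀ v₀ x X : Word m) : Prop :=
  X = x ∧ ∃ L y R : Word m,
    L <:+: phiWord (-(p : ℤ)) u₀ ∧
    R <:+: phiWord (-(p : ℤ)) (FreeGroup.invRev v₀) ∧
    x = L ++ y ++ R ∧
    rank y < i ∧
    ∃ u₀' u₁' v₀' v₁' : Word m,
      TwistedEq p u₀' u₁' v₀' v₁' y ∧
      FreeGroup.IsReduced (u₀' ++ u₁') ∧ u₀' ++ u₁' <:+: phiWord (-(p : ℤ)) u₀ ∧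
      FreeGroup.IsReduced (v₀' ++ v₁') ∧ v₀' ++ v₁' <:+: phiWord (-(p : ℤ)) v₀

end Hydra

/-! Write `ψ = φ^{-p}`, `U = u₁ ψ(u₀)` and `V = v₁ ψ(v₀)`. The equation for `x` is
`x = U ψ(x) V⁻¹`. Cancel as far as possible in `U⁻¹ x V`: this gives `x = L y R`, `U = L z`,
`V = R⁻¹ ζ` and `ψ(L y R) = z⁻¹ y ζ` as reduced words (`CancelData`, `exists_cancelData`). Since
`u₁⁻¹ x v₁` is reduced, `L` and `R` lie in `ψ(u₀)` and `ψ(v₀⁻¹)`.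

The main tool is that a reduced word of rank `t`, cut before the letters `a_t` and after the letters
`a_t⁻¹`, is cut in a way that the powers of `φ` respect (`starts_phi_zpow`, `RP.phi_zpow`,
`cutAt_phi_zpow`). Let `a_b` be the letter of top index in `y`. If `L` and `R` are non-empty and `x`
has larger rank than `y`, then `x = L y R` is the last form of the proposition. Otherwise `L` contains
at most as many letters `a_b^{±1}` as `z`, possibly after the equation is inverted, which exchanges
the two sides.

* If the numbers are equal, then `ψ` maps some cut of `L y` to the same cut of `z⁻¹ y`
  (`phiWord_cutAt_eq`). Both halves of `y` are then common prefixes or suffixes of a word and its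
  image, and each can be replaced by a prefix of some `φ^k(a_t)` with small `k`
  (`exists_short_common_prefix`). Behind this lies the axis in the tree of the free group with the
  vertices `a_t⁻¹ φ^k(a_t)`, `k ∈ ℤ`, along which `g ↦ a_t⁻¹ φ(a_t g)` translates: a common prefix of
  a word and its image has to lie on the axis (`prefix_tail_of_eq`), and far away from its origin its
  two remainders would contain large powers of `a_1` (`exists_prefix_tail_le`).
* If the numbers differ by `d > 0`, then `ψ` shifts the cuts of `y` by `d`, and `y` is a sequence of
  blocks `S`, `π`, `φ^p(π)`, …, `φ^{p(q-1)}(π)`, `P` (`CancelData.formX3_of_periodic`). If `φ` fixes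
  `π`, the periods can be left out. Otherwise large powers of `a_1` appear along the orbit of `π`
  (`growth`), and they bound `q`.

All bounds are obtained from the exponents of the powers of `a_1` in words (`PowerBound`). These
exponents are subadditive, change under `φ^k` by an amount linear in `k` (`PowerBound.phi_zpow`), and
are bounded linearly by the lengths in `F` and in `H` (`powerBound_lenF`, `powerBound_lenH`), although
the subgroup `F` of `H` is heavily distorted. For rank `1` the automorphism acts trivially on `x`, and
the solution is found by hand (`exists_formX1`). -/

namespace Hydra

open FreeGroup

variable {m : ℕ}

/-! ### Reduced words and products without cancellation -/

theorem toWord_mk_of_isReduced {w : Word m} (h : IsReduced w) : (FreeGroup.mk w).toWord = w := by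
  rw [toWord_mk, h.reduce_eq]

theorem isReduced_of_infix_toWord {w : Word m} {g : FreeGroup (Fin m)} (h : w <:+: g.toWord) :
    IsReduced w :=
  isReduced_toWord.infix h

theorem isReduced_invRev {w : Word m} (h : IsReduced w) : IsReduced (invRev w) := by
  rw [isReduced_iff_reduce_eq, reduce_invRev, h.reduce_eq]

theorem mk_append (u v : Word m) :
    FreeGroup.mk (u ++ v) = FreeGroup.mk u * FreeGroup.mk v := mul_mk.symm

theorem mk_invRev (u : Word m) : FreeGroup.mk (invRev u) = (FreeGroup.mk u)⁻¹ := inv_mk.symm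

/-- A word cancels against the next one in a common middle part. -/
theorem exists_cancel_words : ∀ (u v : Word m), IsReduced u → IsReduced v →
    ∃ u' c v', u = u' ++ c ∧ v = invRev c ++ v' ∧ IsReduced (u' ++ v') := by
  intro u
  induction u using List.reverseRecOn with
  | nil => intro v _ hv; exact ⟨[], [], v, rfl, rfl, hv⟩
  | append_singleton u a ih =>
    intro v hu hv
    by_cases h : ∃ v', v = (a.1, !a.2) :: v'
    · obtain ⟨v', rfl⟩ := h
      obtain ⟨u', c, v'', rfl, rfl, hr⟩ := ih v' hu.left_of_append hv.tail
      refine ⟨u', c ++ [a], v'', by simp, ?_, hr⟩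
      simp [invRev]
    · refine ⟨u ++ [a], [], v, by simp, by simp, ?_⟩
      refine List.IsChain.append hu hv ?_
      intro x hx y hy hxy
      simp only [List.getLast?_append, List.getLast?_singleton, Option.some_or,
        Option.mem_def, Option.some.injEq] at hx
      subst hx
      obtain ⟨v', rfl⟩ : ∃ v', v = y :: v' := by
        cases v with
        | nil => simp at hy
        | cons b v => simp at hy; exact ⟨v, by rw [hy]⟩
      by_contra hne
      apply h
      refine ⟨v', ?_⟩
      congr 1
      ext
      · rw [hxy]
      · revert hne
        cases a.2 <;> cases y.2 <;> simp

theorem exists_cancel (g h : FreeGroup (Fin m)) :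
    ∃ u c v, g.toWord = u ++ c ∧ h.toWord = invRev c ++ v ∧ (g * h).toWord = u ++ v := by
  obtain ⟨u, c, v, hu, hv, hr⟩ :=
    exists_cancel_words g.toWord h.toWord isReduced_toWord isReduced_toWord
  refine ⟨u, c, v, hu, hv, ?_⟩
  rw [← toWord_mk_of_isReduced hr]
  congr 1
  rw [← mk_toWord (x := g), ← mk_toWord (x := h), hu, hv]
  simp only [mk_append, mk_invRev]
  group

/-- The product `g * h` involves no cancellation. -/
def RP (g h : FreeGroup (Fin m)) : Prop := (g * h).toWord = g.toWord ++ h.toWord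

theorem RP_of_isReduced {g h : FreeGroup (Fin m)} (hr : IsReduced (g.toWord ++ h.toWord)) :
    RP g h := by
  rw [RP, toWord_mul, hr.reduce_eq]

theorem RP_mk {u v : Word m} (hr : IsReduced (u ++ v)) :
    RP (FreeGroup.mk u) (FreeGroup.mk v) := by
  apply RP_of_isReduced
  rw [toWord_mk_of_isReduced hr.left_of_append, toWord_mk_of_isReduced hr.right_of_append]
  exact hr

theorem RP.isReduced {g h : FreeGroup (Fin m)} (hr : RP g h) :
    IsReduced (g.toWord ++ h.toWord) := by
  rw [← hr]; exact isReduced_toWord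

theorem RP.inv {g h : FreeGroup (Fin m)} (hr : RP g h) : RP h⁻¹ g⁻¹ := by
  rw [RP, ← mul_inv_rev, toWord_inv, hr, invRev_append, toWord_inv, toWord_inv]

theorem RP_one_left (g : FreeGroup (Fin m)) : RP 1 g := by simp [RP]

/-- The reduced word of `g` begins with the letter `a_t`. -/
def Starts (t : Fin m) (g : FreeGroup (Fin m)) : Prop := ∃ w, g.toWord = (t, true) :: w

theorem Starts.of_toWord_prefix {t : Fin m} {g h : FreeGroup (Fin m)} (hg : Starts t g)
    (hp : g.toWord <+: h.toWord) : Starts t h := by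
  obtain ⟨w, hw⟩ := hg
  obtain ⟨v, hv⟩ := hp
  exact ⟨w ++ v, by rw [← hv, hw]; rfl⟩

theorem Starts.exists_mul {t : Fin m} {g : FreeGroup (Fin m)} (hg : Starts t g) :
    ∃ h, g = of t * h ∧ g.toWord = (t, true) :: h.toWord := by
  obtain ⟨w, hw⟩ := hg
  have hr : IsReduced w := by
    have := isReduced_toWord (x := g)
    rw [hw] at this
    exact this.tail
  refine ⟨FreeGroup.mk w, ?_, ?_⟩
  · rw [← mk_toWord (x := g), hw]; rfl
  · rw [toWord_mk_of_isReduced hr, hw]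

theorem starts_inv_iff {t : Fin m} {g : FreeGroup (Fin m)} :
    Starts t g⁻¹ ↔ ∃ w, g.toWord = w ++ [(t, false)] := by
  constructor
  · rintro ⟨w, hw⟩
    refine ⟨invRev w, ?_⟩
    rw [toWord_inv] at hw
    rw [← invRev_invRev (L₁ := g.toWord), hw, invRev_cons]
    simp [invRev]
  · rintro ⟨w, hw⟩
    refine ⟨invRev w, ?_⟩
    rw [toWord_inv, hw, invRev_append]
    simp [invRev]

theorem RP_of_starts {t : Fin m} {g h : FreeGroup (Fin m)} (hh : Starts t h)
    (hg : ¬ Starts t g⁻¹) : RP g h := by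
  apply RP_of_isReduced
  refine List.IsChain.append isReduced_toWord isReduced_toWord ?_
  intro x hx y hy hxy
  obtain ⟨w, hw⟩ := hh
  rw [hw] at hy
  simp only [List.head?_cons, Option.mem_def, Option.some.injEq] at hy
  subst hy
  by_contra hne
  apply hg
  rw [starts_inv_iff]
  rw [Option.mem_def, List.getLast?_eq_some_iff] at hx
  obtain ⟨w', hw'⟩ := hx
  refine ⟨w', ?_⟩
  rw [hw']
  congr 2
  ext
  · simp at hxy; rw [hxy]
  · simpa using hne

theorem RP_of_starts_inv {t : Fin m} {g h : FreeGroup (Fin m)} (hg : Starts t g⁻¹)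
    (hh : ¬ Starts t h) : RP g h := by
  have := (RP_of_starts hg (g := h⁻¹) (by simpa using hh)).inv
  simpa using this

theorem RP.not_starts {t : Fin m} {g h : FreeGroup (Fin m)} (hr : RP g h) (hg : Starts t g⁻¹) :
    ¬ Starts t h := by
  rintro ⟨w, hw⟩
  obtain ⟨v, hv⟩ := starts_inv_iff.1 hg
  have := hr.isReduced
  rw [hw, hv] at this
  have h2 : IsReduced ([(t, false), (t, true)] : Word m) :=
    this.infix ⟨v, w, by simp⟩
  simp at h2

theorem RP.starts {t : Fin m} {g h : FreeGroup (Fin m)} (hr : RP g h) (hg : Starts t g) :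
    Starts t (g * h) :=
  hg.of_toWord_prefix ⟨h.toWord, hr.symm⟩

theorem RP.starts_iff {t : Fin m} {g h : FreeGroup (Fin m)} (hr : RP g h) (hg : g ≠ 1) :
    Starts t (g * h) ↔ Starts t g := by
  refine ⟨?_, hr.starts⟩
  rintro ⟨w, hw⟩
  rw [hr] at hw
  cases hgw : g.toWord with
  | nil => exact absurd (toWord_eq_nil_iff.1 hgw) hg
  | cons a v => rw [hgw] at hw; simp at hw; exact ⟨v, by rw [hgw, hw.1]⟩

/-! ### The filtration by ranks -/

/-- All letters of the word have index below `n` (counted from `0`). -/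
def LettersBelow (n : ℕ) (w : Word m) : Prop := ∀ l ∈ w, l.1.val < n

theorem LettersBelow.mono {n n' : ℕ} (h : n ≤ n') {w : Word m} (hw : LettersBelow n w) :
    LettersBelow n' w := fun l hl => (hw l hl).trans_le h

theorem LettersBelow.append {n : ℕ} {u v : Word m} (hu : LettersBelow n u)
    (hv : LettersBelow n v) : LettersBelow n (u ++ v) := by
  intro l hl
  rcases List.mem_append.1 hl with h | h
  exacts [hu l h, hv l h]

theorem LettersBelow.subset {n : ℕ} {u v : Word m} (hv : LettersBelow n v) (h : u ⊆ v) :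
    LettersBelow n u := fun l hl => hv l (h hl)

theorem LettersBelow.invRev {n : ℕ} {u : Word m} (hu : LettersBelow n u) :
    LettersBelow n (invRev u) := by
  intro l hl
  simp only [FreeGroup.invRev, List.mem_reverse, List.mem_map] at hl
  obtain ⟨a, ha, rfl⟩ := hl
  exact hu a ha

/-- The subgroup generated by the first `n` generators, described by reduced words. -/
def level (m n : ℕ) : Subgroup (FreeGroup (Fin m)) where
  carrier := {g | LettersBelow n g.toWord}
  mul_mem' := by
    intro g h hg hh
    exact (hg.append hh).subset (toWord_mul_sublist g h).subset
  one_mem' := by simp [LettersBelow]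
  inv_mem' := by
    intro g hg
    show LettersBelow n (g⁻¹).toWord
    rw [toWord_inv]
    exact LettersBelow.invRev hg

theorem mem_level {n : ℕ} {g : FreeGroup (Fin m)} : g ∈ level m n ↔ LettersBelow n g.toWord :=
  Iff.rfl

theorem level_mono {n n' : ℕ} (h : n ≤ n') : level m n ≤ level m n' := fun _ hg => hg.mono h

theorem of_mem_level {n : ℕ} {t : Fin m} (h : t.val < n) : of t ∈ level m n := by
  rw [mem_level, toWord_of]; simpa [LettersBelow] using h

theorem mk_mem_level {n : ℕ} {w : Word m} (hw : LettersBelow n w) :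
    FreeGroup.mk w ∈ level m n := by
  rw [mem_level, toWord_mk]
  exact hw.subset (reduce.red (L := w)).sublist.subset

theorem mem_level_self (g : FreeGroup (Fin m)) : g ∈ level m m := fun l _ => l.1.isLt

/-- Induction on a word in the first `n` generators, one letter at a time from the left. -/
theorem letter_induction {n : ℕ} {P : FreeGroup (Fin m) → Prop} (h1 : P 1)
    (hp : ∀ t : Fin m, t.val < n → ∀ g ∈ level m n, P g → P (of t * g))
    (hn : ∀ t : Fin m, t.val < n → ∀ g ∈ level m n, P g → P ((of t)⁻¹ * g)) :
    ∀ g ∈ level m n, P g := by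
  have key : ∀ w : Word m, LettersBelow n w → P (FreeGroup.mk w) := by
    intro w
    induction w with
    | nil => intro _; exact h1
    | cons l w ih =>
      intro hw
      have hw' : LettersBelow n w := hw.subset (List.subset_cons_self _ _)
      have hl : l.1.val < n := hw l (by simp)
      have e : FreeGroup.mk (l :: w) = FreeGroup.mk [l] * FreeGroup.mk w := by
        rw [← mk_append]; rfl
      obtain ⟨t, ε⟩ := l
      cases ε with
      | true => rw [e]; exact hp t hl _ (mk_mem_level hw') (ih hw')
      | false =>
        have e2 : FreeGroup.mk [(t, false)] = (of t)⁻¹ := by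
          rw [of, inv_mk]; rfl
        rw [e, e2]; exact hn t hl _ (mk_mem_level hw') (ih hw')
  intro g hg
  have := key g.toWord hg
  rwa [mk_toWord] at this

/-! ### The automorphism and its powers -/

theorem phi_of_zero (h : 0 < m) : phi m (of ⟨0, h⟩) = of ⟨0, h⟩ := by
  simp [phi, genImage]

theorem phi_of_succ {n : ℕ} (h : n + 1 < m) :
    phi m (of ⟨n + 1, h⟩) = of ⟨n + 1, h⟩ * of ⟨n, Nat.lt_of_succ_lt h⟩ := by
  simp [phi, genImage]

theorem phi_zpow_add (k l : ℤ) (g : FreeGroup (Fin m)) :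
    (phi m ^ (k + l)) g = (phi m ^ k) ((phi m ^ l) g) := by
  rw [zpow_add, MulAut.mul_apply]

theorem phi_zpow_neg_apply (k : ℤ) (g : FreeGroup (Fin m)) :
    (phi m ^ (-k)) ((phi m ^ k) g) = g := by
  rw [← phi_zpow_add]; simp

theorem phi_zpow_apply_neg (k : ℤ) (g : FreeGroup (Fin m)) :
    (phi m ^ k) ((phi m ^ (-k)) g) = g := by
  rw [← phi_zpow_add]; simp

/-- The element `a_t⁻¹ φ^k(a_t)`. -/
def tail (t : Fin m) (k : ℤ) : FreeGroup (Fin m) := (of t)⁻¹ * (phi m ^ k) (of t)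

theorem phi_zpow_of (t : Fin m) (k : ℤ) : (phi m ^ k) (of t) = of t * tail t k := by
  simp [tail]

@[simp] theorem tail_zero (t : Fin m) : tail t 0 = 1 := by simp [tail]

theorem tail_add (t : Fin m) (k l : ℤ) : tail t (k + l) = tail t k * (phi m ^ k) (tail t l) := by
  have : (phi m ^ (k + l)) (of t) = of t * tail t k * (phi m ^ k) (tail t l) := by
    rw [phi_zpow_add, phi_zpow_of t l, _root_.map_mul, phi_zpow_of]
  rw [tail, this]; group

theorem tail_one_succ {n : ℕ} (h : n + 1 < m) :
    tail (⟨n + 1, h⟩ : Fin m) 1 = of ⟨n, Nat.lt_of_succ_lt h⟩ := by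
  rw [tail, zpow_one, phi_of_succ]; group

theorem tail_index_zero (h : 0 < m) (k : ℤ) : tail (⟨0, h⟩ : Fin m) k = 1 := by
  have h1 : tail (⟨0, h⟩ : Fin m) 1 = 1 := by rw [tail, zpow_one, phi_of_zero]; group
  have h2 : tail (⟨0, h⟩ : Fin m) (-1) = 1 := by
    have := tail_add (⟨0, h⟩ : Fin m) (-1) 1
    rw [h1] at this
    simpa using this.symm
  induction k with
  | zero => simp
  | succ k ih => rw [tail_add, ih, h1]; simp
  | pred k ih => rw [sub_eq_add_neg, tail_add, ih, h2]; simp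

theorem phi_zpow_mem_level (k : ℤ) {n : ℕ} {g : FreeGroup (Fin m)} (hg : g ∈ level m n) :
    (phi m ^ k) g ∈ level m n := by
  have gen1 : ∀ t : Fin m, phi m (of t) ∈ level m (t.val + 1) := by
    rintro ⟨_ | n, h⟩
    · rw [phi_of_zero]; exact of_mem_level (by simp)
    · rw [phi_of_succ]; exact mul_mem (of_mem_level (by simp)) (of_mem_level (by simp))
  have gen2 : ∀ (n : ℕ) (h : n < m), genPreimage m n h ∈ level m (n + 1) := by
    intro n
    induction n with
    | zero => intro h; exact of_mem_level (by simp)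
    | succ n ih =>
      intro h
      exact mul_mem (of_mem_level (by simp))
        (inv_mem (level_mono (by omega) (ih (Nat.lt_of_succ_lt h))))
  have gen2' : ∀ t : Fin m, (phi m)⁻¹ (of t) ∈ level m (t.val + 1) := by
    intro t
    have : (phi m)⁻¹ (of t) = genPreimage m t.1 t.2 := by
      rw [MulAut.inv_def]
      simp [phi]
    rw [this]; exact gen2 _ _
  have s1 : ∀ g ∈ level m n, phi m g ∈ level m n := by
    refine letter_induction (by simp [one_mem]) ?_ ?_
    · intro t ht g _ h; rw [_root_.map_mul]; exact mul_mem (level_mono ht (gen1 t)) h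
    · intro t ht g _ h
      rw [_root_.map_mul, _root_.map_inv]; exact mul_mem (inv_mem (level_mono ht (gen1 t))) h
  have s2 : ∀ g ∈ level m n, (phi m)⁻¹ g ∈ level m n := by
    refine letter_induction (by simp [one_mem]) ?_ ?_
    · intro t ht g _ h; rw [_root_.map_mul]; exact mul_mem (level_mono ht (gen2' t)) h
    · intro t ht g _ h
      rw [_root_.map_mul, _root_.map_inv]; exact mul_mem (inv_mem (level_mono ht (gen2' t))) h
  induction k with
  | zero => simpa using hg
  | succ k ih =>
    rw [add_comm, phi_zpow_add, zpow_one]; exact s1 _ ih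
  | pred k ih =>
    rw [sub_eq_add_neg, add_comm, phi_zpow_add, zpow_neg_one]; exact s2 _ ih

theorem tail_mem_level (t : Fin m) (k : ℤ) : tail t k ∈ level m t.val := by
  obtain ⟨_ | n, h⟩ := t
  · rw [tail_index_zero]; exact one_mem _
  · have h1 : tail (⟨n + 1, h⟩ : Fin m) 1 ∈ level m (n + 1) := by
      rw [tail_one_succ]; exact of_mem_level (by simp)
    have h2 : tail (⟨n + 1, h⟩ : Fin m) (-1) ∈ level m (n + 1) := by
      have := tail_add (⟨n + 1, h⟩ : Fin m) (-1) 1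
      simp only [Int.reduceNeg, neg_add_cancel, tail_zero] at this
      have e : tail (⟨n + 1, h⟩ : Fin m) (-1)
          = ((phi m ^ (-1 : ℤ)) (tail (⟨n + 1, h⟩ : Fin m) 1))⁻¹ := by
        rw [eq_inv_iff_mul_eq_one]; simpa using this.symm
      rw [e]; exact inv_mem (phi_zpow_mem_level _ h1)
    induction k with
    | zero => simp [one_mem]
    | succ k ih => rw [tail_add]; exact mul_mem ih (phi_zpow_mem_level _ h1)
    | pred k ih =>
      rw [sub_eq_add_neg, tail_add]; exact mul_mem ih (phi_zpow_mem_level _ h2)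

/-! ### Counting letters of top index -/

theorem count_mul_le (a : Fin m × Bool) (g h : FreeGroup (Fin m)) :
    (g * h).toWord.count a ≤ g.toWord.count a + h.toWord.count a := by
  rw [← List.count_append]
  exact (toWord_mul_sublist g h).count_le a

theorem count_inv (t : Fin m) (ε : Bool) (g : FreeGroup (Fin m)) :
    (g⁻¹).toWord.count (t, ε) = g.toWord.count (t, !ε) := by
  rw [toWord_inv]
  unfold FreeGroup.invRev
  rw [List.count_reverse]
  generalize g.toWord = w
  induction w with
  | nil => simp
  | cons l w ih =>
    obtain ⟨s, δ⟩ := l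
    simp only [List.map_cons, List.count_cons, ih]
    congr 1
    cases ε <;> cases δ <;> simp

theorem count_eq_zero_of_mem_level {t : Fin m} {ε : Bool} {g : FreeGroup (Fin m)}
    (hg : g ∈ level m t.val) : g.toWord.count (t, ε) = 0 := by
  rw [List.count_eq_zero]
  intro h
  exact lt_irrefl _ (hg _ h)

theorem count_phi_zpow_le (t : Fin m) (ε : Bool) (k : ℤ) (w : Word m)
    (hw : LettersBelow (t.val + 1) w) :
    ((phi m ^ k) (FreeGroup.mk w)).toWord.count (t, ε) ≤ w.count (t, ε) := by
  induction w with
  | nil => simp [← one_eq_mk]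
  | cons l w ih =>
    have hw' := ih (hw.subset (List.subset_cons_self _ _))
    have hl : l.1.val < t.val + 1 := hw l (by simp)
    have e : FreeGroup.mk (l :: w) = FreeGroup.mk [l] * FreeGroup.mk w := by
      rw [← mk_append]; rfl
    rw [e, _root_.map_mul, show l :: w = [l] ++ w from rfl, List.count_append]
    refine (count_mul_le _ _ _).trans (add_le_add ?_ hw')
    rcases Nat.lt_succ_iff_lt_or_eq.1 hl with h | h
    · have : (phi m ^ k) (FreeGroup.mk [l]) ∈ level m t.val := by
        apply phi_zpow_mem_level
        apply mk_mem_level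
        simpa [LettersBelow] using h
      rw [count_eq_zero_of_mem_level this]; exact Nat.zero_le _
    · obtain ⟨s, δ⟩ := l
      obtain rfl : s = t := Fin.ext h
      have hp : ∀ ε, ((phi m ^ k) (of s)).toWord.count (s, ε) ≤ [(s, true)].count (s, ε) := by
        intro ε
        rw [phi_zpow_of]
        refine (count_mul_le _ _ _).trans ?_
        rw [count_eq_zero_of_mem_level (tail_mem_level s k), toWord_of]; simp
      cases δ with
      | true => exact hp ε
      | false =>
        have e2 : FreeGroup.mk [(s, false)] = (of s)⁻¹ := by rw [of, inv_mk]; rfl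
        rw [e2, _root_.map_inv, count_inv]
        refine (hp _).trans ?_
        cases ε <;> simp

/-- Powers of `φ` preserve the number of letters of top index of each sign. -/
theorem count_phi_zpow (t : Fin m) (ε : Bool) (k : ℤ) {g : FreeGroup (Fin m)}
    (hg : g ∈ level m (t.val + 1)) :
    ((phi m ^ k) g).toWord.count (t, ε) = g.toWord.count (t, ε) := by
  apply le_antisymm
  · have := count_phi_zpow_le t ε k g.toWord hg
    rwa [mk_toWord] at this
  · have := count_phi_zpow_le t ε (-k) ((phi m ^ k) g).toWord (phi_zpow_mem_level k hg)
    rwa [mk_toWord, phi_zpow_neg_apply] at this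

theorem starts_phi_zpow_of_starts {t : Fin m} (k : ℤ) {g : FreeGroup (Fin m)}
    (hg : g ∈ level m (t.val + 1)) (hs : Starts t g) : Starts t ((phi m ^ k) g) := by
  obtain ⟨g', hg', hw⟩ := hs.exists_mul
  have hmem : g' ∈ level m (t.val + 1) := by
    intro l hl
    apply hg l
    rw [hw]; simp [hl]
  set h := tail t k * (phi m ^ k) g' with hh
  have e : (phi m ^ k) g = of t * h := by
    rw [hg', _root_.map_mul, phi_zpow_of, hh, mul_assoc]
  have hle : h.toWord.count (t, false) ≤ g'.toWord.count (t, false) := by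
    refine (count_mul_le _ _ _).trans ?_
    rw [count_eq_zero_of_mem_level (tail_mem_level t k), count_phi_zpow t _ k hmem, zero_add]
  have heq : ((phi m ^ k) g).toWord.count (t, false) = g'.toWord.count (t, false) := by
    rw [count_phi_zpow t _ k hg, hw]; simp
  obtain ⟨u, c, v, hu, hv, huv⟩ := exists_cancel (of t) h
  rw [toWord_of] at hu
  rw [e] at heq ⊢
  cases u with
  | nil =>
    simp only [List.nil_append] at hu huv
    rw [← hu] at hv
    rw [huv] at heq
    rw [hv] at hle
    simp [FreeGroup.invRev] at hle
    omega
  | cons a u =>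
    simp only [List.cons_append, List.cons.injEq] at hu
    exact ⟨u ++ v, by rw [huv, ← hu.1]; rfl⟩

/-- On words of rank at most `t`, every power of `φ` preserves and reflects the first letter
`a_t`. -/
theorem starts_phi_zpow {t : Fin m} (k : ℤ) {g : FreeGroup (Fin m)}
    (hg : g ∈ level m (t.val + 1)) : Starts t ((phi m ^ k) g) ↔ Starts t g := by
  refine ⟨fun h => ?_, starts_phi_zpow_of_starts k hg⟩
  have := starts_phi_zpow_of_starts (-k) (phi_zpow_mem_level k hg) h
  rwa [phi_zpow_neg_apply] at this

/-- A product that is cut before a letter `a_t` or after a letter `a_t⁻¹` of top index stays free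
of cancellation under the powers of `φ`. -/
theorem RP.phi_zpow {t : Fin m} (k : ℤ) {g h : FreeGroup (Fin m)} (hg : g ∈ level m (t.val + 1))
    (hh : h ∈ level m (t.val + 1)) (hr : RP g h) (hs : Starts t h ∨ Starts t g⁻¹) :
    RP ((phi m ^ k) g) ((phi m ^ k) h) := by
  have hginv : Starts t ((phi m ^ k) g)⁻¹ ↔ Starts t g⁻¹ := by
    rw [← _root_.map_inv]; exact starts_phi_zpow k (inv_mem hg)
  by_cases hs2 : Starts t g⁻¹
  · refine RP_of_starts_inv (hginv.2 hs2) ?_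
    rw [starts_phi_zpow k hh]
    exact hr.not_starts hs2
  · have h3 := hs.resolve_right hs2
    exact RP_of_starts ((starts_phi_zpow k hh).2 h3) (by rwa [hginv])

/-! ### Letters of top index and the cuts next to them -/

/-- The subsequence of the letters `a_t^{±1}` of a word. -/
def lettersAt (t : Fin m) (w : Word m) : Word m := w.filter fun l => l.1 = t

theorem lettersAt_append (t : Fin m) (u v : Word m) :
    lettersAt t (u ++ v) = lettersAt t u ++ lettersAt t v := List.filter_append ..

theorem lettersAt_eq_nil {t : Fin m} {w : Word m} (hw : LettersBelow t.val w) :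
    lettersAt t w = [] := by
  rw [lettersAt, List.filter_eq_nil_iff]
  intro l hl h
  have := hw l hl
  simp only [decide_eq_true_eq] at h
  rw [h] at this
  exact lt_irrefl _ this

theorem lettersBelow_of_lettersAt_eq_nil {t : Fin m} {w : Word m}
    (hw : LettersBelow (t.val + 1) w) (h : lettersAt t w = []) : LettersBelow t.val w := by
  intro l hl
  rcases Nat.lt_succ_iff_lt_or_eq.1 (hw l hl) with h1 | h1
  · exact h1
  · rw [lettersAt, List.filter_eq_nil_iff] at h
    exact absurd (by simpa using Fin.ext h1) (h l hl)

theorem lettersAt_mul_left {t : Fin m} {e : FreeGroup (Fin m)} (he : e ∈ level m t.val)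
    (g : FreeGroup (Fin m)) : lettersAt t (e * g).toWord = lettersAt t g.toWord := by
  obtain ⟨u, c, v, hu, hv, huv⟩ := exists_cancel e g
  have h1 : LettersBelow t.val (u ++ c) := by rw [← hu]; exact he
  have hu' : lettersAt t u = [] := lettersAt_eq_nil (h1.subset (by simp))
  have hc' : lettersAt t (invRev c) = [] :=
    lettersAt_eq_nil (LettersBelow.invRev (h1.subset (by simp)))
  rw [huv, hv, lettersAt_append, lettersAt_append, hu', hc']

/-- The powers of `φ` do not change the sequence of letters of top index. -/
theorem lettersAt_phi_zpow (t : Fin m) (k : ℤ) {g : FreeGroup (Fin m)}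
    (hg : g ∈ level m (t.val + 1)) :
    lettersAt t ((phi m ^ k) g).toWord = lettersAt t g.toWord := by
  have key : ∀ w : Word m, IsReduced w → LettersBelow (t.val + 1) w →
      lettersAt t ((phi m ^ k) (FreeGroup.mk w)).toWord = lettersAt t w := by
    intro w
    induction w with
    | nil => intro _ _; simp [← one_eq_mk]
    | cons l w ih =>
      intro hr hw
      have hw' := hw.subset (List.subset_cons_self l w)
      have ih' := ih hr.tail hw'
      have hl : l.1.val < t.val + 1 := hw l (by simp)
      have e : FreeGroup.mk (l :: w) = FreeGroup.mk [l] * FreeGroup.mk w := by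
        rw [← mk_append]; rfl
      rcases Nat.lt_succ_iff_lt_or_eq.1 hl with h | h
      · have h1 : LettersBelow t.val [l] := by simpa [LettersBelow] using h
        rw [e, _root_.map_mul, lettersAt_mul_left (phi_zpow_mem_level k (mk_mem_level h1)), ih',
          show l :: w = [l] ++ w from rfl, lettersAt_append, lettersAt_eq_nil h1]
        rfl
      · obtain ⟨s, δ⟩ := l
        obtain rfl : s = t := Fin.ext h
        cases δ with
        | true =>
          have hst : Starts s (FreeGroup.mk ((s, true) :: w)) :=
            ⟨w, toWord_mk_of_isReduced hr⟩
          obtain ⟨h', h1, h2⟩ := (starts_phi_zpow_of_starts k (mk_mem_level hw) hst).exists_mul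
          rw [h2, show (s, true) :: h'.toWord = [(s, true)] ++ h'.toWord from rfl,
            show (s, true) :: w = [(s, true)] ++ w from rfl, lettersAt_append, lettersAt_append,
            ← ih']
          congr 1
          have : h' = tail s k * (phi m ^ k) (FreeGroup.mk w) := by
            rw [e, _root_.map_mul] at h1
            have e2 : FreeGroup.mk [(s, true)] = of s := rfl
            rw [e2, phi_zpow_of, mul_assoc] at h1
            exact (mul_left_cancel h1).symm
          rw [this, lettersAt_mul_left (tail_mem_level s k)]
        | false =>
          have e2 : FreeGroup.mk [(s, false)] = (of s)⁻¹ := by rw [of, inv_mk]; rfl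
          rw [e, e2, _root_.map_mul, _root_.map_inv, phi_zpow_of, mul_inv_rev, mul_assoc,
            lettersAt_mul_left (inv_mem (tail_mem_level s k))]
          have hns : ¬ Starts s (FreeGroup.mk w) := by
            rintro ⟨v, hv⟩
            rw [toWord_mk_of_isReduced (show IsReduced w from hr.tail)] at hv
            rw [hv] at hr
            simp at hr
          have hrp : RP (of s)⁻¹ ((phi m ^ k) (FreeGroup.mk w)) := by
            refine RP_of_starts_inv (t := s) ⟨[], by simp⟩ ?_
            rwa [starts_phi_zpow k (mk_mem_level hw')]
          rw [hrp, lettersAt_append, ih', toWord_inv, toWord_of,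
            show (s, false) :: w = [(s, false)] ++ w from rfl, lettersAt_append]
          rfl
  have := key g.toWord isReduced_toWord hg
  rwa [mk_toWord] at this

/-- The number of letters `a_t^{±1}` of a word. -/
def numAt (t : Fin m) (w : Word m) : ℕ := (lettersAt t w).length

@[simp] theorem numAt_nil (t : Fin m) : numAt t ([] : Word m) = 0 := rfl

theorem numAt_append (t : Fin m) (u v : Word m) : numAt t (u ++ v) = numAt t u + numAt t v := by
  simp [numAt, lettersAt_append]

theorem numAt_cons_self {t : Fin m} {l : Fin m × Bool} (h : l.1 = t) (w : Word m) :
    numAt t (l :: w) = numAt t w + 1 := by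
  simp [numAt, lettersAt, h]

theorem numAt_cons_ne {t : Fin m} {l : Fin m × Bool} (h : l.1 ≠ t) (w : Word m) :
    numAt t (l :: w) = numAt t w := by
  simp [numAt, lettersAt, h]

theorem numAt_invRev (t : Fin m) (w : Word m) : numAt t (invRev w) = numAt t w := by
  induction w with
  | nil => rfl
  | cons l w ih =>
    rw [invRev_cons, numAt_append, ih, show l :: w = [l] ++ w from rfl, numAt_append, add_comm]
    congr 1
    by_cases h : l.1 = t
    · simp [invRev, numAt, lettersAt, h]
    · simp [invRev, numAt, lettersAt, h]

/-- The prefix of a word up to its `k`-th letter `a_t^{±1}` (counted from `0`), where this letter is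
included if its exponent is `-1` and excluded if its exponent is `1`; the whole word if there are
not so many letters `a_t^{±1}`. -/
def cutAt (t : Fin m) : ℕ → Word m → Word m
  | _, [] => []
  | 0, l :: w => if l.1 = t then (if l.2 then [] else [l]) else l :: cutAt t 0 w
  | k + 1, l :: w => if l.1 = t then l :: cutAt t k w else l :: cutAt t (k + 1) w

theorem cutAt_cons_ne {t : Fin m} {l : Fin m × Bool} (h : l.1 ≠ t) (k : ℕ) (w : Word m) :
    cutAt t k (l :: w) = l :: cutAt t k w := by
  cases k <;> simp [cutAt, h]

theorem cutAt_succ_cons_self {t : Fin m} {l : Fin m × Bool} (h : l.1 = t) (k : ℕ) (w : Word m) :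
    cutAt t (k + 1) (l :: w) = l :: cutAt t k w := by
  simp [cutAt, h]

theorem cutAt_prefix (t : Fin m) (w : Word m) : ∀ k, cutAt t k w <+: w := by
  induction w with
  | nil => intro k; cases k <;> simp [cutAt]
  | cons l w ih =>
    intro k
    by_cases h : l.1 = t
    · cases k with
      | zero =>
        by_cases h2 : l.2
        · simp [cutAt, h, h2]
        · simp [cutAt, h, h2]
      | succ k => rw [cutAt_succ_cons_self h]; simpa using ih k
    · rw [cutAt_cons_ne h]; simpa using ih k

theorem cutAt_append (t : Fin m) (u v : Word m) (k : ℕ) :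
    cutAt t (numAt t u + k) (u ++ v) = u ++ cutAt t k v := by
  induction u with
  | nil => simp
  | cons l u ih =>
    by_cases h : l.1 = t
    · rw [numAt_cons_self h, show numAt t u + 1 + k = numAt t u + k + 1 by omega, List.cons_append,
        cutAt_succ_cons_self h, ih, List.cons_append]
    · rw [numAt_cons_ne h, List.cons_append, cutAt_cons_ne h, ih, List.cons_append]

theorem cutAt_append_of_lt (t : Fin m) (u v : Word m) :
    ∀ k, k < numAt t u → cutAt t k (u ++ v) = cutAt t k u := by
  induction u with
  | nil => intro k hk; simp at hk
  | cons l u ih =>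
    intro k hk
    by_cases h : l.1 = t
    · cases k with
      | zero => simp [cutAt, h]
      | succ k =>
        rw [numAt_cons_self h] at hk
        rw [List.cons_append, cutAt_succ_cons_self h, cutAt_succ_cons_self h, ih k (by omega)]
    · rw [numAt_cons_ne h] at hk
      rw [List.cons_append, cutAt_cons_ne h, cutAt_cons_ne h, ih k hk]

theorem cutAt_mono (t : Fin m) (w : Word m) :
    ∀ k k', k ≤ k' → cutAt t k w <+: cutAt t k' w := by
  induction w with
  | nil => intro k k' _; cases k <;> simp [cutAt]
  | cons l w ih =>
    intro k k' hk
    by_cases h : l.1 = t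
    · cases k with
      | zero =>
        cases k' with
        | zero => exact List.prefix_rfl
        | succ k' =>
          rw [cutAt_succ_cons_self h]
          by_cases h2 : l.2 <;> simp [cutAt, h, h2]
      | succ k =>
        obtain ⟨k', rfl⟩ : ∃ j, k' = j + 1 := ⟨k' - 1, by omega⟩
        rw [cutAt_succ_cons_self h, cutAt_succ_cons_self h]
        simpa using ih k k' (by omega)
    · rw [cutAt_cons_ne h, cutAt_cons_ne h]
      simpa using ih k k' hk

/-- The cut is taken after a letter `a_t⁻¹` or before a letter `a_t`. -/
theorem cutAt_spec (t : Fin m) (w : Word m) : ∀ k, k < numAt t w →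
    ∃ r, w = cutAt t k w ++ r ∧
      ((∃ c, cutAt t k w = c ++ [(t, false)] ∧ numAt t c = k) ∨
        (∃ r', r = (t, true) :: r' ∧ numAt t (cutAt t k w) = k)) := by
  induction w with
  | nil => intro k hk; simp at hk
  | cons l w ih =>
    intro k hk
    by_cases h : l.1 = t
    · cases k with
      | zero =>
        obtain ⟨s, δ⟩ := l
        simp only at h
        subst h
        cases δ with
        | true => exact ⟨(s, true) :: w, by simp [cutAt], Or.inr ⟨w, rfl, by simp [cutAt]⟩⟩
        | false => exact ⟨w, by simp [cutAt], Or.inl ⟨[], by simp [cutAt]⟩⟩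
      | succ k =>
        rw [numAt_cons_self h] at hk
        obtain ⟨r, hr, h1⟩ := ih k (by omega)
        rw [cutAt_succ_cons_self h]
        refine ⟨r, by rw [List.cons_append, ← hr], ?_⟩
        rcases h1 with ⟨c, hc, hn⟩ | ⟨r', hr', hn⟩
        · exact Or.inl ⟨l :: c, by rw [hc]; rfl, by rw [numAt_cons_self h, hn]⟩
        · exact Or.inr ⟨r', hr', by rw [numAt_cons_self h, hn]⟩
    · rw [numAt_cons_ne h] at hk
      obtain ⟨r, hr, h1⟩ := ih k hk
      rw [cutAt_cons_ne h]
      refine ⟨r, by rw [List.cons_append, ← hr], ?_⟩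
      rcases h1 with ⟨c, hc, hn⟩ | ⟨r', hr', hn⟩
      · exact Or.inl ⟨l :: c, by rw [hc]; rfl, by rw [numAt_cons_ne h, hn]⟩
      · exact Or.inr ⟨r', hr', by rw [numAt_cons_ne h, hn]⟩

/-- Cuts are natural with respect to the powers of `φ`. -/
theorem cutAt_phi_zpow {t : Fin m} (n : ℤ) {g : FreeGroup (Fin m)} (hg : g ∈ level m (t.val + 1))
    {k : ℕ} (hk : k < numAt t g.toWord) :
    ((phi m ^ n) (FreeGroup.mk (cutAt t k g.toWord))).toWord
      = cutAt t k ((phi m ^ n) g).toWord := by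
  obtain ⟨r, hr, h1⟩ := cutAt_spec t g.toWord k hk
  set c := cutAt t k g.toWord with hc
  have hred : IsReduced (c ++ r) := by rw [← hr]; exact isReduced_toWord
  have hcr := hg
  rw [mem_level, hr] at hcr
  have hcm : FreeGroup.mk c ∈ level m (t.val + 1) := mk_mem_level (hcr.subset (by simp))
  have hrm : FreeGroup.mk r ∈ level m (t.val + 1) := mk_mem_level (hcr.subset (by simp))
  have ge : g = FreeGroup.mk c * FreeGroup.mk r := by
    rw [← mk_append, ← hr, mk_toWord]
  have hcw := toWord_mk_of_isReduced hred.left_of_append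
  have hrw := toWord_mk_of_isReduced hred.right_of_append
  have hnum : ∀ g ∈ level m (t.val + 1), numAt t ((phi m ^ n) g).toWord = numAt t g.toWord := by
    intro g hg; rw [numAt, lettersAt_phi_zpow t n hg]; rfl
  rcases h1 with ⟨d, hd, hn⟩ | ⟨r', hr', hn⟩
  · have hs : Starts t (FreeGroup.mk c)⁻¹ := starts_inv_iff.2 ⟨d, by rw [hcw, hd]⟩
    have hrp := (RP_mk hred).phi_zpow n hcm hrm (Or.inr hs)
    rw [ge, _root_.map_mul, hrp]
    have hs' : Starts t ((phi m ^ n) (FreeGroup.mk c))⁻¹ := by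
      rw [← _root_.map_inv]; exact (starts_phi_zpow n (inv_mem hcm)).2 hs
    obtain ⟨d', hd'⟩ := starts_inv_iff.1 hs'
    have hn' : numAt t d' = k := by
      have h2 := hnum _ hcm
      rw [hcw, hd', hd, numAt_append, numAt_append] at h2
      omega
    rw [hd', List.append_assoc, ← hn', ← Nat.add_zero (numAt t d'), cutAt_append]
    simp [cutAt]
  · have hs : Starts t (FreeGroup.mk r) := ⟨r', by rw [hrw, hr']⟩
    have hrp := (RP_mk hred).phi_zpow n hcm hrm (Or.inl hs)
    rw [ge, _root_.map_mul, hrp]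
    obtain ⟨d', hd'⟩ := (starts_phi_zpow n hrm).2 hs
    have h2 := hnum _ hcm
    rw [hcw, hn] at h2
    rw [hd']
    have h3 := cutAt_append t ((phi m ^ n) (FreeGroup.mk c)).toWord ((t, true) :: d') 0
    rw [h2, Nat.add_zero] at h3
    rw [h3]
    simp [cutAt]

/-! ### Letters of small index next to a letter of large index -/

theorem RP_of_mem_level {n : ℕ} {g h : FreeGroup (Fin m)} (hg : g ∈ level m n)
    (hh : ∀ l ∈ h.toWord.head?, n ≤ l.1.val) : RP g h := by
  apply RP_of_isReduced
  refine List.IsChain.append isReduced_toWord isReduced_toWord ?_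
  intro x hx y hy hxy
  have h1 := hg x (List.mem_of_getLast? hx)
  have h2 := hh y hy
  rw [hxy] at h1
  omega

theorem exists_first {α : Type*} (p : α → Prop) (w : List α) (h : ∃ a ∈ w, p a) :
    ∃ u a v, w = u ++ a :: v ∧ p a ∧ ∀ x ∈ u, ¬ p x := by
  induction w with
  | nil => simp at h
  | cons b w ih =>
    by_cases hb : p b
    · exact ⟨[], b, w, rfl, hb, by simp⟩
    · obtain ⟨a, ha, hpa⟩ := h
      have : a ∈ w := by
        rcases List.mem_cons.1 ha with rfl | h
        · exact absurd hpa hb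
        · exact h
      obtain ⟨u, a, v, rfl, h1, h2⟩ := ih ⟨a, this, hpa⟩
      refine ⟨b :: u, a, v, rfl, h1, ?_⟩
      intro x hx
      rcases List.mem_cons.1 hx with rfl | h
      exacts [hb, h2 x h]

theorem exists_split_level (n : ℕ) (w : Word m) :
    ∃ u v, w = u ++ v ∧ LettersBelow n u ∧ ∀ l ∈ v.head?, n ≤ l.1.val := by
  by_cases h : ∃ a ∈ w, n ≤ a.1.val
  · obtain ⟨u, a, v, rfl, h1, h2⟩ := exists_first (fun a : Fin m × Bool => n ≤ a.1.val) w h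
    exact ⟨u, a :: v, rfl, fun l hl => not_le.1 (h2 l hl), by simpa using h1⟩
  · push Not at h
    exact ⟨w, [], by simp, h, by simp⟩

/-- If a reduced word begins with a letter of index above `b`, then in its image under `φ` the first
letter of index above `b` is preceded by nothing, or by the letter `a_b⁻¹`. In the first case the word does
not begin with `a_{b+1}⁻¹`; in the second case the first letter of index above `b` in the image is
`a_{b+1}⁻¹`, so that a further application of `φ` leads to the second case again. -/
theorem phi_head_above (b : Fin m) : ∀ (c : ℕ) (g : FreeGroup (Fin m)), g ∈ level m c →
    ∀ l w, g.toWord = l :: w → b.val < l.1.val →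
    ∃ q l' w', (phi m g).toWord = q ++ l' :: w' ∧ b.val < l'.1.val ∧
      ((q = [] ∧ ¬ (l.1.val = b.val + 1 ∧ l.2 = false)) ∨
        (q = [(b, false)] ∧ l'.1.val = b.val + 1 ∧ l'.2 = false)) := by
  intro c
  induction c with
  | zero =>
    intro g hg l w hl _
    exact absurd (hg l (by rw [hl]; simp)) (by omega)
  | succ c ih =>
    intro g hg l w hl hbl
    by_cases hex : ∃ a ∈ g.toWord, c ≤ a.1.val
    swap
    · push Not at hex
      exact ih g hex l w hl hbl
    obtain ⟨f, ⟨t, ε⟩, v, hfv, htc, hf⟩ :=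
      exists_first (fun a : Fin m × Bool => c ≤ a.1.val) g.toWord hex
    have ht : t.val = c := by
      have := hg (t, ε) (by rw [hfv]; simp)
      simp only at this htc
      omega
    have hfm : FreeGroup.mk f ∈ level m c := mk_mem_level fun l hl => not_le.1 (hf l hl)
    have hred : IsReduced (f ++ (t, ε) :: v) := by rw [← hfv]; exact isReduced_toWord
    have hbelow := hg
    rw [mem_level, hfv, ← ht] at hbelow
    have ge : g = FreeGroup.mk f * FreeGroup.mk ((t, ε) :: v) := by
      rw [← mk_append, ← hfv, mk_toWord]
    have hgm : FreeGroup.mk ((t, ε) :: v) ∈ level m (t.val + 1) :=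
      mk_mem_level (hbelow.subset (by simp))
    have hvm : FreeGroup.mk v ∈ level m (t.val + 1) := mk_mem_level (hbelow.subset (by simp))
    have hbc : b.val < c := by
      cases f with
      | nil =>
        rw [hl] at hfv
        simp only [List.nil_append, List.cons.injEq] at hfv
        rw [hfv.1] at hbl
        simpa [ht] using hbl
      | cons a f =>
        rw [hl] at hfv
        simp only [List.cons_append, List.cons.injEq] at hfv
        have := hf a (by simp)
        rw [← hfv.1] at this
        omega
    obtain ⟨c', rfl⟩ : ∃ c', c = c' + 1 := ⟨c - 1, by omega⟩
    have hc'm : c' < m := by have := t.isLt; omega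
    have hphit : phi m (of t) = of t * of ⟨c', hc'm⟩ := by
      obtain ⟨tv, htv⟩ := t
      simp only at ht
      subst ht
      exact phi_of_succ htv
    set s : Fin m := ⟨c', hc'm⟩ with hs
    cases ε with
    | true =>
      have hst : Starts t (FreeGroup.mk ((t, true) :: v)) :=
        ⟨v, toWord_mk_of_isReduced hred.right_of_append⟩
      have h2 := starts_phi_zpow_of_starts 1 hgm hst
      rw [zpow_one] at h2
      obtain ⟨v', hv'⟩ := h2
      have hrp := (RP_mk hred).phi_zpow (t := t) 1 (level_mono (by omega) hfm) hgm (Or.inl hst)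
      rw [zpow_one] at hrp
      rw [ge, _root_.map_mul, hrp, hv']
      cases f with
      | nil =>
        refine ⟨[], (t, true), v', by simp [← one_eq_mk], by simp only; omega, Or.inl ⟨rfl, ?_⟩⟩
        rw [hl] at hfv
        simp only [List.nil_append, List.cons.injEq] at hfv
        rw [hfv.1]; simp
      | cons a f =>
        obtain rfl : l = a := by
          rw [hl] at hfv
          simp only [List.cons_append, List.cons.injEq] at hfv
          exact hfv.1
        have ha := hbl
        obtain ⟨q, l', w', h1, h2, h3⟩ := ih (FreeGroup.mk (l :: f)) hfm
          l f (toWord_mk_of_isReduced hred.left_of_append) ha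
        exact ⟨q, l', w' ++ (t, true) :: v', by rw [h1]; simp, h2, h3⟩
    | false =>
      have e1 : FreeGroup.mk ((t, false) :: v) = (of t)⁻¹ * FreeGroup.mk v := by
        rw [of, inv_mk, mul_mk]; rfl
      have hns : ¬ Starts t (FreeGroup.mk v) := by
        rintro ⟨x, hx⟩
        have h4 := hred.right_of_append
        rw [toWord_mk_of_isReduced (show IsReduced v from h4.tail)] at hx
        rw [hx] at h4
        simp at h4
      have hrp : RP (of t)⁻¹ (phi m (FreeGroup.mk v)) := by
        refine RP_of_starts_inv (t := t) ⟨[], by simp⟩ ?_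
        have := starts_phi_zpow 1 hvm
        rw [zpow_one] at this
        rwa [this]
      have hw1 : ((of t)⁻¹ * phi m (FreeGroup.mk v)).toWord
          = (t, false) :: (phi m (FreeGroup.mk v)).toWord := by
        rw [hrp, toWord_inv, toWord_of]; rfl
      have hsm : (of s)⁻¹ ∈ level m (c' + 1) := inv_mem (of_mem_level (by simp [hs]))
      have ge2 : phi m g = (phi m (FreeGroup.mk f) * (of s)⁻¹) *
          ((of t)⁻¹ * phi m (FreeGroup.mk v)) := by
        rw [ge, e1, _root_.map_mul, _root_.map_mul, _root_.map_inv, hphit]; group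
      have hphif : phi m (FreeGroup.mk f) ∈ level m (c' + 1) := by
        have := phi_zpow_mem_level 1 hfm
        rwa [zpow_one] at this
      have hrp2 : RP (phi m (FreeGroup.mk f) * (of s)⁻¹)
          ((of t)⁻¹ * phi m (FreeGroup.mk v)) := by
        refine RP_of_mem_level (mul_mem hphif hsm) ?_
        rw [hw1]; simp [ht]
      rw [ge2, hrp2, hw1]
      cases f with
      | nil =>
        have e3 : (phi m (FreeGroup.mk ([] : Word m)) * (of s)⁻¹).toWord = [(s, false)] := by
          rw [← one_eq_mk, _root_.map_one, one_mul, toWord_inv, toWord_of]; rfl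
        rw [e3]
        by_cases hsb : s = b
        · have : t.val = b.val + 1 := by rw [← hsb, ht]
          exact ⟨[(b, false)], (t, false), _, by rw [hsb], by simp only; omega,
            Or.inr ⟨rfl, this, rfl⟩⟩
        · have h5 : s.val ≠ b.val := fun h => hsb (Fin.ext h)
          simp only [hs] at h5
          refine ⟨[], (s, false), _, rfl, ?_, Or.inl ⟨rfl, ?_⟩⟩
          · simp only [hs]
            omega
          · rw [hl] at hfv
            simp only [List.nil_append, List.cons.injEq] at hfv
            rw [hfv.1]
            simp only
            omega
      | cons a f =>
        obtain rfl : l = a := by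
          rw [hl] at hfv
          simp only [List.cons_append, List.cons.injEq] at hfv
          exact hfv.1
        have ha := hbl
        obtain ⟨q, l', w', h1, h2, h3⟩ := ih (FreeGroup.mk (l :: f)) hfm
          l f (toWord_mk_of_isReduced hred.left_of_append) ha
        obtain ⟨u, d, z, hu, hz, huz⟩ := exists_cancel (phi m (FreeGroup.mk (l :: f))) (of s)⁻¹
        rw [huz]
        rw [h1] at hu
        rw [toWord_inv, toWord_of] at hz
        rcases List.eq_nil_or_concat d with rfl | ⟨d', x, rfl⟩
        · simp only [List.append_nil] at hu
          exact ⟨q, l', w' ++ z ++ (t, false) :: (phi m (FreeGroup.mk v)).toWord,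
            by rw [← hu]; simp, h2, h3⟩
        · have hd' : d' = [] ∧ z = [] ∧ x = (s, true) := by
            rw [List.concat_eq_append, invRev_append, List.append_assoc] at hz
            obtain ⟨x1, x2⟩ := x
            simp only [FreeGroup.invRev, List.map_cons, List.map_nil, List.reverse_cons,
              List.reverse_nil, List.nil_append, Bool.not_true, List.cons_append,
              List.cons.injEq, Prod.mk.injEq] at hz
            obtain ⟨⟨h6, h7⟩, h8⟩ := hz
            have := congrArg List.length h8
            simp only [List.length_nil, List.length_append, List.length_reverse,
              List.length_map] at this
            refine ⟨List.length_eq_zero_iff.1 (by omega), List.length_eq_zero_iff.1 (by omega), ?_⟩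
            cases x2 with
            | true => rw [h6]
            | false => simp at h7
          obtain ⟨rfl, rfl, rfl⟩ := hd'
          simp only [List.nil_append, List.concat_eq_append, List.append_nil] at hu ⊢
          rcases List.eq_nil_or_concat w' with rfl | ⟨w'', y, rfl⟩
          · have h6 := List.append_inj' hu (by simp)
            refine ⟨q, (t, false), _, by rw [h6.1], by simp only; omega, ?_⟩
            rcases h3 with h3 | h3
            · exact Or.inl h3
            · have h7 := h3.2.2
              simp only [List.cons.injEq, and_true] at h6
              rw [h6.2] at h7
              simp at h7
          · rw [List.concat_eq_append, ← List.cons_append, ← List.append_assoc] at hu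
            have := List.append_inj' hu (by simp)
            exact ⟨q, l', w'' ++ (t, false) :: (phi m (FreeGroup.mk v)).toWord,
              by rw [← this.1]; simp, h2, h3⟩

/-- If a reduced word is empty or begins with a letter of index at least `t`, then in its image
under `φ^{-p}` the part before the first letter of index at least `t` is `φ^{-p}(a_t⁻¹ φ^e(a_t))` for
some `0 ≤ e ≤ p`. -/
theorem phi_neg_head_tail (t : Fin m) (p : ℕ) {g : FreeGroup (Fin m)}
    (hg : ∀ l ∈ g.toWord.head?, t.val ≤ l.1.val) :
    ∃ (c τ : Word m) (e : ℕ), ((phi m ^ (-(p : ℤ))) g).toWord = c ++ τ ∧ LettersBelow t.val c ∧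
      (∀ l ∈ τ.head?, t.val ≤ l.1.val) ∧ e ≤ p ∧
      FreeGroup.mk c = (phi m ^ (-(p : ℤ))) (tail t e) := by
  obtain ⟨c, τ, hcτ, hc, hτ⟩ := exists_split_level t.val ((phi m ^ (-(p : ℤ))) g).toWord
  have hred : IsReduced (c ++ τ) := by rw [← hcτ]; exact isReduced_toWord
  suffices h : ∃ e : ℕ, e ≤ p ∧ FreeGroup.mk c = (phi m ^ (-(p : ℤ))) (tail t e) by
    obtain ⟨e, h1, h2⟩ := h
    exact ⟨c, τ, e, hcτ, hc, hτ, h1, h2⟩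
  obtain ⟨_ | b, htb⟩ := t
  · refine ⟨0, Nat.zero_le _, ?_⟩
    cases c with
    | nil => simp [← one_eq_mk]
    | cons l c => exact absurd (hc l (by simp)) (by simp)
  set t : Fin m := ⟨b + 1, htb⟩ with ht
  set s : Fin m := ⟨b, Nat.lt_of_succ_lt htb⟩ with hs
  have iter : ∀ k : ℕ, ∃ (j : ℕ) (τ' : Word m), j ≤ k ∧ IsReduced τ' ∧
      (∀ l ∈ τ'.head?, t.val ≤ l.1.val) ∧
      (0 < j → ∃ l ∈ τ'.head?, l.1.val = b + 1 ∧ l.2 = false) ∧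
      (phi m ^ (k : ℤ)) (FreeGroup.mk τ) = (tail t j)⁻¹ * FreeGroup.mk τ' := by
    intro k
    induction k with
    | zero => exact ⟨0, τ, le_rfl, hred.right_of_append, hτ, by simp, by simp⟩
    | succ k ih =>
      obtain ⟨j, τ', hj, hr, hh, hj0, he⟩ := ih
      have e1 : (phi m ^ ((k + 1 : ℕ) : ℤ)) (FreeGroup.mk τ)
          = ((phi m ^ (1 : ℤ)) (tail t j))⁻¹ * phi m (FreeGroup.mk τ') := by
        rw [Nat.cast_add, add_comm, phi_zpow_add, he, _root_.map_mul]; simp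
      cases τ' with
      | nil =>
        have hj00 : j = 0 := by
          by_contra h
          obtain ⟨l, hl, _⟩ := hj0 (by omega)
          simp at hl
        refine ⟨0, [], Nat.zero_le _, IsReduced.nil, by simp, by simp, ?_⟩
        rw [e1, hj00, ← one_eq_mk, _root_.map_one]
        simp
      | cons l w =>
        obtain ⟨q, l', w', h1, h2, h3⟩ := phi_head_above s m (FreeGroup.mk (l :: w))
          (mem_level_self _) l w (toWord_mk_of_isReduced hr) (hh l (by simp))
        have hr' : IsReduced (q ++ l' :: w') := by rw [← h1]; exact isReduced_toWord
        rcases h3 with ⟨rfl, h3⟩ | ⟨rfl, h3, h4⟩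
        · have hj00 : j = 0 := by
            by_contra h
            obtain ⟨l1, hl1, h5⟩ := hj0 (by omega)
            simp only [List.head?_cons, Option.mem_def, Option.some.injEq] at hl1
            subst hl1
            exact h3 h5
          refine ⟨0, l' :: w', Nat.zero_le _, hr', ?_, by simp, ?_⟩
          · simp only [List.head?_cons, Option.mem_def, Option.some.injEq, forall_eq']
            exact h2
          · rw [e1, hj00, ← mk_toWord (x := phi m (FreeGroup.mk (l :: w))), h1]
            simp
        · refine ⟨j + 1, l' :: w', by omega, hr'.right_of_append, ?_, ?_, ?_⟩
          · simp only [List.head?_cons, Option.mem_def, Option.some.injEq, forall_eq']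
            exact h2
          · intro _
            exact ⟨l', by simp, h3, h4⟩
          · have e2 : FreeGroup.mk [(s, false)] = (of s)⁻¹ := by rw [of, inv_mk]; rfl
            rw [e1, ← mk_toWord (x := phi m (FreeGroup.mk (l :: w))), h1, mk_append, e2,
              Nat.cast_add, add_comm, tail_add, Nat.cast_one, ht, tail_one_succ htb, ← hs]
            group
  obtain ⟨j, τ', hj, hr, hh, -, he⟩ := iter p
  refine ⟨j, hj, ?_⟩
  have hcm := mk_mem_level hc
  have e1 : g = ((phi m ^ (p : ℤ)) (FreeGroup.mk c) * (tail t j)⁻¹) * FreeGroup.mk τ' := by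
    have : g = (phi m ^ (p : ℤ)) ((phi m ^ (-(p : ℤ))) g) := by rw [phi_zpow_apply_neg]
    rw [this, ← mk_toWord (x := (phi m ^ (-(p : ℤ))) g), hcτ, mk_append, _root_.map_mul, he,
      mul_assoc]
  have hm := mul_mem (phi_zpow_mem_level (p : ℤ) hcm) (inv_mem (tail_mem_level t j))
  have hrp := RP_of_mem_level hm (h := FreeGroup.mk τ') (by rwa [toWord_mk_of_isReduced hr])
  have hone : (phi m ^ (p : ℤ)) (FreeGroup.mk c) * (tail t j)⁻¹ = 1 := by
    rw [← toWord_eq_nil_iff]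
    rw [RP, ← e1] at hrp
    cases hx : ((phi m ^ (p : ℤ)) (FreeGroup.mk c) * (tail t j)⁻¹).toWord with
    | nil => rfl
    | cons a v =>
      have h5 := hm a (by rw [hx]; simp)
      have h6 := hg a (by rw [hrp, hx]; simp)
      omega
  rw [← mul_inv_eq_one.1 hone, phi_zpow_neg_apply]

/-- For nonnegative exponents, `a_{n+1}⁻¹ φ^e(a_{n+1})` contains `a_n` only with exponent `1`. -/
theorem count_tail_succ {n : ℕ} (h : n + 1 < m) (e : ℕ) :
    (tail (⟨n + 1, h⟩ : Fin m) e).toWord.count (⟨n, Nat.lt_of_succ_lt h⟩, false) = 0 := by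
  induction e with
  | zero => simp
  | succ e ih =>
    rw [Nat.cast_add, add_comm (e : ℤ), tail_add, Nat.cast_one, tail_one_succ]
    have h1 := count_mul_le (⟨n, Nat.lt_of_succ_lt h⟩, false) (of ⟨n, Nat.lt_of_succ_lt h⟩)
      ((phi m ^ (1 : ℤ)) (tail (⟨n + 1, h⟩ : Fin m) e))
    rw [count_phi_zpow _ _ 1 (tail_mem_level (⟨n + 1, h⟩ : Fin m) e), ih] at h1
    simpa using h1

/-- If a reduced word is empty or begins with a letter of index above `b`, then in its image under
`φ^{-p}` the part before the first letter of index above `b` contains `a_b` only with exponent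
`1`. -/
theorem phi_neg_head_above (b : Fin m) (p : ℕ) {g : FreeGroup (Fin m)}
    (hg : ∀ l ∈ g.toWord.head?, b.val + 1 ≤ l.1.val) :
    ∃ c τ, ((phi m ^ (-(p : ℤ))) g).toWord = c ++ τ ∧ LettersBelow (b.val + 1) c ∧
      (b, false) ∉ c ∧ ∀ l ∈ τ.head?, b.val + 1 ≤ l.1.val := by
  by_cases hb : b.val + 1 < m
  · obtain ⟨c, τ, e, h1, h2, h3, -, h4⟩ := phi_neg_head_tail ⟨b.val + 1, hb⟩ p hg
    refine ⟨c, τ, h1, h2, ?_, h3⟩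
    have hr : IsReduced (c ++ τ) := by rw [← h1]; exact isReduced_toWord
    rw [← List.count_eq_zero, ← toWord_mk_of_isReduced hr.left_of_append, h4,
      count_phi_zpow b false _ (tail_mem_level ⟨b.val + 1, hb⟩ e), count_tail_succ hb]
  · refine ⟨[], [], ?_, by simp [LettersBelow], by simp, by simp⟩
    have : g = 1 := by
      rw [← toWord_eq_nil_iff]
      cases h : g.toWord with
      | nil => rfl
      | cons l w =>
        rw [h] at hg
        have h1 := hg l (by simp)
        have := l.1.isLt
        omega
    rw [this]; simp

theorem phiWord_of_mul (k : ℤ) (u : Word m) :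
    phiWord k u = ((phi m ^ k) (FreeGroup.mk u)).toWord := rfl

/-- If the image under `φ^{-p}` of a reduced word `L y ρ` has a prefix `w y`, where `L`, `y`, `w`
have rank at most that of `a_b` and `w` contains as many letters `a_b^{±1}` as `L`, then the cuts at
the last letter `a_b^{±1}` of the two copies of `y` correspond to each other. -/
theorem phiWord_cutAt_eq (b : Fin m) (p : ℕ) {L y ρ w rest : Word m}
    (hr : IsReduced (L ++ y ++ ρ)) (hL : LettersBelow (b.val + 1) L)
    (hy : LettersBelow (b.val + 1) y) (hw : LettersBelow (b.val + 1) w)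
    (hnum : numAt b w = numAt b L) (hn : 0 < numAt b y)
    (heq : phiWord (-(p : ℤ)) (L ++ y ++ ρ) = w ++ y ++ rest) :
    phiWord (-(p : ℤ)) (L ++ cutAt b (numAt b y - 1) y) = w ++ cutAt b (numAt b y - 1) y := by
  obtain ⟨r, σ, rfl, hrb, hσ⟩ := exists_split_level (b.val + 1) ρ
  rw [← List.append_assoc] at hr heq
  set g := FreeGroup.mk (L ++ y ++ r) with hg
  have hgm : g ∈ level m (b.val + 1) := mk_mem_level ((hL.append hy).append hrb)
  have hgw : g.toWord = L ++ y ++ r := toWord_mk_of_isReduced hr.left_of_append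
  obtain ⟨c, τ, hcτ, hc, hcneg, hτ⟩ := phi_neg_head_above b p (g := FreeGroup.mk σ)
    (by rwa [toWord_mk_of_isReduced hr.right_of_append])
  have hcτr : IsReduced (c ++ τ) := by rw [← hcτ]; exact isReduced_toWord
  set ψ := phi m ^ (-(p : ℤ)) with hψ
  have hcw := toWord_mk_of_isReduced hcτr.left_of_append
  have hKm : ψ g * FreeGroup.mk c ∈ level m (b.val + 1) :=
    mul_mem (phi_zpow_mem_level _ hgm) (mk_mem_level hc)
  have hK : RP (ψ g * FreeGroup.mk c) (FreeGroup.mk τ) :=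
    RP_of_mem_level hKm (by rwa [toWord_mk_of_isReduced hcτr.right_of_append])
  have hall : phiWord (-(p : ℤ)) (L ++ y ++ r ++ σ) = (ψ g * FreeGroup.mk c).toWord ++ τ := by
    rw [phiWord_of_mul, mk_append, _root_.map_mul, ← hψ, ← hg,
      ← mk_toWord (x := ψ (FreeGroup.mk σ)), hcτ, mk_append, ← mul_assoc, hK,
      toWord_mk_of_isReduced hcτr.right_of_append]
  obtain ⟨κ₁, d, κ₂, h1, h2, h3⟩ := exists_cancel (ψ g) (FreeGroup.mk c)
  rw [hcw] at h2
  have hpre : w ++ y <+: κ₁ ++ κ₂ := by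
    rw [hall, h3] at heq
    have p1 : w ++ y <+: κ₁ ++ κ₂ ++ τ := ⟨rest, heq.symm⟩
    have p2 : κ₁ ++ κ₂ <+: κ₁ ++ κ₂ ++ τ := ⟨τ, rfl⟩
    rcases List.prefix_or_prefix_of_prefix p1 p2 with h | ⟨v, hv⟩
    · exact h
    · cases v with
      | nil => rw [← hv]; simp
      | cons a v =>
        exfalso
        have h5 : a.1.val < b.val + 1 := (hw.append hy) a (by rw [← hv]; simp)
        rw [← hv] at heq
        have : τ = a :: v ++ rest := by simpa [List.append_assoc] using heq
        have h6 := hτ a (by rw [this]; simp)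
        omega
  obtain ⟨v, hv⟩ := hpre
  set n := numAt b y with hndef
  by_cases hcase : numAt b L + (n - 1) < numAt b κ₁
  · have e1 : cutAt b (numAt b L + (n - 1)) (ψ g).toWord = w ++ cutAt b (n - 1) y := by
      rw [h1, cutAt_append_of_lt _ _ _ _ hcase, ← cutAt_append_of_lt _ _ κ₂ _ hcase, ← hv,
        ← hnum, List.append_assoc, cutAt_append, cutAt_append_of_lt _ _ _ _ (by omega)]
    rw [← e1, hψ, ← cutAt_phi_zpow _ hgm (by rw [hgw, numAt_append, numAt_append]; omega), hgw,
      List.append_assoc, cutAt_append, cutAt_append_of_lt _ _ _ _ (by omega)]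
    rfl
  · -- The last letter `a_b^{±1}` of `y` would cancel against `c` and reappear from `c`, so that both
    -- signs of it would occur in `c`.
    exfalso
    obtain ⟨a, ha⟩ : ∃ a, (lettersAt b y)[n - 1]? = some a :=
      ⟨_, List.getElem?_eq_getElem (by show n - 1 < n; omega)⟩
    have hlen : (lettersAt b κ₁).length ≤ numAt b L + (n - 1) := not_lt.1 hcase
    have g1 : (lettersAt b d)[numAt b L + (n - 1) - (lettersAt b κ₁).length]? = some a := by
      have := lettersAt_phi_zpow b (-(p : ℤ)) hgm
      rw [← hψ, h1, hgw, lettersAt_append, List.append_assoc, lettersAt_append,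
        lettersAt_append] at this
      have hl : (lettersAt b L).length = numAt b L := rfl
      have hl2 : (lettersAt b L).length ≤ numAt b L + (n - 1) := by
        rw [hl]; exact Nat.le_add_right _ _
      rw [← List.getElem?_append_right hlen, this, List.getElem?_append_right hl2, hl,
        Nat.add_sub_cancel_left, List.getElem?_append_left (by
        show n - 1 < n; omega), ha]
    have g2 : (lettersAt b κ₂)[numAt b L + (n - 1) - (lettersAt b κ₁).length]? = some a := by
      have := congrArg (lettersAt b) hv
      rw [lettersAt_append, lettersAt_append, lettersAt_append, List.append_assoc] at this
      have hl : (lettersAt b w).length = numAt b w := rfl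
      have hl2 : (lettersAt b w).length ≤ numAt b w + (n - 1) := by
        rw [hl]; exact Nat.le_add_right _ _
      rw [← List.getElem?_append_right hlen, ← this, ← hnum,
        List.getElem?_append_right hl2, hl,
        Nat.add_sub_cancel_left, List.getElem?_append_left (by
        show n - 1 < n; omega), ha]
    have m1 := List.mem_of_getElem? g1
    have m2 := List.mem_of_getElem? g2
    simp only [lettersAt, List.mem_filter, decide_eq_true_eq] at m1 m2
    obtain ⟨s, ε⟩ := a
    obtain ⟨m1, rfl⟩ := m1
    cases ε with
    | false => exact hcneg (by rw [h2]; simp [m2.1])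
    | true =>
      apply hcneg
      rw [h2]
      apply List.mem_append_left
      simp only [FreeGroup.invRev, List.mem_reverse, List.mem_map]
      exact ⟨_, m1, rfl⟩

/-! ### Decomposition into pieces -/

theorem mk_pos (t : Fin m) : FreeGroup.mk [(t, true)] = of t := rfl

theorem mk_neg (t : Fin m) : FreeGroup.mk [(t, false)] = (of t)⁻¹ := by rw [of, inv_mk]; rfl

/-- Every reduced word of rank at most that of `a_b` is cut before each letter `a_b` and after each
letter `a_b⁻¹` into pieces `f`, `a_b f`, `f a_b⁻¹`, `a_b f a_b⁻¹` with `f` of smaller rank. -/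
theorem piece_induction (b : Fin m) {P : FreeGroup (Fin m) → Prop}
    (hlow : ∀ f ∈ level m b.val, P f) (hleft : ∀ f ∈ level m b.val, P (of b * f))
    (hboth : ∀ f ∈ level m b.val, f ≠ 1 → P (of b * f * (of b)⁻¹))
    (hinv : ∀ g, P g → P g⁻¹)
    (hmul : ∀ c r, c ∈ level m (b.val + 1) → r ∈ level m (b.val + 1) → RP c r →
      (Starts b r ∨ Starts b c⁻¹) → P c → P r → P (c * r)) :
    ∀ g ∈ level m (b.val + 1), P g := by
  have key : ∀ (n : ℕ) (w : Word m), w.length = n → IsReduced w → LettersBelow (b.val + 1) w →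
      P (FreeGroup.mk w) := by
    intro n
    induction n using Nat.strong_induction_on with
    | _ n ih =>
      intro w hn hr hw
      have split : ∀ c r, c ≠ [] → r ≠ [] → w = c ++ r →
          (Starts b (FreeGroup.mk r) ∨ Starts b (FreeGroup.mk c)⁻¹) → P (FreeGroup.mk w) := by
        rintro c r hc hr0 rfl hs
        have hc' := List.length_pos_iff.2 hc
        have hr' := List.length_pos_iff.2 hr0
        rw [List.length_append] at hn
        rw [mk_append]
        refine hmul _ _ (mk_mem_level (hw.subset (by simp))) (mk_mem_level (hw.subset (by simp)))
          (RP_mk hr) hs ?_ ?_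
        · exact ih _ (by omega) c rfl hr.left_of_append (hw.subset (by simp))
        · exact ih _ (by omega) r rfl hr.right_of_append (hw.subset (by simp))
      by_cases hA : ∃ u v, w = u ++ (b, true) :: v ∧ u ≠ []
      · obtain ⟨u, v, rfl, hu⟩ := hA
        exact split _ _ hu (by simp) rfl
          (Or.inl ⟨v, toWord_mk_of_isReduced hr.right_of_append⟩)
      by_cases hB : ∃ u v, w = u ++ (b, false) :: v ∧ v ≠ []
      · obtain ⟨u, v, rfl, hv⟩ := hB
        have e : u ++ (b, false) :: v = (u ++ [(b, false)]) ++ v := by simp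
        refine split _ _ (by simp) hv e (Or.inr (starts_inv_iff.2 ⟨u, ?_⟩))
        rw [e] at hr
        exact toWord_mk_of_isReduced hr.left_of_append
      have low : ∀ f : Word m, f ⊆ w → (b, true) ∉ f → (b, false) ∉ f → LettersBelow b.val f := by
        intro f hf h1 h2 l hl
        rcases Nat.lt_succ_iff_lt_or_eq.1 (hw l (hf hl)) with h | h
        · exact h
        · obtain ⟨s, δ⟩ := l
          obtain rfl : s = b := Fin.ext h
          cases δ
          exacts [absurd hl h2, absurd hl h1]
      by_cases hneg : (b, false) ∈ w
      · obtain ⟨f, v, rfl⟩ := List.append_of_mem hneg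
        obtain rfl : v = [] := by
          by_contra h
          exact hB ⟨f, v, rfl, h⟩
        have hfneg : (b, false) ∉ f := by
          intro h
          obtain ⟨x, y, rfl⟩ := List.append_of_mem h
          exact hB ⟨x, y ++ [(b, false)], by simp, by simp⟩
        by_cases hpos : (b, true) ∈ f
        · obtain ⟨x, y, rfl⟩ := List.append_of_mem hpos
          obtain rfl : x = [] := by
            by_contra h
            exact hA ⟨x, y ++ [(b, false)], by simp, h⟩
          have hy : (b, true) ∉ y := by
            intro h
            obtain ⟨x, z, rfl⟩ := List.append_of_mem h
            exact hA ⟨(b, true) :: x, z ++ [(b, false)], by simp, by simp⟩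
          have hyneg : (b, false) ∉ y := fun h => hfneg (by simp [h])
          have hyb := low y (by intro l hl; simp [hl]) hy hyneg
          have e : FreeGroup.mk ([] ++ (b, true) :: y ++ [(b, false)])
              = of b * FreeGroup.mk y * (of b)⁻¹ := by
            rw [← mk_neg, ← mk_pos, ← mk_append, ← mk_append]; rfl
          rw [e]
          refine hboth _ (mk_mem_level hyb) ?_
          intro h1
          have hyr : IsReduced y := hr.infix ⟨[(b, true)], [(b, false)], by simp⟩
          have : y = [] := by
            rw [← toWord_mk_of_isReduced hyr, h1, toWord_one]
          rw [this] at hr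
          simp at hr
        · have e : FreeGroup.mk (f ++ [(b, false)]) = (of b * (FreeGroup.mk f)⁻¹)⁻¹ := by
            rw [mk_append, mk_neg]; group
          rw [e]
          exact hinv _ (hleft _ (inv_mem (mk_mem_level
            (low f (by intro l hl; simp [hl]) hpos hfneg))))
      · by_cases hpos : (b, true) ∈ w
        · obtain ⟨x, y, rfl⟩ := List.append_of_mem hpos
          obtain rfl : x = [] := by
            by_contra h
            exact hA ⟨x, y, by simp, h⟩
          have hy : (b, true) ∉ y := by
            intro h
            obtain ⟨x, z, rfl⟩ := List.append_of_mem h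
            exact hA ⟨(b, true) :: x, z, by simp, by simp⟩
          have hyneg : (b, false) ∉ y := fun h => hneg (by simp [h])
          have e : FreeGroup.mk ([] ++ (b, true) :: y) = of b * FreeGroup.mk y := by
            rw [← mk_pos, ← mk_append]; rfl
          rw [e]
          exact hleft _ (mk_mem_level (low y (by intro l hl; simp [hl]) hy hyneg))
        · exact hlow _ (mk_mem_level (low w (fun _ h => h) hpos hneg))
  intro g hg
  have := key _ g.toWord rfl isReduced_toWord hg
  rwa [mk_toWord] at this

theorem RP_of_mul_low {b : Fin m} {f : FreeGroup (Fin m)} (hf : f ∈ level m b.val) :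
    RP (of b) f := by
  apply RP_of_isReduced
  rw [toWord_of]
  refine List.IsChain.append (by simp) isReduced_toWord ?_
  intro x hx y hy hxy
  simp only [List.getLast?_singleton, Option.mem_def, Option.some.injEq] at hx
  have := hf y (List.mem_of_head? hy)
  rw [← hxy, ← hx] at this
  exact absurd this (lt_irrefl _)

theorem starts_of_mul_low {b : Fin m} {f : FreeGroup (Fin m)} (hf : f ∈ level m b.val) :
    Starts b (of b * f) := ⟨f.toWord, by rw [RP_of_mul_low hf, toWord_of]; rfl⟩

theorem not_starts_of_mem_level {b : Fin m} {f : FreeGroup (Fin m)} (hf : f ∈ level m b.val) :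
    ¬ Starts b f := by
  rintro ⟨w, hw⟩
  exact lt_irrefl _ (hf (b, true) (by rw [hw]; simp))

theorem RP_mul_low_inv {b : Fin m} {f : FreeGroup (Fin m)} (hf : f ∈ level m b.val) (hf1 : f ≠ 1) :
    RP (of b * f) (of b)⁻¹ := by
  apply RP_of_isReduced
  rw [RP_of_mul_low hf, toWord_of, toWord_inv, toWord_of]
  have h1 : IsReduced (f.toWord ++ [(b, false)]) := by
    refine List.IsChain.append isReduced_toWord (by simp) ?_
    intro x hx y hy hxy
    simp only [List.head?_cons, Option.mem_def, Option.some.injEq] at hy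
    have := hf x (List.mem_of_getLast? hx)
    rw [hxy, ← hy] at this
    exact absurd this (lt_irrefl _)
  refine List.IsChain.append ?_ (by simp [FreeGroup.invRev]) ?_
  · have := (RP_of_mul_low hf).isReduced
    rwa [toWord_of] at this
  · intro x hx y hy hxy
    have hx' : x ∈ f.toWord.getLast? := by
      cases hw : f.toWord with
      | nil => exact absurd (toWord_eq_nil_iff.1 hw) hf1
      | cons l w =>
        rw [hw] at hx
        simpa [List.getLast?_cons_cons] using hx
    simp only [FreeGroup.invRev, List.map_cons, List.map_nil, List.reverse_cons, List.reverse_nil,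
      List.nil_append, List.head?_cons, Option.mem_def, Option.some.injEq] at hy
    have := hf x (List.mem_of_getLast? hx')
    rw [hxy, ← hy] at this
    exact absurd this (lt_irrefl _)

/-! ### Powers of the first generator inside words -/

/-- No subword of `w` is a power of `a_1^{±1}` with exponent above `N`. -/
def PowerBound (N : ℕ) (w : Word m) : Prop :=
  ∀ (n : ℕ) (l : Fin m × Bool), l.1.val = 0 → List.replicate n l <:+: w → n ≤ N

namespace PowerBound

variable {N N' : ℕ} {u v w : Word m}

theorem mono (h : PowerBound N w) (hN : N ≤ N') : PowerBound N' w :=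
  fun n l hl hi => (h n l hl hi).trans hN

theorem of_infix (h : PowerBound N w) (hi : u <:+: w) : PowerBound N u :=
  fun n l hl hn => h n l hl (hn.trans hi)

theorem of_length (h : w.length ≤ N) : PowerBound N w := by
  intro n l _ hi
  have := hi.length_le
  rw [List.length_replicate] at this
  exact this.trans h

theorem invRev (h : PowerBound N w) : PowerBound N (invRev w) := by
  rintro n l hl ⟨s, t, hst⟩
  refine h n (l.1, !l.2) hl ⟨FreeGroup.invRev t, FreeGroup.invRev s, ?_⟩
  rw [← invRev_invRev (L₁ := w), ← hst, invRev_append, invRev_append, ← List.append_assoc]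
  congr 2
  simp [FreeGroup.invRev]

theorem replicate_infix_append {n : ℕ} {l : Fin m × Bool} (h : List.replicate n l <:+: u ++ v) :
    List.replicate n l <:+: u ∨ List.replicate n l <:+: v ∨
      ∃ i j, n = i + j ∧ 0 < i ∧ 0 < j ∧ List.replicate i l <:+ u ∧ List.replicate j l <+: v := by
  rcases List.infix_append_iff.1 h with h | h | ⟨s, t, hst, hs, ht⟩
  · exact Or.inl h
  · exact Or.inr (Or.inl h)
  · obtain ⟨h1, h2, h3⟩ := List.append_eq_replicate_iff.1 hst.symm
    rcases Nat.eq_zero_or_pos s.length with h4 | h4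
    · right; left
      rw [List.length_eq_zero_iff] at h4
      rw [hst, h4, List.nil_append]
      exact ht.isInfix
    rcases Nat.eq_zero_or_pos t.length with h5 | h5
    · left
      rw [List.length_eq_zero_iff] at h5
      rw [hst, h5, List.append_nil]
      exact hs.isInfix
    exact Or.inr (Or.inr ⟨s.length, t.length, h1.symm, h4, h5, h2 ▸ hs, h3 ▸ ht⟩)

theorem append (hu : PowerBound N u) (hv : PowerBound N' v) : PowerBound (N + N') (u ++ v) := by
  intro n l hl hi
  rcases replicate_infix_append hi with h | h | ⟨i, j, rfl, -, -, h1, h2⟩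
  · exact (hu n l hl h).trans (Nat.le_add_right _ _)
  · exact (hv n l hl h).trans (Nat.le_add_left _ _)
  · exact add_le_add (hu i l hl h1.isInfix) (hv j l hl h2.isInfix)

/-- A letter other than `a_1^{±1}` at the junction separates powers of `a_1`. -/
theorem append_sep (hu : PowerBound N u) (hv : PowerBound N v)
    (hs : (∀ l ∈ u.getLast?, l.1.val ≠ 0) ∨ ∀ l ∈ v.head?, l.1.val ≠ 0) :
    PowerBound N (u ++ v) := by
  intro n l hl hi
  rcases replicate_infix_append hi with h | h | ⟨i, j, rfl, hi0, hj0, h1, h2⟩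
  · exact hu n l hl h
  · exact hv n l hl h
  · exfalso
    obtain ⟨i, rfl⟩ : ∃ i', i = i' + 1 := ⟨i - 1, by omega⟩
    obtain ⟨j, rfl⟩ : ∃ j', j = j' + 1 := ⟨j - 1, by omega⟩
    rcases hs with hs | hs
    · obtain ⟨x, rfl⟩ := h1
      refine hs l ?_ hl
      rw [List.replicate_succ', ← List.append_assoc]
      simp
    · obtain ⟨x, rfl⟩ := h2
      refine hs l ?_ hl
      rw [List.replicate_succ]
      simp

theorem mul {g h : FreeGroup (Fin m)} (hg : PowerBound N g.toWord) (hh : PowerBound N' h.toWord) :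
    PowerBound (N + N') (g * h).toWord := by
  obtain ⟨u, c, v, h1, h2, h3⟩ := exists_cancel g h
  rw [h3]
  exact (hg.of_infix ⟨[], c, by rw [h1]; rfl⟩).append (hh.of_infix ⟨FreeGroup.invRev c, [], by rw [h2]; simp⟩)

theorem inv {g : FreeGroup (Fin m)} (hg : PowerBound N g.toWord) : PowerBound N (g⁻¹).toWord := by
  rw [toWord_inv]; exact hg.invRev

end PowerBound

theorem RP.left_infix {g h : FreeGroup (Fin m)} (hr : RP g h) : g.toWord <:+: (g * h).toWord :=
  ⟨[], h.toWord, by rw [hr]; rfl⟩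

theorem RP.right_infix {g h : FreeGroup (Fin m)} (hr : RP g h) : h.toWord <:+: (g * h).toWord :=
  ⟨g.toWord, [], by rw [hr]; simp⟩

/-- The two factors of a cut next to a letter of positive index do not interact. -/
theorem PowerBound.mul_cut {N : ℕ} {b : Fin m} (hb : b.val ≠ 0) {g h : FreeGroup (Fin m)}
    (hg : PowerBound N g.toWord) (hh : PowerBound N h.toWord) (hr : RP g h)
    (hs : Starts b h ∨ Starts b g⁻¹) : PowerBound N (g * h).toWord := by
  rw [hr]
  refine hg.append_sep hh ?_
  rcases hs with ⟨w, hw⟩ | hs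
  · right; rw [hw]; simpa using hb
  · left
    obtain ⟨w, hw⟩ := starts_inv_iff.1 hs
    rw [hw]; simpa using hb

theorem PowerBound.of_mul {N : ℕ} {b : Fin m} (hb : b.val ≠ 0) {f : FreeGroup (Fin m)}
    (hf : PowerBound N f.toWord) (hfl : f ∈ level m b.val) : PowerBound N (of b * f).toWord := by
  rw [RP_of_mul_low hfl, toWord_of]
  refine PowerBound.append_sep ?_ hf (Or.inl (by simpa using hb))
  intro n l hl hi
  cases n with
  | zero => exact Nat.zero_le _
  | succ n =>
    have : l ∈ [(b, true)] := hi.subset (by simp)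
    rw [List.mem_singleton] at this
    rw [this] at hl
    exact absurd hl hb

theorem PowerBound.of_mul_inv {N : ℕ} {b : Fin m} (hb : b.val ≠ 0) {f : FreeGroup (Fin m)}
    (hf : PowerBound N f.toWord) (hfl : f ∈ level m b.val) (hf1 : f ≠ 1) :
    PowerBound N (of b * f * (of b)⁻¹).toWord := by
  rw [RP_mul_low_inv hfl hf1]
  refine PowerBound.append_sep (hf.of_mul hb hfl) ?_ (Or.inr ?_)
  · intro n l hl hi
    cases n with
    | zero => exact Nat.zero_le _
    | succ n =>
      have : l ∈ ((of b)⁻¹).toWord := hi.subset (by simp)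
      rw [toWord_inv, toWord_of] at this
      simp only [FreeGroup.invRev, List.map_cons, List.map_nil, List.reverse_cons,
        List.reverse_nil, List.nil_append, List.mem_singleton] at this
      rw [this] at hl
      exact absurd hl hb
  · rw [toWord_inv, toWord_of]
    simpa [FreeGroup.invRev] using hb

/-! ### The elements `a_t⁻¹ φ^k(a_t)` -/

/-- The generator before `a_t`, for `t` of positive index. -/
def prev (t : Fin m) : Fin m := ⟨t.val - 1, by have := t.isLt; omega⟩

theorem prev_val (t : Fin m) : (prev t).val = t.val - 1 := rfl

theorem tail_one {t : Fin m} (ht : t.val ≠ 0) : tail t 1 = of (prev t) := by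
  obtain ⟨_ | n, h⟩ := t
  · exact absurd rfl ht
  · exact tail_one_succ h

theorem tail_mem_level_prev {t : Fin m} (ht : t.val ≠ 0) (k : ℤ) :
    tail t k ∈ level m ((prev t).val + 1) := by
  have := tail_mem_level t k
  rwa [show (prev t).val + 1 = t.val by rw [prev_val]; omega]

/-- `tail t` is an axis along which `φ` translates. -/
theorem tail_succ {t : Fin m} (ht : t.val ≠ 0) (k : ℤ) :
    tail t (k + 1) = tail t k * (phi m ^ k) (of (prev t)) := by
  rw [tail_add, tail_one ht]

theorem tail_succ' {t : Fin m} (ht : t.val ≠ 0) (k : ℤ) :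
    tail t (k + 1) = tail t k * (of (prev t) * tail (prev t) k) := by
  rw [tail_succ ht, phi_zpow_of]

theorem tail_one_add {t : Fin m} (ht : t.val ≠ 0) (k : ℤ) :
    tail t (1 + k) = of (prev t) * (phi m ^ (1 : ℤ)) (tail t k) := by
  rw [tail_add, tail_one ht]

theorem tail_pred {t : Fin m} (ht : t.val ≠ 0) (k : ℤ) :
    tail t (k - 1) = tail t k * (of (prev t) * tail (prev t) (k - 1))⁻¹ := by
  have := tail_succ' ht (k - 1)
  rw [sub_add_cancel] at this
  rw [this]; group

theorem tail_neg (t : Fin m) (k : ℤ) : tail t (-k) = ((phi m ^ (-k)) (tail t k))⁻¹ := by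
  have := tail_add t (-k) k
  rw [neg_add_cancel, tail_zero] at this
  exact eq_inv_of_mul_eq_one_left this.symm

theorem count_tail_pos {t : Fin m} (ht : t.val ≠ 0) (k : ℕ) :
    (tail t k).toWord.count (prev t, false) = 0 := by
  obtain ⟨_ | n, h⟩ := t
  · exact absurd rfl ht
  · exact count_tail_succ h k

theorem starts_tail {t : Fin m} (ht : t.val ≠ 0) (k : ℕ) : Starts (prev t) (tail t (k + 1 : ℕ)) := by
  induction k with
  | zero => rw [zero_add, Nat.cast_one, tail_one ht]; exact ⟨[], by rw [toWord_of]⟩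
  | succ k ih =>
    rw [Nat.cast_add, add_comm, Nat.cast_one, tail_one_add ht]
    have h1 := (starts_phi_zpow 1 (tail_mem_level_prev ht _)).2 ih
    refine (RP_of_starts h1 ?_).starts ⟨[], by rw [toWord_of]⟩
    rintro ⟨w, hw⟩
    rw [toWord_inv, toWord_of] at hw
    simp [FreeGroup.invRev] at hw

theorem count_tail {t : Fin m} (ht : t.val ≠ 0) (k : ℕ) :
    (tail t k).toWord.count (prev t, true) = k := by
  induction k with
  | zero => simp
  | succ k ih =>
    rw [Nat.cast_add, Nat.cast_one, tail_succ ht]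
    have h1 : Starts (prev t) ((phi m ^ (k : ℤ)) (of (prev t))) := by
      rw [phi_zpow_of]; exact starts_of_mul_low (tail_mem_level _ _)
    have h2 : RP (tail t k) ((phi m ^ (k : ℤ)) (of (prev t))) := by
      refine RP_of_starts h1 ?_
      intro h
      obtain ⟨w, hw⟩ := starts_inv_iff.1 h
      have := count_tail_pos ht k
      rw [hw] at this
      simp at this
    rw [h2, List.count_append, ih, count_phi_zpow _ _ _ (of_mem_level (by simp)), toWord_of]
    simp

theorem count_tail_neg {t : Fin m} (ht : t.val ≠ 0) (k : ℕ) :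
    (tail t (-(k : ℤ))).toWord.count (prev t, false) = k := by
  rw [tail_neg, count_inv, count_phi_zpow _ _ _ (tail_mem_level_prev ht _)]
  exact count_tail ht k

theorem count_tail_neg_pos {t : Fin m} (ht : t.val ≠ 0) (k : ℕ) :
    (tail t (-(k : ℤ))).toWord.count (prev t, true) = 0 := by
  rw [tail_neg, count_inv, count_phi_zpow _ _ _ (tail_mem_level_prev ht _)]
  exact count_tail_pos ht k

theorem starts_tail_neg_inv {t : Fin m} (ht : t.val ≠ 0) (k : ℕ) :
    Starts (prev t) (tail t (-((k + 1 : ℕ) : ℤ)))⁻¹ := by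
  rw [tail_neg, inv_inv, starts_phi_zpow _ (tail_mem_level_prev ht _)]
  exact starts_tail ht k

theorem not_starts_tail_inv {t : Fin m} (ht : t.val ≠ 0) (k : ℕ) :
    ¬ Starts (prev t) (tail t k)⁻¹ := by
  intro h
  obtain ⟨w, hw⟩ := starts_inv_iff.1 h
  have := count_tail_pos ht k
  rw [hw] at this
  simp at this

theorem tail_eq_one {t : Fin m} (ht : t.val ≠ 0) {k : ℤ} (h : tail t k = 1) : k = 0 := by
  rcases Int.eq_nat_or_neg k with ⟨n, rfl | rfl⟩
  · have := count_tail ht n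
    rw [h] at this
    simp at this
    simp [← this]
  · have := count_tail_neg ht n
    rw [h] at this
    simp at this
    simp [← this]

theorem tail_injective {t : Fin m} (ht : t.val ≠ 0) {k l : ℤ} (h : tail t k = tail t l) :
    k = l := by
  have := tail_add t l (k - l)
  rw [add_sub_cancel, h, left_eq_mul] at this
  have := tail_eq_one ht ((map_eq_one_iff _ (MulEquiv.injective _)).1 this)
  omega

/-- A product of `a_t⁻¹ φ^k(a_t)`, `k ≥ 0`, with the next block of the axis is free of
cancellation. -/
theorem RP_tail_succ {t : Fin m} (ht : t.val ≠ 0) (k : ℕ) :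
    RP (tail t k) (of (prev t) * tail (prev t) k) :=
  RP_of_starts (starts_of_mul_low (tail_mem_level _ _)) (not_starts_tail_inv ht k)

theorem RP_tail_pred {t : Fin m} (ht : t.val ≠ 0) (k : ℕ) (j : ℤ) :
    RP (tail t (-(k : ℤ))) (of (prev t) * tail (prev t) j)⁻¹ := by
  cases k with
  | zero => rw [Nat.cast_zero, neg_zero, tail_zero]; exact RP_one_left _
  | succ k =>
    refine RP_of_starts_inv (starts_tail_neg_inv ht k) ?_
    rintro ⟨w, hw⟩
    have h1 := count_inv (prev t) true (of (prev t) * tail (prev t) j)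
    rw [hw, RP_of_mul_low (tail_mem_level _ _), List.count_append,
      count_eq_zero_of_mem_level (tail_mem_level _ _), toWord_of] at h1
    simp at h1

theorem tail_of_prev_zero {t : Fin m} (ht : t.val = 1) (k : ℤ) : tail t k = of (prev t) ^ k := by
  have ht0 : t.val ≠ 0 := by omega
  have h0 : ∀ j, tail (prev t) j = 1 := by
    intro j
    have : (prev t) = ⟨0, by have := t.isLt; omega⟩ := Fin.ext (by show t.val - 1 = 0; omega)
    rw [this, tail_index_zero]
  induction k with
  | zero => simp
  | succ k ih => rw [tail_succ' ht0, ih, h0, mul_one, zpow_add_one]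
  | pred k ih => rw [tail_pred ht0, ih, h0, mul_one, zpow_sub_one]

theorem level_one {g : FreeGroup (Fin m)} (hg : g ∈ level m 1) (hm : 0 < m) :
    ∃ k : ℤ, g = of ⟨0, hm⟩ ^ k := by
  suffices h : ∀ g ∈ level m 1, ∃ k : ℤ, g = of ⟨0, hm⟩ ^ k from h g hg
  refine letter_induction ⟨0, by simp⟩ ?_ ?_
  · rintro ⟨t, h⟩ ht g _ ⟨k, rfl⟩
    obtain rfl : t = 0 := by simp only at ht; omega
    exact ⟨1 + k, by rw [zpow_add, zpow_one]⟩
  · rintro ⟨t, h⟩ ht g _ ⟨k, rfl⟩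
    obtain rfl : t = 0 := by simp only at ht; omega
    exact ⟨-1 + k, by rw [zpow_add, zpow_neg_one]⟩

theorem phi_zpow_level_one {g : FreeGroup (Fin m)} (hg : g ∈ level m 1) (k : ℤ) :
    (phi m ^ k) g = g := by
  by_cases hm : 0 < m
  · obtain ⟨j, rfl⟩ := level_one hg hm
    rw [_root_.map_zpow, phi_zpow_of, tail_index_zero, mul_one]
  · obtain rfl : m = 0 := by omega
    exact Subsingleton.elim _ _

theorem toWord_of_zpow (t : Fin m) (k : ℤ) :
    (of t ^ k).toWord = List.replicate k.natAbs (t, decide (0 ≤ k)) := by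
  obtain ⟨n, rfl | rfl⟩ := Int.eq_nat_or_neg k
  · rw [zpow_natCast, toWord_of_pow]; simp
  · rw [zpow_neg, zpow_natCast, toWord_inv, toWord_of_pow]
    cases n
    · simp
    · simp [FreeGroup.invRev]
      omega

theorem powerBound_of_zpow_iff {N : ℕ} {t : Fin m} (ht : t.val = 0) (k : ℤ) :
    PowerBound N (of t ^ k).toWord ↔ k.natAbs ≤ N := by
  rw [toWord_of_zpow]
  constructor
  · intro h
    exact h _ _ (by exact ht) List.infix_rfl
  · intro h
    exact PowerBound.of_length (by simpa using h)

/-- The element `a_t⁻¹ φ^k(a_t)` contains no power of `a_1` with exponent above `|k|`. -/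
theorem powerBound_tail (t : Fin m) (k : ℤ) : PowerBound k.natAbs (tail t k).toWord := by
  obtain ⟨n, hn⟩ : ∃ n, t.val = n := ⟨_, rfl⟩
  induction n generalizing t k with
  | zero =>
    have : t = ⟨0, by have := t.isLt; omega⟩ := Fin.ext hn
    rw [this, tail_index_zero]
    exact PowerBound.of_length (by simp)
  | succ n ih =>
    have ht : t.val ≠ 0 := by omega
    have hp : (prev t).val = n := by rw [prev_val]; omega
    by_cases h1 : t.val = 1
    · rw [tail_of_prev_zero h1, powerBound_of_zpow_iff (by rw [prev_val, h1])]
    have hp0 : (prev t).val ≠ 0 := by rw [prev_val]; omega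
    obtain ⟨j, rfl | rfl⟩ := Int.eq_nat_or_neg k
    · rw [Int.natAbs_natCast]
      induction j with
      | zero => exact PowerBound.of_length (by simp)
      | succ j ihj =>
        have h2 := ih (prev t) j hp
        rw [Int.natAbs_natCast] at h2
        rw [Nat.cast_add, Nat.cast_one, tail_succ' ht]
        exact (ihj.mono (by omega)).mul_cut hp0
          ((h2.mono (by omega)).of_mul hp0 (tail_mem_level _ _)) (RP_tail_succ ht j)
          (Or.inl (starts_of_mul_low (tail_mem_level _ _)))
    · rw [Int.natAbs_neg, Int.natAbs_natCast]
      induction j with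
      | zero => exact PowerBound.of_length (by simp)
      | succ j ihj =>
        have h2 := ih (prev t) (-((j + 1 : ℕ) : ℤ)) hp
        rw [Int.natAbs_neg, Int.natAbs_natCast] at h2
        have h3 := RP_tail_pred ht j (-((j + 1 : ℕ) : ℤ))
        have h4 := tail_pred ht (-(j : ℤ))
        rw [show -(j : ℤ) - 1 = -((j + 1 : ℕ) : ℤ) by push_cast; ring] at h4
        rw [h4, h3]
        refine PowerBound.append_sep (ihj.mono (by omega))
          (h2.of_mul hp0 (tail_mem_level _ _)).inv ?_
        left
        intro l hl
        cases j with
        | zero => simp at hl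
        | succ j =>
          obtain ⟨w, hw⟩ := starts_inv_iff.1 (starts_tail_neg_inv ht j)
          rw [hw] at hl
          simp only [List.getLast?_append, List.getLast?_singleton, Option.some_or,
            Option.mem_def, Option.some.injEq] at hl
          rw [← hl]
          exact hp0

/-- The element `a_t⁻¹ φ^k(a_t)`, for `t` of positive index, contains a power of `a_1` with exponent
at least `|k|` up to an additive constant. -/
theorem natAbs_le_of_powerBound_tail {N : ℕ} {t : Fin m} (ht : t.val ≠ 0) (k : ℤ)
    (h : PowerBound N (tail t k).toWord) : k.natAbs ≤ N + t.val := by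
  obtain ⟨n, hn⟩ : ∃ n, t.val = n + 1 := ⟨t.val - 1, by omega⟩
  induction n generalizing t k with
  | zero =>
    rw [tail_of_prev_zero (by omega), powerBound_of_zpow_iff (by rw [prev_val, hn])] at h
    omega
  | succ n ih =>
    have hp : (prev t).val = n + 1 := by rw [prev_val]; omega
    have hp0 : (prev t).val ≠ 0 := by omega
    obtain ⟨j, rfl | rfl⟩ := Int.eq_nat_or_neg k
    · rw [Int.natAbs_natCast]
      cases j with
      | zero => omega
      | succ j =>
        rw [Nat.cast_add, Nat.cast_one, tail_succ' ht] at h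
        have h2 := (h.of_infix (RP_tail_succ ht j).right_infix).of_infix
          (RP_of_mul_low (tail_mem_level (prev t) j)).right_infix
        have := ih hp0 j h2 hp
        rw [Int.natAbs_natCast] at this
        omega
    · rw [Int.natAbs_neg, Int.natAbs_natCast]
      cases j with
      | zero => omega
      | succ j =>
        have h3 := RP_tail_pred ht j (-((j + 1 : ℕ) : ℤ))
        have h4 := tail_pred ht (-(j : ℤ))
        rw [show -(j : ℤ) - 1 = -((j + 1 : ℕ) : ℤ) by push_cast; ring] at h4
        rw [h4] at h
        have h5 := (h.of_infix h3.right_infix).inv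
        rw [inv_inv] at h5
        have := ih hp0 _ (h5.of_infix (RP_of_mul_low (tail_mem_level (prev t) _)).right_infix) hp
        rw [Int.natAbs_neg, Int.natAbs_natCast] at this
        omega

/-- The powers of `φ` change the exponents of the powers of `a_1` in a word by an amount that is
linear in the power of `φ`. -/
theorem PowerBound.phi_zpow (k : ℤ) {n : ℕ} (hn : n ≤ m) : ∀ g ∈ level m n, ∀ N,
    PowerBound N g.toWord → PowerBound (N + 2 * n * k.natAbs) ((phi m ^ k) g).toWord := by
  induction n with
  | zero =>
    intro g hg N _
    rw [phi_zpow_level_one (level_mono (by omega) hg)]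
    simpa
  | succ b ih =>
    have ih := ih (by omega)
    rcases Nat.eq_zero_or_pos b with rfl | hb
    · intro g hg N h
      rw [phi_zpow_level_one hg]
      exact h.mono (by omega)
    set t : Fin m := ⟨b, hn⟩ with ht
    have ht0 : t.val ≠ 0 := by simp only [ht]; omega
    have hbb : ∀ N, N + 2 * b * k.natAbs + 2 * k.natAbs = N + 2 * (b + 1) * k.natAbs := by
      intro N; ring
    refine piece_induction t ?_ ?_ ?_ ?_ ?_
    · intro f hf N h
      exact (ih f hf N h).mono (by rw [← hbb]; omega)
    · intro f hf N h
      have h1 := (powerBound_tail t k).mul (ih f hf N (h.of_infix (RP_of_mul_low hf).right_infix))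
      rw [_root_.map_mul, phi_zpow_of, mul_assoc (of t)]
      refine (h1.mono ?_).of_mul ht0 (mul_mem (tail_mem_level t k) (phi_zpow_mem_level k hf))
      rw [← hbb]; omega
    · intro f hf hf1 N h
      have h0 := ih f hf N
        ((h.of_infix (RP_mul_low_inv hf hf1).left_infix).of_infix (RP_of_mul_low hf).right_infix)
      have h1 := ((powerBound_tail t k).mul h0).mul (powerBound_tail t k).inv
      have e : (phi m ^ k) (of t * f * (of t)⁻¹)
          = of t * (tail t k * (phi m ^ k) f * (tail t k)⁻¹) * (of t)⁻¹ := by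
        rw [_root_.map_mul, _root_.map_mul, _root_.map_inv, phi_zpow_of]; group
      rw [e]
      refine (h1.mono ?_).of_mul_inv ht0 (mul_mem (mul_mem (tail_mem_level t k)
        (phi_zpow_mem_level k hf)) (inv_mem (tail_mem_level t k))) ?_
      · rw [← hbb]; omega
      · intro h2
        have h3 : (phi m ^ k) f = 1 := by
          have := congrArg (fun x => (tail t k)⁻¹ * x * tail t k) h2
          simpa [mul_assoc] using this
        exact hf1 ((map_eq_one_iff _ (MulEquiv.injective _)).1 h3)
    · intro g h N hN
      have := (h N (by simpa using hN.inv)).inv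
      rwa [← _root_.map_inv] at this
    · intro c r hc hr hrp hs ihc ihr N h
      have hs' : Starts t ((phi m ^ k) r) ∨ Starts t ((phi m ^ k) c)⁻¹ := by
        rw [← _root_.map_inv, starts_phi_zpow k hr, starts_phi_zpow k (inv_mem hc)]
        exact hs
      rw [_root_.map_mul]
      exact (ihc N (h.of_infix hrp.left_infix)).mul_cut ht0 (ihr N (h.of_infix hrp.right_infix))
        (hrp.phi_zpow k hc hr hs) hs'

/-! ### Translation along an axis -/

theorem numAt_eq_count (t : Fin m) (w : Word m) :
    numAt t w = w.count (t, true) + w.count (t, false) := by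
  induction w with
  | nil => rfl
  | cons l w ih =>
    obtain ⟨s, δ⟩ := l
    by_cases h : s = t
    · subst h
      rw [numAt_cons_self (show (s, δ).1 = s from rfl), ih]
      cases δ
      · simp; omega
      · simp; omega
    · rw [numAt_cons_ne h, ih]
      simp [h]

theorem numAt_phi_zpow (t : Fin m) (k : ℤ) {g : FreeGroup (Fin m)} (hg : g ∈ level m (t.val + 1)) :
    numAt t ((phi m ^ k) g).toWord = numAt t g.toWord := by
  rw [numAt, lettersAt_phi_zpow t k hg]; rfl

theorem numAt_eq_zero_of_mem_level {t : Fin m} {g : FreeGroup (Fin m)} (hg : g ∈ level m t.val) :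
    numAt t g.toWord = 0 := by
  rw [numAt, lettersAt_eq_nil hg]; rfl

/-- The elements `tail t k`, `k ∈ ℤ`, are points on an axis in the tree of the free group, where
consecutive points are separated by exactly one edge labelled `a_{t-1}`. This predicate says that `g`
lies behind the edge that follows the point `tail t (k - 1)`. -/
def Beyond (t : Fin m) (k : ℤ) (g : FreeGroup (Fin m)) : Prop :=
  Starts (prev t) ((tail t (k - 1))⁻¹ * g)

/-- The map `g ↦ tail t n * φ^n(g)` translates the axis by `n`. -/
theorem beyond_shift {t : Fin m} (ht : t.val ≠ 0) {g : FreeGroup (Fin m)} (hg : g ∈ level m t.val)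
    (k n : ℤ) : Beyond t (k + n) (tail t n * (phi m ^ n) g) ↔ Beyond t k g := by
  have e : (tail t (k + n - 1))⁻¹ * (tail t n * (phi m ^ n) g)
      = (phi m ^ n) ((tail t (k - 1))⁻¹ * g) := by
    rw [show k + n - 1 = n + (k - 1) by ring, tail_add, _root_.map_mul, _root_.map_inv]; group
  rw [Beyond, e, starts_phi_zpow, Beyond]
  have := mul_mem (inv_mem (tail_mem_level t (k - 1))) hg
  rwa [show (prev t).val + 1 = t.val by rw [prev_val]; omega]

/-- Behind an edge of the axis one is behind all earlier edges. -/
theorem beyond_of_succ {t : Fin m} (ht : t.val ≠ 0) {g : FreeGroup (Fin m)}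
    (k : ℤ) (h : Beyond t (k + 1) g) : Beyond t k g := by
  have e : (tail t (k - 1))⁻¹ * g
      = (phi m ^ (k - 1)) (of (prev t)) * ((tail t (k + 1 - 1))⁻¹ * g) := by
    have := tail_succ ht (k - 1)
    rw [show k - 1 + 1 = k + 1 - 1 by ring] at this
    rw [this]; group
  rw [Beyond, e]
  rw [Beyond] at h
  have h1 : Starts (prev t) ((phi m ^ (k - 1)) (of (prev t))) := by
    rw [phi_zpow_of]; exact starts_of_mul_low (tail_mem_level _ _)
  refine (RP_of_starts h ?_).starts h1
  rw [← _root_.map_inv, starts_phi_zpow _ (inv_mem (of_mem_level (by simp)))]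
  rintro ⟨w, hw⟩
  rw [toWord_inv, toWord_of] at hw
  simp [FreeGroup.invRev] at hw

theorem beyond_mono {t : Fin m} (ht : t.val ≠ 0) {g : FreeGroup (Fin m)} {k l : ℤ} (hkl : k ≤ l)
    (h : Beyond t l g) : Beyond t k g := by
  obtain ⟨n, rfl⟩ := Int.le.dest hkl
  induction n with
  | zero => simpa using h
  | succ n ih =>
    refine ih (by omega) (beyond_of_succ ht _ ?_)
    rwa [Nat.cast_add, Nat.cast_one, ← add_assoc] at h

theorem beyond_pos_iff {t : Fin m} (ht : t.val ≠ 0) (k : ℕ) {g : FreeGroup (Fin m)} :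
    Beyond t (k + 1) g ↔ (tail t k).toWord ++ [(prev t, true)] <+: g.toWord := by
  rw [Beyond, show (k : ℤ) + 1 - 1 = k by ring]
  constructor
  · intro h
    have h1 := RP_of_starts h (not_starts_tail_inv ht k)
    rw [RP, mul_inv_cancel_left] at h1
    obtain ⟨w, hw⟩ := h
    exact ⟨w, by rw [h1, hw]; simp⟩
  · rintro ⟨w, hw⟩
    refine ⟨w, ?_⟩
    rw [List.append_assoc] at hw
    have e : (tail t k)⁻¹ * g = FreeGroup.mk ([(prev t, true)] ++ w) := by
      rw [← mk_toWord (x := g), ← hw, mk_append, mk_toWord]; group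
    rw [e]
    refine toWord_mk_of_isReduced (isReduced_of_infix_toWord (g := g) ⟨(tail t k).toWord, [], ?_⟩)
    rw [← hw]; simp

theorem not_beyond_neg_iff {t : Fin m} (ht : t.val ≠ 0) (k : ℕ) {g : FreeGroup (Fin m)} :
    ¬ Beyond t (-(k : ℤ)) g ↔ (tail t (-((k + 1 : ℕ) : ℤ))).toWord <+: g.toWord := by
  rw [Beyond, show -(k : ℤ) - 1 = -((k + 1 : ℕ) : ℤ) by push_cast; ring]
  have h0 := starts_tail_neg_inv ht k
  constructor
  · intro h
    have h1 := RP_of_starts_inv h0 h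
    rw [RP, mul_inv_cancel_left] at h1
    exact ⟨_, h1.symm⟩
  · rintro ⟨w, hw⟩
    have e : (tail t (-((k + 1 : ℕ) : ℤ)))⁻¹ * g = FreeGroup.mk w := by
      rw [← mk_toWord (x := g), ← hw, mk_append, mk_toWord]; group
    have hr : IsReduced w := isReduced_of_infix_toWord (g := g) ⟨_, [], by rw [← hw]; simp; rfl⟩
    have h1 : RP (tail t (-((k + 1 : ℕ) : ℤ))) (FreeGroup.mk w) := by
      apply RP_of_isReduced
      rw [toWord_mk_of_isReduced hr, hw]
      exact isReduced_toWord
    rw [e]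
    exact h1.not_starts h0

theorem exists_not_beyond {t : Fin m} (ht : t.val ≠ 0) (g : FreeGroup (Fin m)) :
    ¬ Beyond t ((g.toWord.length : ℤ) + 1) g := by
  rw [beyond_pos_iff ht]
  intro h
  have h1 := h.length_le
  have h2 := (tail t g.toWord.length).toWord.count_le_length (a := (prev t, true))
  rw [count_tail ht] at h2
  simp at h1
  omega

theorem exists_beyond {t : Fin m} (ht : t.val ≠ 0) (g : FreeGroup (Fin m)) :
    Beyond t (-(g.toWord.length : ℤ)) g := by
  by_contra h
  rw [not_beyond_neg_iff ht] at h
  have h1 := h.length_le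
  have h2 := (tail t (-((g.toWord.length + 1 : ℕ) : ℤ))).toWord.count_le_length
    (a := (prev t, false))
  rw [count_tail_neg ht] at h2
  omega

/-- The points of the axis are the cuts of each other. -/
theorem cutAt_tail {t : Fin m} (ht : t.val ≠ 0) {r n : ℕ} (hrn : r < n) :
    cutAt (prev t) r (tail t n).toWord = (tail t r).toWord := by
  obtain ⟨d, rfl⟩ : ∃ d, n = r + (d + 1) := ⟨n - r - 1, by omega⟩
  rw [Nat.cast_add, tail_add]
  have h1 : Starts (prev t) ((phi m ^ (r : ℤ)) (tail t (d + 1 : ℕ))) :=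
    (starts_phi_zpow _ (tail_mem_level_prev ht _)).2 (starts_tail ht d)
  rw [RP_of_starts h1 (not_starts_tail_inv ht r)]
  obtain ⟨w, hw⟩ := h1
  have h2 : numAt (prev t) (tail t r).toWord = r := by
    rw [numAt_eq_count, count_tail ht, count_tail_pos ht]; rfl
  have h3 := cutAt_append (prev t) (tail t r).toWord ((prev t, true) :: w) 0
  rw [h2, Nat.add_zero] at h3
  rw [hw, h3]
  simp [cutAt]

/-- Two distinct translates of the axis overlap so little that at most one marked edge of the
first one is followed in both. -/
theorem beyond_mul_tail {t : Fin m} (ht : (prev t).val ≠ 0) {G : FreeGroup (Fin m)} (hG1 : G ≠ 1)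
    {k l l' : ℤ} (hl : l' < l) (h : Beyond t k (G * tail t l)) :
    Beyond t (k - 1) (G * tail t l') := by
  have ht0 : t.val ≠ 0 := by rw [prev_val] at ht; omega
  set a := prev t with ha
  obtain ⟨n, rfl⟩ := Int.le.dest hl.le
  set y := (phi m ^ l') (tail t n) with hy
  have hyl : y ∈ level m (a.val + 1) := phi_zpow_mem_level _ (tail_mem_level_prev ht0 _)
  rw [Beyond, ← ha] at h ⊢
  set x := (tail t (k - 1))⁻¹ * (G * tail t (l' + n)) with hx
  set P := (phi m ^ (k - 2)) (of a) with hP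
  have hPt : tail t (k - 1) = tail t (k - 2) * P := by
    have := tail_succ ht0 (k - 2)
    rwa [show k - 2 + 1 = k - 1 by ring] at this
  have e1 : (tail t (k - 1 - 1))⁻¹ * (G * tail t l') = (P * x) * y⁻¹ := by
    rw [hx, tail_add, ← hy, hPt, show k - 1 - 1 = k - 2 by ring]; group
  have hPs : P.toWord = (a, true) :: (tail a (k - 2)).toWord := by
    rw [hP, phi_zpow_of, RP_of_mul_low (tail_mem_level _ _), toWord_of]; rfl
  have hrp : RP P x := by
    refine RP_of_starts h ?_
    rw [hP, ← _root_.map_inv, starts_phi_zpow _ (inv_mem (of_mem_level (by simp)))]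
    rintro ⟨w, hw⟩
    rw [toWord_inv, toWord_of] at hw
    simp [FreeGroup.invRev] at hw
  rw [e1]
  obtain ⟨u, c, v, hu, hv, huv⟩ := exists_cancel (P * x) y⁻¹
  cases u with
  | cons l u =>
    rw [hrp, hPs] at hu
    simp only [List.cons_append, List.cons.injEq] at hu
    exact ⟨u ++ v, by rw [huv, ← hu.1]; rfl⟩
  | nil =>
    -- Two consecutive marked edges of the first axis would be marked edges of the second one with the
    -- same labels in between, and the labels determine the position on the axis.
    exfalso
    rw [List.nil_append] at hu huv
    rw [← hu, toWord_inv] at hv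
    have hyw : y.toWord = invRev v ++ (P.toWord ++ x.toWord) := by
      have := congrArg FreeGroup.invRev hv
      rwa [invRev_invRev, invRev_append, invRev_invRev, hrp] at this
    obtain ⟨s, hs⟩ := h
    set r := numAt a (invRev v) with hr
    have hnP : numAt a P.toWord = 1 := by
      rw [hPs, numAt_cons_self (show (a, true).1 = a from rfl),
        numAt_eq_zero_of_mem_level (tail_mem_level _ _)]
    have hny : numAt a y.toWord = n := by
      rw [hy, numAt_phi_zpow _ _ (tail_mem_level_prev ht0 _), numAt_eq_count, count_tail ht0,
        count_tail_pos ht0]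
      rfl
    have hrn : r + 1 < n := by
      rw [hyw, numAt_append, numAt_append, hnP, hs,
        numAt_cons_self (show (a, true).1 = a from rfl)] at hny
      omega
    have cut : ∀ j < n, cutAt a j y.toWord = ((phi m ^ l') (tail t j)).toWord := by
      intro j hj
      rw [hy, ← cutAt_phi_zpow _ (tail_mem_level_prev ht0 _), cutAt_tail ht0 hj, mk_toWord]
      rw [numAt_eq_count, count_tail ht0]
      omega
    have c1 : (phi m ^ l') (tail t r) = FreeGroup.mk (invRev v) := by
      rw [← mk_toWord (x := (phi m ^ l') (tail t r)), ← cut r (by omega), hyw]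
      have h3 := cutAt_append a (invRev v) (P.toWord ++ x.toWord) 0
      rw [← hr, Nat.add_zero] at h3
      rw [h3, hPs]
      simp [cutAt]
    have c2 : (phi m ^ l') (tail t (r + 1 : ℕ)) = FreeGroup.mk (invRev v) * P := by
      rw [← mk_toWord (x := (phi m ^ l') (tail t (r + 1 : ℕ))), ← cut (r + 1) hrn, hyw,
        ← List.append_assoc]
      have h3 := cutAt_append a (invRev v ++ P.toWord) x.toWord 0
      rw [numAt_append, ← hr, hnP, Nat.add_zero] at h3
      rw [h3, hs, mk_append, mk_append, mk_toWord]
      simp [cutAt, ← one_eq_mk]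
    rw [Nat.cast_add, Nat.cast_one, tail_succ ht0, _root_.map_mul, ← phi_zpow_add, c1] at c2
    have c3 := mul_left_cancel c2
    rw [hP, phi_zpow_of, phi_zpow_of] at c3
    have c4 := tail_injective ht (mul_left_cancel c3)
    have c5 : (P * x) * y⁻¹ = (FreeGroup.mk (invRev v))⁻¹ := by
      rw [← mk_toWord (x := (P * x) * y⁻¹), huv, mk_invRev, inv_inv]
    rw [← e1, ← c1, show k - 1 - 1 = l' + r by omega, tail_add, mul_inv_rev, mul_assoc] at c5
    have c6 := inv_mul_eq_one.1 (mul_left_cancel (c5.trans (mul_one _).symm))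
    exact hG1 (by simpa using c6)

/-- A common prefix of two elements that sit differently with respect to the axis is a prefix of the
axis. -/
theorem prefix_tail_of_beyond {t : Fin m} (ht : t.val ≠ 0) {G K : FreeGroup (Fin m)} {f : Word m}
    (hG : f <+: G.toWord) (hK : f <+: K.toWord) {k : ℤ} (h1 : Beyond t k G) (h2 : ¬ Beyond t k K) :
    ∃ j : ℤ, f <+: (tail t j).toWord := by
  rcases lt_or_ge 0 k with hk | hk
  · obtain ⟨n, rfl⟩ : ∃ n : ℕ, k = n + 1 := ⟨(k - 1).toNat, by omega⟩
    rw [beyond_pos_iff ht] at h1 h2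
    refine ⟨(n + 1 : ℕ), ?_⟩
    have h3 : (tail t n).toWord ++ [(prev t, true)] <+: (tail t (n + 1 : ℕ)).toWord := by
      rw [Nat.cast_add, Nat.cast_one, tail_succ' ht, RP_tail_succ ht, RP_of_mul_low
        (tail_mem_level _ _), toWord_of]
      exact ⟨(tail (prev t) n).toWord, by simp⟩
    rcases List.prefix_or_prefix_of_prefix hG h1 with h | h
    · exact h.trans h3
    · exact absurd (h.trans hK) h2
  · obtain ⟨n, rfl⟩ : ∃ n : ℕ, k = -(n : ℤ) := ⟨(-k).toNat, by omega⟩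
    rw [not_beyond_neg_iff ht] at h2
    refine ⟨-((n + 1 : ℕ) : ℤ), ?_⟩
    rcases List.prefix_or_prefix_of_prefix hK h2 with h | h
    · exact h
    · exact absurd h1 ((not_beyond_neg_iff ht n).2 (h.trans hG))

/-- A common prefix of `G` and `K = φ^{-p}((tail t p)⁻¹ G (tail t e))`, where `0 ≤ e ≤ p`, lies on the
axis. Left multiplication by `tail t p` after `φ^p` translates the axis by `p`, which the factor
`tail t e` on the right cannot make up for unless `G` is on the axis itself. -/
theorem prefix_tail_of_eq {t : Fin m} (ht : (prev t).val ≠ 0) {G K : FreeGroup (Fin m)}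
    (hKl : K ∈ level m t.val) {f : Word m} (hG : f <+: G.toWord)
    (hK : f <+: K.toWord) {e p : ℕ} (hep : e ≤ p) (hp : 0 < p)
    (h : G * tail t e = tail t p * (phi m ^ (p : ℤ)) K) :
    ∃ j : ℤ, f <+: (tail t j).toWord := by
  have ht0 : t.val ≠ 0 := by rw [prev_val] at ht; omega
  by_cases hdiff : ∃ k, ¬ (Beyond t k G ↔ Beyond t k K)
  · obtain ⟨k, hk⟩ := hdiff
    by_cases h1 : Beyond t k G
    · exact prefix_tail_of_beyond ht0 hG hK h1 (by tauto)
    · exact prefix_tail_of_beyond ht0 hK hG (by tauto) h1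
  push Not at hdiff
  by_cases hG1 : G = 1
  · refine ⟨0, ?_⟩
    rw [hG1, toWord_one, List.prefix_nil] at hG
    rw [hG]; exact List.nil_prefix
  -- `κ` is the last edge of the axis that `G` and `K` pass.
  obtain ⟨κ, hκ1, hκ2⟩ : ∃ κ, Beyond t κ G ∧ ¬ Beyond t (κ + 1) G := by
    by_contra hcon
    push Not at hcon
    have : ∀ n : ℕ, Beyond t (-(G.toWord.length : ℤ) + n) G := by
      intro n
      induction n with
      | zero => simpa using exists_beyond ht0 G
      | succ n ih =>
        have := hcon _ ih
        rwa [add_assoc] at this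
    refine exists_not_beyond ht0 G ?_
    have h3 := this (2 * G.toWord.length + 1)
    rwa [show -(G.toWord.length : ℤ) + ((2 * G.toWord.length + 1 : ℕ) : ℤ)
      = (G.toWord.length : ℤ) + 1 by push_cast; ring] at h3
  have h1 : Beyond t (κ + p) (G * tail t e) := by
    rw [h, beyond_shift ht0 hKl]
    exact (hdiff κ).1 hκ1
  have h2 : ¬ Beyond t (κ + 1 + p) (G * tail t e) := by
    rw [h, beyond_shift ht0 hKl]
    exact fun h => hκ2 ((hdiff _).2 h)
  rcases Nat.eq_zero_or_pos e with rfl | he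
  · exfalso
    rw [Nat.cast_zero, tail_zero, mul_one] at h1
    exact hκ2 (beyond_mono ht0 (by omega) h1)
  · have h3 := beyond_mul_tail ht hG1 (l' := 0) (l := e) (by omega) h1
    rw [tail_zero, mul_one] at h3
    obtain rfl : p = 1 := by
      by_contra hne
      exact hκ2 (beyond_mono ht0 (by omega) h3)
    obtain rfl : e = 1 := by omega
    rw [Nat.cast_one, tail_one ht0, Beyond, add_sub_cancel_right] at h1
    rw [Beyond, add_sub_cancel_right] at hκ2
    refine ⟨κ, ?_⟩
    suffices hx : (tail t κ)⁻¹ * G = 1 by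
      rw [inv_mul_eq_one] at hx
      rwa [hx]
    by_contra hne
    set x := (tail t κ)⁻¹ * G with hx
    rw [← mul_assoc, ← hx] at h1
    apply hκ2
    by_cases hs : Starts (prev t) x⁻¹
    · obtain ⟨w, hw⟩ := starts_inv_iff.1 hs
      have hxe : x = FreeGroup.mk w * (of (prev t))⁻¹ := by
        rw [← mk_toWord (x := x), hw, mk_append, mk_neg]
      have hwr : IsReduced w := isReduced_of_infix_toWord (g := x) ⟨[], _, by rw [hw]; rfl⟩
      rw [hxe, inv_mul_cancel_right] at h1
      refine h1.of_toWord_prefix ?_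
      rw [hw, toWord_mk_of_isReduced hwr]
      exact List.prefix_append _ _
    · exact ((RP_of_starts ⟨[], by rw [toWord_of]⟩ hs).starts_iff hne).1 h1

/-! ### Growth of powers along orbits -/

theorem le_of_beyond {t : Fin m} (ht : t.val ≠ 0) {B k : ℕ} {g : FreeGroup (Fin m)}
    (h : Beyond t (k + 1) g) (hB : PowerBound B g.toWord) : k ≤ B + t.val := by
  rw [beyond_pos_iff ht] at h
  have := natAbs_le_of_powerBound_tail ht k
    (hB.of_infix ((List.prefix_append _ _).trans h).isInfix)
  rwa [Int.natAbs_natCast] at this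

theorem beyond_of_powerBound {t : Fin m} (ht : t.val ≠ 0) {B : ℕ} {g : FreeGroup (Fin m)}
    (hB : PowerBound B g.toWord) : Beyond t (-((B + t.val : ℕ) : ℤ)) g := by
  by_contra h
  rw [not_beyond_neg_iff ht] at h
  have := natAbs_le_of_powerBound_tail ht _ (hB.of_infix h.isInfix)
  rw [Int.natAbs_neg, Int.natAbs_natCast] at this
  omega

/-- If `φ` does not fix `g`, then large powers of `a_1` appear in `φ^n(g)` for large `n`, unless they
are present in `g`. In a piece of `g` that is not fixed, the translation along the axis moves a marked
edge from one end of the axis, which `g` has to reach, to the other. -/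
theorem growth {B n : ℕ} {d : ℕ} (hd : d ≤ m) : ∀ g ∈ level m d, phi m g ≠ g →
    PowerBound B g.toWord → PowerBound B ((phi m ^ (n : ℤ)) g).toWord → n ≤ 2 * B + 2 * m + 2 := by
  have fix1 : ∀ g ∈ level m 1, phi m g = g := by
    intro g hg
    simpa using phi_zpow_level_one hg 1
  induction d with
  | zero => intro g hg h; exact absurd (fix1 g (level_mono (by omega) hg)) h
  | succ b ih =>
    have ih := ih (by omega)
    rcases Nat.eq_zero_or_pos b with rfl | hb
    · intro g hg h; exact absurd (fix1 g hg) h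
    set t : Fin m := ⟨b, hd⟩ with ht
    have ht0 : t.val ≠ 0 := by simp only [ht]; omega
    have htm := t.isLt
    refine piece_induction t ih ?_ ?_ ?_ ?_
    · intro f hf _ h1 h2
      rw [_root_.map_mul, phi_zpow_of, mul_assoc] at h2
      have hfl := phi_zpow_mem_level (n : ℤ) hf
      have h1 := h1.of_infix (RP_of_mul_low hf).right_infix
      have h2 := h2.of_infix (RP_of_mul_low (mul_mem (tail_mem_level t n) hfl)).right_infix
      have h3 := beyond_of_powerBound ht0 h1
      rw [← beyond_shift ht0 hf _ n] at h3
      by_contra hcon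
      obtain ⟨k, hk⟩ : ∃ k : ℕ, -((B + t.val : ℕ) : ℤ) + n = k + 1 :=
        ⟨n - 1 - (B + t.val), by omega⟩
      rw [hk] at h3
      have := le_of_beyond ht0 h3 h2
      omega
    · intro f hf hf1 hne h1 h2
      have h1 := (h1.of_infix (RP_mul_low_inv hf hf1).left_infix).of_infix
        (RP_of_mul_low hf).right_infix
      set h := tail t n * (phi m ^ (n : ℤ)) f * (tail t n)⁻¹ with hh
      have hhl : h ∈ level m t.val := mul_mem (mul_mem (tail_mem_level t n)
        (phi_zpow_mem_level _ hf)) (inv_mem (tail_mem_level t n))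
      have e : (phi m ^ (n : ℤ)) (of t * f * (of t)⁻¹) = of t * h * (of t)⁻¹ := by
        rw [_root_.map_mul, _root_.map_mul, _root_.map_inv, phi_zpow_of, hh]; group
      have hh1 : h ≠ 1 := by
        intro h2
        have h3 : (phi m ^ (n : ℤ)) f = 1 := by
          have := congrArg (fun x => (tail t n)⁻¹ * x * tail t n) h2
          simpa [mul_assoc, hh] using this
        exact hf1 ((map_eq_one_iff _ (MulEquiv.injective _)).1 h3)
      rw [e] at h2
      have h2 := (h2.of_infix (RP_mul_low_inv hhl hh1).left_infix).of_infix
        (RP_of_mul_low hhl).right_infix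
      by_cases hp0 : (prev t).val ≠ 0
      · have h3 := beyond_of_powerBound ht0 h1
        rw [← beyond_shift ht0 hf _ n, show tail t n * (phi m ^ (n : ℤ)) f = h * tail t n by
          rw [hh]; group] at h3
        by_contra hcon
        have h4 := beyond_mul_tail hp0 hh1 (l' := 0) (l := n) (by omega) h3
        rw [tail_zero, mul_one] at h4
        obtain ⟨k, hk⟩ : ∃ k : ℕ, -((B + t.val : ℕ) : ℤ) + n - 1 = k + 1 :=
          ⟨n - 2 - (B + t.val), by omega⟩
        rw [hk] at h4
        have := le_of_beyond ht0 h4 h2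
        omega
      · -- `a_2 a_1^j a_2⁻¹` is fixed by `φ`.
        exfalso
        apply hne
        have ht1 : t.val = 1 := by rw [prev_val] at hp0; omega
        have h5 : phi m (of t) = of t * of (prev t) := by
          have := phi_zpow_of t 1
          rwa [zpow_one, tail_of_prev_zero ht1, zpow_one] at this
        have hm : 0 < m := by omega
        obtain ⟨j, hj⟩ := level_one (by rw [← ht1]; exact hf) hm
        have h6 : prev t = ⟨0, hm⟩ := Fin.ext (by show t.val - 1 = 0; omega)
        rw [_root_.map_mul, _root_.map_mul, _root_.map_inv, h5, fix1 f (by rw [← ht1]; exact hf),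
          hj, h6]
        group
    · intro g h hne h1 h2
      refine h ?_ (by simpa using h1.inv) ?_
      · intro h3; apply hne; rw [_root_.map_inv, h3]
      · have := h2.inv
        rwa [← _root_.map_inv, inv_inv] at this
    · intro c r hc hr hrp hs ihc ihr hne h1 h2
      have hrp2 := hrp.phi_zpow (n : ℤ) hc hr hs
      rw [_root_.map_mul] at h2
      by_cases hcne : phi m c = c
      · refine ihr ?_ (h1.of_infix hrp.right_infix) (h2.of_infix hrp2.right_infix)
        intro h3
        exact hne (by rw [_root_.map_mul, hcne, h3])
      · exact ihc hcne (h1.of_infix hrp.left_infix) (h2.of_infix hrp2.left_infix)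

/-! ### Common prefixes of a word and its image -/

theorem not_starts_of_count {t : Fin m} {g : FreeGroup (Fin m)} (h : g.toWord.count (t, true) = 0) :
    ¬ Starts t g := by
  rintro ⟨w, hw⟩
  rw [hw] at h
  simp at h

theorem prefix_tail_nat {t : Fin m} (ht : t.val ≠ 0) {f : Word m} (j : ℕ)
    (h : f <+: (tail t j).toWord) :
    f = [] ∨ ∃ (n : ℕ) (f' : Word m), f = (tail t n).toWord ++ (prev t, true) :: f' ∧
      f' <+: (tail (prev t) n).toWord := by
  induction j with
  | zero => left; simpa using h
  | succ j ih =>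
    rw [Nat.cast_add, Nat.cast_one, tail_succ' ht, RP_tail_succ ht,
      RP_of_mul_low (tail_mem_level _ _), toWord_of] at h
    rcases List.prefix_or_prefix_of_prefix h (List.prefix_append _ _) with h1 | ⟨g, rfl⟩
    · exact ih h1
    · rw [List.prefix_append_right_inj] at h
      cases g with
      | nil => exact ih (by simp)
      | cons l g =>
        obtain ⟨x, hx⟩ := h
        simp only [List.cons_append, List.nil_append, List.cons.injEq] at hx
        exact Or.inr ⟨j, g, by rw [← hx.1], ⟨x, hx.2⟩⟩

theorem prefix_tail_neg {t : Fin m} (ht : t.val ≠ 0) {f : Word m} (j : ℕ)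
    (h : f <+: (tail t (-(j : ℤ))).toWord) :
    ∃ (n : ℕ) (f' : Word m), f = (tail t (-(n : ℤ))).toWord ++ f' ∧
      f' <+: ((tail (prev t) (-((n + 1 : ℕ) : ℤ)))⁻¹).toWord := by
  induction j with
  | zero =>
    have hf : f = [] := by simpa using h
    exact ⟨0, [], by rw [hf]; simp, List.nil_prefix⟩
  | succ j ih =>
    have h4 := tail_pred ht (-(j : ℤ))
    rw [show -(j : ℤ) - 1 = -((j + 1 : ℕ) : ℤ) by push_cast; ring] at h4
    have h' := h
    rw [h4, RP_tail_pred ht, mul_inv_rev] at h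
    have h5 := (RP_of_mul_low (tail_mem_level (prev t) (-((j + 1 : ℕ) : ℤ)))).inv
    rw [h5] at h
    rcases List.prefix_or_prefix_of_prefix h (List.prefix_append _ _) with h1 | ⟨g, rfl⟩
    · exact ih h1
    · rw [List.prefix_append_right_inj] at h
      rcases List.prefix_or_prefix_of_prefix h (List.prefix_append _ _) with h1 | ⟨g', hg'⟩
      · exact ⟨j, g, rfl, h1⟩
      · rw [← hg', List.prefix_append_right_inj, toWord_inv, toWord_of] at h
        cases g' with
        | nil => exact ⟨j, g, rfl, by rw [← hg']; simp⟩
        | cons l g' =>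
          refine ⟨j + 1, [], ?_, List.nil_prefix⟩
          have h6 : l :: g' = invRev [(prev t, true)] := by
            refine h.eq_of_length_le ?_
            simp
          rw [List.append_nil, ← hg', h6, h4, RP_tail_pred ht, mul_inv_rev, h5, toWord_inv (of _),
            toWord_of]

/-- A prefix `f` of the axis occurs near the point `0` of the axis if its deviation
`f⁻¹ · a_t⁻¹ φ^{-p}(a_t f)` contains only small powers of `a_1`. -/
theorem exists_prefix_tail_le {t : Fin m} (ht : (prev t).val ≠ 0) {f : Word m} {j : ℤ}
    (h : f <+: (tail t j).toWord) {p D : ℕ} (hp : 0 < p)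
    (hD : PowerBound D
      ((FreeGroup.mk f)⁻¹ * tail t (-(p : ℤ)) * (phi m ^ (-(p : ℤ))) (FreeGroup.mk f)).toWord) :
    ∃ k : ℤ, f <+: (tail t k).toWord ∧ k.natAbs ≤ 2 * D + 2 * m * p + 2 * p + 2 * m := by
  have ht0 : t.val ≠ 0 := by rw [prev_val] at ht; omega
  have htm := t.isLt
  have ham : (prev t).val < m := (prev t).isLt
  have hLip : ∀ (k : ℤ) (g : FreeGroup (Fin m)) (N : ℕ), PowerBound N g.toWord →
      k.natAbs ≤ p → PowerBound (N + 2 * m * p) ((phi m ^ k) g).toWord := by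
    intro k g N hN hk
    refine (PowerBound.phi_zpow k le_rfl g (mem_level_self g) N hN).mono ?_
    gcongr
  set a := prev t with ha
  set ψ := phi m ^ (-(p : ℤ)) with hψ
  obtain ⟨p', rfl⟩ : ∃ p', p = p' + 1 := ⟨p - 1, by omega⟩
  rcases Int.eq_nat_or_neg j with ⟨j, rfl | rfl⟩
  · rcases prefix_tail_nat ht0 j h with rfl | ⟨n, f', rfl, hf'⟩
    · exact ⟨0, List.nil_prefix, by simp⟩
    refine ⟨(n + 1 : ℕ), ?_, ?_⟩
    · rw [Nat.cast_add, Nat.cast_one, tail_succ' ht0, RP_tail_succ ht0,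
        RP_of_mul_low (tail_mem_level _ _), toWord_of]
      simpa using hf'
    set F := FreeGroup.mk f' with hF
    have hFl : F ∈ level m a.val := mk_mem_level ((tail_mem_level a n).subset hf'.subset)
    set E := (phi m ^ ((n : ℤ) - p')) (tail t p') with hE
    set ω := (tail a ((n : ℤ) - (p' + 1 : ℕ)))⁻¹ * tail a (-((p' + 1 : ℕ) : ℤ)) * ψ F with hω
    have e0 : FreeGroup.mk ((tail t n).toWord ++ (a, true) :: f') = tail t n * (of a * F) := by
      rw [mk_append, mk_toWord, ← mk_pos, ← mk_append]; rfl
    have e1 : tail t n = tail t ((n : ℤ) - (p' + 1 : ℕ)) * (of a *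
        tail a ((n : ℤ) - (p' + 1 : ℕ)) * E) := by
      have h1 := tail_add t ((n : ℤ) - (p' + 1 : ℕ)) (1 + p')
      rw [show (n : ℤ) - (p' + 1 : ℕ) + (1 + p') = n by push_cast; ring, tail_one_add ht0,
        _root_.map_mul, ← phi_zpow_add, phi_zpow_of,
        show (n : ℤ) - (p' + 1 : ℕ) + 1 = n - p' by push_cast; ring] at h1
      exact h1
    have e2 : tail t (-((p' + 1 : ℕ) : ℤ)) * ψ (tail t n) = tail t ((n : ℤ) - (p' + 1 : ℕ)) := by
      rw [hψ, ← tail_add, neg_add_eq_sub]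
    -- The right-hand side is free of cancellation, and `tail a (n - p)` can be read off from its two
    -- ends `F` and `ω`.
    have e3 : (tail t n * (of a * F))⁻¹ * tail t (-((p' + 1 : ℕ) : ℤ)) *
        ψ (tail t n * (of a * F)) = (of a * F)⁻¹ * (E⁻¹ * ω) := by
      have h2 : ψ (of a) = of a * tail a (-((p' + 1 : ℕ) : ℤ)) := phi_zpow_of _ _
      calc _ = (of a * F)⁻¹ * (tail t n)⁻¹ * (tail t (-((p' + 1 : ℕ) : ℤ)) * ψ (tail t n)) *
              (ψ (of a) * ψ F) := by rw [_root_.map_mul, _root_.map_mul]; group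
        _ = _ := by rw [e2, h2, hω, e1]; group
    rw [e0, e3] at hD
    have hωl : ω ∈ level m a.val := mul_mem (mul_mem (inv_mem (tail_mem_level _ _))
      (tail_mem_level _ _)) (phi_zpow_mem_level _ hFl)
    have hEl := tail_mem_level_prev ht0 p'
    have r1 : RP E⁻¹ ω := by
      cases p' with
      | zero =>
        have : E = 1 := by rw [hE]; simp
        rw [this, inv_one]; exact RP_one_left _
      | succ q =>
        refine RP_of_starts_inv (t := a) ?_ (not_starts_of_mem_level hωl)
        rw [inv_inv, hE, starts_phi_zpow _ hEl]
        exact starts_tail ht0 q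
    have r2 : RP (of a * F)⁻¹ (E⁻¹ * ω) := by
      refine RP_of_starts_inv (t := a) (by rw [inv_inv]; exact starts_of_mul_low hFl) ?_
      apply not_starts_of_count
      rw [r1, List.count_append, count_eq_zero_of_mem_level hωl, count_inv, hE,
        count_phi_zpow _ _ _ hEl]
      exact count_tail_pos ht0 p'
    have b1 : PowerBound D F.toWord := by
      have := (hD.of_infix r2.left_infix).inv
      rw [inv_inv] at this
      exact this.of_infix (RP_of_mul_low hFl).right_infix
    have b2 : PowerBound D ω.toWord := (hD.of_infix r2.right_infix).of_infix r1.right_infix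
    have b3 := hLip (-((p' + 1 : ℕ) : ℤ)) F D b1 (by omega)
    have b4 := (b2.mul b3.inv).mul (powerBound_tail a (-((p' + 1 : ℕ) : ℤ))).inv
    have e4 : ω * (ψ F)⁻¹ * (tail a (-((p' + 1 : ℕ) : ℤ)))⁻¹
        = (tail a ((n : ℤ) - (p' + 1 : ℕ)))⁻¹ := by rw [hω]; group
    rw [e4] at b4
    have b5 := b4.inv
    rw [inv_inv] at b5
    have := natAbs_le_of_powerBound_tail ht _ b5
    rw [Int.natAbs_neg, Int.natAbs_natCast] at this
    omega
  · obtain ⟨n, f', rfl, hf'⟩ := prefix_tail_neg ht0 j h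
    have h4 := tail_pred ht0 (-(n : ℤ))
    rw [show -(n : ℤ) - 1 = -((n + 1 : ℕ) : ℤ) by push_cast; ring, ← ha] at h4
    rw [← ha] at hf'
    refine ⟨-((n + 1 : ℕ) : ℤ), ?_, ?_⟩
    · rw [h4, RP_tail_pred ht0, mul_inv_rev, (RP_of_mul_low (tail_mem_level _ _)).inv]
      exact (List.prefix_append_right_inj _).2 (hf'.trans (List.prefix_append _ _))
    set F := FreeGroup.mk f' with hF
    have hFl : F ∈ level m a.val :=
      mk_mem_level (LettersBelow.subset (inv_mem (tail_mem_level a (-((n + 1 : ℕ) : ℤ)))) hf'.subset)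
    set E := (phi m ^ (-((n + 1 : ℕ) : ℤ))) (tail t (-(p' : ℤ))) with hE
    set α := F⁻¹ * (tail a (-((n + 1 : ℕ) : ℤ)))⁻¹ with hα
    have e0 : FreeGroup.mk ((tail t (-(n : ℤ))).toWord ++ f') = tail t (-(n : ℤ)) * F := by
      rw [mk_append, mk_toWord]
    have e2 : tail t (-((p' + 1 : ℕ) : ℤ)) * ψ (tail t (-(n : ℤ)))
        = tail t (-((n + 1 : ℕ) : ℤ)) * E := by
      rw [hψ, hE, ← tail_add, ← tail_add]; congr 1; push_cast; ring
    -- Again free of cancellation, with `tail a (-(n + 1))` hidden in the two ends `α` and `ψ F`.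
    have e3 : (tail t (-(n : ℤ)) * F)⁻¹ * tail t (-((p' + 1 : ℕ) : ℤ)) *
        ψ (tail t (-(n : ℤ)) * F) = (α * (of a)⁻¹) * (E * ψ F) := by
      calc _ = F⁻¹ * (tail t (-(n : ℤ)))⁻¹ *
              (tail t (-((p' + 1 : ℕ) : ℤ)) * ψ (tail t (-(n : ℤ)))) * ψ F := by
            rw [_root_.map_mul]; group
        _ = _ := by rw [e2, hα, h4]; group
    rw [e0, e3] at hD
    have hαl : α ∈ level m a.val := mul_mem (inv_mem hFl) (inv_mem (tail_mem_level _ _))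
    have hψF : ψ F ∈ level m a.val := phi_zpow_mem_level _ hFl
    have hEl := tail_mem_level_prev ht0 (-(p' : ℤ))
    have r0 : RP α (of a)⁻¹ := by
      have := (RP_of_mul_low (inv_mem hαl)).inv
      rwa [inv_inv] at this
    have r1 : RP E (ψ F) := by
      cases p' with
      | zero =>
        have : E = 1 := by rw [hE]; simp
        rw [this]; exact RP_one_left _
      | succ q =>
        refine RP_of_starts_inv (t := a) ?_ (not_starts_of_mem_level hψF)
        rw [hE, ← _root_.map_inv, starts_phi_zpow _ (inv_mem hEl)]
        exact starts_tail_neg_inv ht0 q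
    have r2 : RP (α * (of a)⁻¹) (E * ψ F) := by
      refine RP_of_starts_inv (t := a) ?_ ?_
      · rw [mul_inv_rev, inv_inv]; exact starts_of_mul_low (inv_mem hαl)
      · apply not_starts_of_count
        rw [r1, List.count_append, count_eq_zero_of_mem_level hψF, hE, count_phi_zpow _ _ _ hEl]
        exact count_tail_neg_pos ht0 p'
    have b1 : PowerBound D α.toWord := (hD.of_infix r2.left_infix).of_infix r0.left_infix
    have b2 : PowerBound D (ψ F).toWord := (hD.of_infix r2.right_infix).of_infix r1.right_infix
    have b3 := hLip ((p' + 1 : ℕ) : ℤ) (ψ F) D b2 (by omega)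
    rw [hψ, phi_zpow_apply_neg] at b3
    have b4 := (b3.mul b1).inv
    rw [hα, mul_inv_cancel_left, inv_inv] at b4
    have := natAbs_le_of_powerBound_tail ht _ b4
    rw [Int.natAbs_neg, Int.natAbs_natCast] at this ⊢
    omega

theorem commute_level_one {g h : FreeGroup (Fin m)} (hg : g ∈ level m 1) (hh : h ∈ level m 1) :
    g * h = h * g := by
  by_cases hm : 0 < m
  · obtain ⟨j, rfl⟩ := level_one hg hm
    obtain ⟨k, rfl⟩ := level_one hh hm
    rw [← zpow_add, ← zpow_add, add_comm]
  · obtain rfl : m = 0 := by omega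
    exact Subsingleton.elim _ _

theorem mk_phiWord (k : ℤ) (w : Word m) :
    FreeGroup.mk (phiWord k w) = (phi m ^ k) (FreeGroup.mk w) := mk_toWord

theorem cons_prefix_phiWord {t : Fin m} {f : Word m} {k : ℤ} (h : f <+: (tail t k).toWord) :
    (t, true) :: f <+: phiWord k [(t, true)] := by
  rw [phiWord_of_mul, mk_pos, phi_zpow_of, RP_of_mul_low (tail_mem_level t k), toWord_of]
  simpa using h

/-- A common prefix `S` of a reduced word `S Λ` and of its image under `φ^{-p}` can be replaced by a
prefix of some `φ^k(a_t)`, with `k` controlled by the powers of `a_1` in the two remainders. -/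
theorem exists_short_common_prefix (hm : 0 < m) {p : ℕ} (hp : 0 < p) {n : ℕ} (hn : n ≤ m) :
    ∀ S Λ z : Word m, LettersBelow n S → IsReduced (S ++ Λ) → IsReduced (S ++ z) →
      phiWord (-(p : ℤ)) (S ++ Λ) = S ++ z → ∀ N, PowerBound N Λ → PowerBound N z →
      ∃ (S' : Word m) (t : Fin m) (k : ℤ), t.val + 1 ≤ max 1 n ∧
        S' <+: phiWord k [(t, true)] ∧ k.natAbs ≤ 4 * N + 10 * m * p ∧
        (phi m ^ (-(p : ℤ))) (FreeGroup.mk (S' ++ Λ)) = FreeGroup.mk (S' ++ z) := by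
  induction n with
  | zero =>
    intro S Λ z hS hr1 hr2 heq N _ _
    obtain rfl : S = [] := by
      cases S with
      | nil => rfl
      | cons l S => exact absurd (hS l (by simp)) (by omega)
    refine ⟨[], ⟨0, hm⟩, 0, by simp, List.nil_prefix, by simp, ?_⟩
    rw [← mk_phiWord, heq]
  | succ b' ih =>
    have ih := ih (by omega)
    intro S Λ z hS hr1 hr2 heq N hΛ hz
    set b : Fin m := ⟨b', hn⟩ with hb
    -- the part of `S` up to its last letter of top index is fixed
    obtain ⟨S₀, S₁, rfl, hfix, hS₁⟩ : ∃ S₀ S₁, S = S₀ ++ S₁ ∧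
        (phi m ^ (-(p : ℤ))) (FreeGroup.mk S₀) = FreeGroup.mk S₀ ∧
        (LettersBelow b' S₁ ∨ ∃ f, S₁ = (b, true) :: f ∧ LettersBelow b' f) := by
      rcases Nat.eq_zero_or_pos (numAt b S) with h0 | h0
      · refine ⟨[], S, rfl, by simp [← one_eq_mk], Or.inl ?_⟩
        exact lettersBelow_of_lettersAt_eq_nil (t := b) hS (List.length_eq_zero_iff.1 h0)
      · have h1 := phiWord_cutAt_eq b p (L := []) (y := S) (ρ := Λ) (w := []) (rest := z)
          (by simpa using hr1) (by simp [LettersBelow]) hS (by simp [LettersBelow]) rfl h0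
          (by simpa using heq)
        obtain ⟨r, hr, h2⟩ := cutAt_spec b S (numAt b S - 1) (by omega)
        refine ⟨_, r, hr, ?_, ?_⟩
        · rw [← mk_phiWord]
          exact congrArg FreeGroup.mk h1
        · have hnum := congrArg (numAt b) hr
          rw [numAt_append] at hnum
          have hrS : r ⊆ S := by rw [hr]; simp
          rcases h2 with ⟨c, hc, hcn⟩ | ⟨f, rfl, hcn⟩
          · left
            refine lettersBelow_of_lettersAt_eq_nil (t := b) (hS.subset hrS)
              (List.length_eq_zero_iff.1 ?_)
            rw [hc, numAt_append, numAt_cons_self (show (b, false).1 = b from rfl), numAt_nil] at hnum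
            show numAt b r = 0
            omega
          · right
            refine ⟨f, rfl, ?_⟩
            refine lettersBelow_of_lettersAt_eq_nil (t := b)
              (hS.subset (fun l hl => hrS (by simp [hl]))) (List.length_eq_zero_iff.1 ?_)
            rw [hcn, numAt_cons_self (show (b, true).1 = b from rfl)] at hnum
            show numAt b f = 0
            omega
    have hr1' : IsReduced (S₁ ++ Λ) := by
      rw [List.append_assoc] at hr1; exact hr1.right_of_append
    have hr2' : IsReduced (S₁ ++ z) := by
      rw [List.append_assoc] at hr2; exact hr2.right_of_append
    have heqm : (phi m ^ (-(p : ℤ))) (FreeGroup.mk (S₁ ++ Λ)) = FreeGroup.mk (S₁ ++ z) := by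
      have h3 := mk_phiWord (-(p : ℤ)) (S₀ ++ S₁ ++ Λ)
      rw [heq, List.append_assoc, List.append_assoc, mk_append, mk_append S₀, _root_.map_mul,
        hfix] at h3
      exact (mul_left_cancel h3).symm
    have heq' : phiWord (-(p : ℤ)) (S₁ ++ Λ) = S₁ ++ z := by
      rw [phiWord_of_mul, heqm, toWord_mk_of_isReduced hr2']
    rcases hS₁ with hS₁ | ⟨f, rfl, hf⟩
    · obtain ⟨S', t, k, h1, h2, h3, h4⟩ := ih S₁ Λ z hS₁ hr1' hr2' heq' N hΛ hz
      exact ⟨S', t, k, by omega, h2, h3, h4⟩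
    have econs : ∀ w : Word m, FreeGroup.mk ((b, true) :: w) = of b * FreeGroup.mk w := by
      intro w; rw [← mk_pos, ← mk_append]; rfl
    have hkey : tail b (-(p : ℤ)) * (phi m ^ (-(p : ℤ))) (FreeGroup.mk f) *
        (phi m ^ (-(p : ℤ))) (FreeGroup.mk Λ) = FreeGroup.mk f * FreeGroup.mk z := by
      rw [List.cons_append, List.cons_append, econs, econs, mk_append, mk_append, _root_.map_mul,
        _root_.map_mul, phi_zpow_of, mul_assoc] at heqm
      have := mul_left_cancel heqm
      rwa [← mul_assoc] at this
    rcases Nat.lt_or_ge 1 b' with hb1 | hb1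
    · have hpb : (prev b).val ≠ 0 := by rw [prev_val]; simp only [hb]; omega
      obtain ⟨j, hj⟩ : ∃ j : ℤ, f <+: (tail b j).toWord := by
        obtain ⟨μ, Λ', rfl, hμ, hΛ'⟩ := exists_split_level b' Λ
        have hfμ : IsReduced (f ++ μ) :=
          hr1'.infix ⟨[(b, true)], Λ', by simp⟩
        have hΛr : IsReduced Λ' := hr1'.infix ⟨(b, true) :: f ++ μ, [], by simp⟩
        obtain ⟨c, τ, e, hcτ, hc, hτ, he, hce⟩ := phi_neg_head_tail b p (g := FreeGroup.mk Λ')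
          (by rwa [toWord_mk_of_isReduced hΛr])
        have hcτr : IsReduced (c ++ τ) := by rw [← hcτ]; exact isReduced_toWord
        set G := FreeGroup.mk (f ++ μ) with hG
        have hGl : G ∈ level m b.val := mk_mem_level (hf.append hμ)
        -- `K` is the part of rank at most `b'` at the beginning of the image, as `c` in the image of
        -- `Λ'` represents `φ^{-p}(tail b e)`.
        set K := (phi m ^ (-(p : ℤ))) ((tail b p)⁻¹ * G * tail b e) with hK
        have hKl : K ∈ level m b.val := phi_zpow_mem_level _ (mul_mem (mul_mem
          (inv_mem (tail_mem_level _ _)) hGl) (tail_mem_level _ _))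
        refine prefix_tail_of_eq hpb hKl (G := G) ?_ ?_ he hp ?_
        · rw [hG, toWord_mk_of_isReduced hfμ]; exact List.prefix_append _ _
        · have h5 : K * FreeGroup.mk τ = FreeGroup.mk (f ++ z) := by
            have h6 : (phi m ^ (-(p : ℤ))) (FreeGroup.mk Λ') = FreeGroup.mk c * FreeGroup.mk τ := by
              rw [← mk_append, ← hcτ, mk_toWord]
            rw [mk_append f z, ← hkey, mk_append μ, _root_.map_mul, h6, hK, _root_.map_mul,
              _root_.map_mul, hce, hG, mk_append f μ, _root_.map_mul, tail_neg, _root_.map_inv]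
            group
          have h7 : RP K (FreeGroup.mk τ) :=
            RP_of_mem_level hKl (by rwa [toWord_mk_of_isReduced hcτr.right_of_append])
          have h8 : f ++ z = K.toWord ++ τ := by
            rw [← toWord_mk_of_isReduced (show IsReduced (f ++ z) from hr2'.tail), ← h5, h7,
              toWord_mk_of_isReduced hcτr.right_of_append]
          rcases List.prefix_or_prefix_of_prefix (List.prefix_append f z)
            (h8 ▸ List.prefix_append K.toWord τ) with h9 | ⟨g, hg⟩
          · exact h9
          · cases g with
            | nil => rw [← hg]; simp
            | cons l g =>
              exfalso
              rw [← hg, List.append_assoc, List.append_cancel_left_eq] at h8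
              have h10 := hτ l (by rw [← h8]; simp)
              have h11 := hf l (by rw [← hg]; simp)
              simp only [hb] at h10
              omega
        · rw [hK, phi_zpow_apply_neg]; group
      obtain ⟨k, hk, hkb⟩ := exists_prefix_tail_le hpb hj (p := p) (D := 2 * N + 2 * m * p) hp (by
        have e5 : (FreeGroup.mk f)⁻¹ * tail b (-(p : ℤ)) * (phi m ^ (-(p : ℤ))) (FreeGroup.mk f)
            = FreeGroup.mk z * ((phi m ^ (-(p : ℤ))) (FreeGroup.mk Λ))⁻¹ := by
          rw [eq_mul_inv_iff_mul_eq, mul_assoc, mul_assoc, inv_mul_eq_iff_eq_mul, ← mul_assoc,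
            hkey]
        rw [e5]
        have b1 : PowerBound N (FreeGroup.mk z).toWord := by
          rwa [toWord_mk_of_isReduced hr2'.right_of_append]
        have b2 : PowerBound N (FreeGroup.mk Λ).toWord := by
          rwa [toWord_mk_of_isReduced hr1'.right_of_append]
        have b3 := PowerBound.phi_zpow (-(p : ℤ)) le_rfl _ (mem_level_self _) N b2
        rw [Int.natAbs_neg, Int.natAbs_natCast] at b3
        exact (b1.mul b3.inv).mono (by omega))
      refine ⟨(b, true) :: f, b, k, by simp only [hb]; omega, cons_prefix_phiWord hk, ?_, heqm⟩
      have h1 : 2 * p ≤ 2 * m * p := by nlinarith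
      have h2 : 2 * m ≤ 2 * m * p := by nlinarith
      have h3 : 10 * m * p = 5 * (2 * m * p) := by ring
      omega
    · -- Here `f` is a power of `a_1`, which drops out of the equation.
      refine ⟨[(b, true)], b, 0, by simp only [hb]; omega, ?_, by simp, ?_⟩
      · rw [phiWord_of_mul, zpow_zero]
        simp [mk_pos]
      · have hf1 : FreeGroup.mk f ∈ level m 1 := mk_mem_level (hf.mono hb1)
        have ht1 : tail b (-(p : ℤ)) ∈ level m 1 := level_mono hb1 (tail_mem_level _ _)
        rw [phi_zpow_level_one hf1, commute_level_one ht1 hf1, mul_assoc] at hkey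
        have h5 := mul_left_cancel hkey
        rw [mk_append, mk_append, _root_.map_mul, mk_pos, phi_zpow_of, mul_assoc, h5]

/-! ### Powers of the first generator and the length in the hydra group -/

/-- `Reach b n g k`: the element `g s^k` of the hydra group is a product of at most `n` letters
`s^{±1}` and `a_t^{±1}` with `t < b`. -/
inductive Reach (b : ℕ) : ℕ → FreeGroup (Fin m) → ℤ → Prop
  | one : Reach b 0 1 0
  | stay {n : ℕ} {g : FreeGroup (Fin m)} {k : ℤ} : Reach b n g k → Reach b (n + 1) g k
  | up {n : ℕ} {g : FreeGroup (Fin m)} {k : ℤ} : Reach b n g k → Reach b (n + 1) g (k + 1)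
  | down {n : ℕ} {g : FreeGroup (Fin m)} {k : ℤ} : Reach b n g k → Reach b (n + 1) g (k - 1)
  | letter {n : ℕ} {g : FreeGroup (Fin m)} {k : ℤ} (t : Fin m) : Reach b n g k → t.val < b →
      Reach b (n + 1) (g * (phi m ^ (-k)) (of t)) k
  | letter_inv {n : ℕ} {g : FreeGroup (Fin m)} {k : ℤ} (t : Fin m) : Reach b n g k → t.val < b →
      Reach b (n + 1) (g * ((phi m ^ (-k)) (of t))⁻¹) k

namespace Reach

variable {b n n' : ℕ} {g f : FreeGroup (Fin m)} {k : ℤ} {t : Fin m}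

theorem mono (h : Reach b n g k) (hn : n ≤ n') : Reach b n' g k := by
  obtain ⟨d, rfl⟩ := Nat.exists_eq_add_of_le hn
  induction d with
  | zero => exact h
  | succ d ih => exact (ih (by omega)).stay

theorem natAbs_le (h : Reach b n g k) : k.natAbs ≤ n := by
  induction h <;> omega

theorem tail_up (ht : t.val ≠ 0) (h : Reach t.val n (f * tail t (-k)) k) :
    Reach t.val (n + 2) (f * tail t (-(k + 1))) (k + 1) := by
  have h1 := h.up.letter_inv (prev t) (by rw [prev_val]; omega)
  have h2 := tail_succ ht (-(k + 1))
  rw [show -(k + 1) + 1 = -k by ring] at h2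
  rwa [h2, mul_assoc, mul_inv_cancel_right] at h1

theorem tail_down (ht : t.val ≠ 0) (h : Reach t.val n (f * tail t (-k)) k) :
    Reach t.val (n + 2) (f * tail t (-(k - 1))) (k - 1) := by
  have h1 := (h.letter (prev t) (by rw [prev_val]; omega)).down
  have h2 := tail_succ ht (-k)
  rw [show -k + 1 = -(k - 1) by ring] at h2
  rwa [mul_assoc, ← h2] at h1

theorem id (k : ℤ) : Reach b (2 * k.natAbs) (1 : FreeGroup (Fin m)) k := by
  induction k with
  | zero => exact one
  | succ k ih => exact ih.up.mono (by omega)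
  | pred k ih => exact ih.down.mono (by omega)

theorem tail (ht : t.val ≠ 0) (k : ℤ) : Reach t.val (2 * k.natAbs) (tail t (-k)) k := by
  induction k with
  | zero => simpa using one
  | succ k ih =>
    rw [← one_mul (Hydra.tail t _)] at ih
    have := tail_up ht ih
    rw [one_mul] at this
    exact this.mono (by omega)
  | pred k ih =>
    rw [← one_mul (Hydra.tail t _)] at ih
    have := tail_down ht ih
    rw [one_mul] at this
    exact this.mono (by omega)

end Reach

/-- A word that is empty or ends with a letter `a_t^{±1}`, in which the maximal subwords `f` of
smaller rank satisfy `R δ f`, where `δ` is the exponent of the letter `a_t^{±1}` that follows `f`. -/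
inductive GoodPrefix (t : Fin m) (R : Bool → FreeGroup (Fin m) → Prop) : Word m → Prop
  | nil : GoodPrefix t R []
  | snoc {u : Word m} {f : FreeGroup (Fin m)} (δ : Bool) : GoodPrefix t R u → f ∈ level m t.val →
      R δ f → GoodPrefix t R (u ++ f.toWord ++ [(t, δ)])

/-- The maximal subwords `f` of smaller rank of the reduced word of `g` satisfy `R δ f`, where `δ` is
the exponent of the letter `a_t^{±1}` that follows `f`, or `Q f` if `f` is at the end. -/
def Good (t : Fin m) (R : Bool → FreeGroup (Fin m) → Prop) (Q : FreeGroup (Fin m) → Prop)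
    (g : FreeGroup (Fin m)) : Prop :=
  ∃ (u : Word m) (f : FreeGroup (Fin m)), g.toWord = u ++ f.toWord ∧ GoodPrefix t R u ∧
    f ∈ level m t.val ∧ Q f

section Good

variable {t : Fin m} {R R' : Bool → FreeGroup (Fin m) → Prop} {Q Q' : FreeGroup (Fin m) → Prop}
  {g : FreeGroup (Fin m)} {u : Word m}

theorem GoodPrefix.mono (h : GoodPrefix t R u) (hR : ∀ δ f, R δ f → R' δ f) :
    GoodPrefix t R' u := by
  induction h with
  | nil => exact .nil
  | snoc δ _ hf hfR ih => exact ih.snoc δ hf (hR _ _ hfR)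

theorem GoodPrefix.last (h : GoodPrefix t R u) : ∀ l ∈ u.getLast?, l.1 = t := by
  cases h with
  | nil => simp
  | snoc δ _ _ _ =>
    intro l hl
    simp only [List.getLast?_append, List.getLast?_singleton, Option.some_or,
      Option.mem_def, Option.some.injEq] at hl
    rw [← hl]

theorem Good.mono (h : Good t R Q g) (hR : ∀ δ f, R δ f → R' δ f) (hQ : ∀ f, Q f → Q' f) :
    Good t R' Q' g := by
  obtain ⟨u, f, h1, h2, h3, h4⟩ := h
  exact ⟨u, f, h1, h2.mono hR, h3, hQ f h4⟩

theorem Good.mul_low (h : Good t R Q g) {e : FreeGroup (Fin m)} (he : e ∈ level m t.val)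
    (hQ : ∀ f, Q f → Q' (f * e)) : Good t R Q' (g * e) := by
  obtain ⟨u, f, h1, h2, h3, h4⟩ := h
  refine ⟨u, f * e, ?_, h2, mul_mem h3 he, hQ f h4⟩
  have hur : IsReduced u := isReduced_of_infix_toWord (g := g) ⟨[], f.toWord, by rw [h1]; rfl⟩
  have e1 : g = FreeGroup.mk u * f := by
    rw [← mk_toWord (x := g), h1, mk_append, mk_toWord]
  have hrp : RP (FreeGroup.mk u) (f * e) := by
    apply RP_of_isReduced
    rw [toWord_mk_of_isReduced hur]
    refine List.IsChain.append hur isReduced_toWord ?_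
    intro x hx y hy hxy
    have h5 := h2.last x hx
    have h6 := (mul_mem h3 he) y (List.mem_of_head? hy)
    rw [← hxy, h5] at h6
    exact absurd h6 (lt_irrefl _)
  rw [e1, mul_assoc, hrp, toWord_mk_of_isReduced hur]

theorem Good.mul_letter (h : Good t R Q g) (δ : Bool) (hR : ∀ f, R (!δ) f → Q' f)
    (hQ : ∀ f, Q f → R δ f) (h1 : Q' 1) : Good t R Q' (g * FreeGroup.mk [(t, δ)]) := by
  obtain ⟨u, f, hg, hu, hf, hQf⟩ := h
  have hgr : IsReduced (u ++ f.toWord) := by rw [← hg]; exact isReduced_toWord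
  have e1 : g * FreeGroup.mk [(t, δ)] = FreeGroup.mk (u ++ f.toWord ++ [(t, δ)]) := by
    rw [mk_append, ← hg, mk_toWord]
  have generic : (∀ l ∈ (u ++ f.toWord).getLast?, l.1 = t → l.2 = δ) →
      Good t R Q' (g * FreeGroup.mk [(t, δ)]) := by
    intro hl
    refine ⟨u ++ f.toWord ++ [(t, δ)], 1, ?_, hu.snoc δ hf (hQ f hQf), one_mem _, h1⟩
    rw [e1, toWord_one, List.append_nil, toWord_mk_of_isReduced]
    refine List.IsChain.append hgr (by simp) ?_
    intro x hx y hy hxy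
    simp only [List.head?_cons, Option.mem_def, Option.some.injEq] at hy
    subst hy
    exact hl x hx hxy
  by_cases hf1 : f = 1
  · subst hf1
    cases hu with
    | nil => exact generic (by simp)
    | @snoc u' f' δ' hu' hf' hR' =>
      by_cases hδ : δ' = δ
      · refine generic ?_
        intro l hl _
        simp only [toWord_one, List.append_nil, List.getLast?_append, List.getLast?_singleton,
          Option.some_or, Option.mem_def, Option.some.injEq] at hl
        rw [← hl, hδ]
      · obtain rfl : δ' = !δ := by cases δ <;> cases δ' <;> simp_all
        refine ⟨u', f', ?_, hu', hf', hR f' hR'⟩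
        rw [toWord_one, List.append_nil] at e1 hgr
        have e2 : FreeGroup.mk [(t, !δ)] * FreeGroup.mk [(t, δ)] = 1 := by
          have : FreeGroup.mk [(t, !δ)] = (FreeGroup.mk [(t, δ)])⁻¹ := by rw [inv_mk]; rfl
          rw [this, inv_mul_cancel]
        rw [e1, mk_append, mk_append _ [(t, !δ)], mul_assoc, e2, mul_one,
          toWord_mk_of_isReduced hgr.left_of_append]
  · refine generic ?_
    intro l hl hlt
    rw [List.getLast?_append] at hl
    have hne : f.toWord ≠ [] := fun h => hf1 (toWord_eq_nil_iff.1 h)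
    rw [List.getLast?_eq_some_getLast hne] at hl
    simp only [Option.some_or, Option.mem_def, Option.some.injEq] at hl
    have := hf l (by rw [← hl]; exact List.getLast_mem hne)
    rw [hlt] at this
    exact absurd this (lt_irrefl _)

theorem Good.powerBound (h : Good t R Q g) (ht : t.val ≠ 0) {N : ℕ}
    (hR : ∀ δ f, R δ f → PowerBound N f.toWord) (hQ : ∀ f, Q f → PowerBound N f.toWord) :
    PowerBound N g.toWord := by
  obtain ⟨u, f, hg, hu, hf, hQf⟩ := h
  have key : PowerBound N u := by
    clear hg
    induction hu with
    | nil => exact PowerBound.of_length (Nat.zero_le _)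
    | snoc δ hu' hf' hR' ih =>
      refine PowerBound.append_sep (PowerBound.append_sep ih (hR _ _ hR') (Or.inl ?_)) ?_
        (Or.inr ?_)
      · intro l hl
        rw [hu'.last l hl]
        exact ht
      · intro n l hl hi
        cases n with
        | zero => exact Nat.zero_le _
        | succ n =>
          have : l ∈ [(t, δ)] := hi.subset (by simp)
          rw [List.mem_singleton] at this
          rw [this] at hl
          exact absurd hl ht
      · simpa using ht
  rw [hg]
  refine key.append_sep (hQ f hQf) (Or.inl ?_)
  intro l hl
  rw [hu.last l hl]
  exact ht

end Good

/-- A short path in the hydra group that reaches `g s^k` projects to short paths that reach the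
maximal subwords of smaller rank of `g`, after a correction that undoes the effect of `s^k` on the
letter that follows. -/
theorem Reach.good {t : Fin m} (ht : t.val ≠ 0) {n : ℕ} {g : FreeGroup (Fin m)} {k : ℤ}
    (h : Reach (t.val + 1) n g k) :
    Good t (fun δ f => if δ then Reach t.val (2 * n) f k
      else Reach t.val (2 * n) (f * Hydra.tail t (-k)) k) (fun f => Reach t.val (2 * n) f k) g := by
  have step : ∀ (n : ℕ) (k : ℤ) (δ : Bool) (f : FreeGroup (Fin m)),
      (if δ then Reach t.val (2 * n) f k else Reach t.val (2 * n) (f * Hydra.tail t (-k)) k) →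
      (if δ then Reach t.val (2 * (n + 1)) f k
        else Reach t.val (2 * (n + 1)) (f * Hydra.tail t (-k)) k) := by
    intro n k δ f h
    cases δ
    · exact Reach.mono (by simpa using h) (by omega)
    · exact Reach.mono (by simpa using h) (by omega)
  induction h with
  | one => exact ⟨[], 1, by simp, .nil, one_mem _, .one⟩
  | stay _ ih => exact ih.mono (step _ _) fun f hf => hf.mono (by omega)
  | up _ ih =>
    refine ih.mono ?_ fun f hf => hf.up.mono (by omega)
    intro δ f hf
    cases δ
    · exact Reach.tail_up ht (by simpa using hf)
    · exact (Reach.up (by simpa using hf)).mono (by omega)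
  | down _ ih =>
    refine ih.mono ?_ fun f hf => hf.down.mono (by omega)
    intro δ f hf
    cases δ
    · exact Reach.tail_down ht (by simpa using hf)
    · exact (Reach.down (by simpa using hf)).mono (by omega)
  | @letter n g k s hr hs ih =>
    have hk := hr.natAbs_le
    rcases Nat.lt_succ_iff_lt_or_eq.1 hs with h | h
    · refine (ih.mono (step _ _) fun f hf => hf).mul_low
        (phi_zpow_mem_level _ (of_mem_level h)) ?_
      exact fun f hf => (hf.letter s h).mono (by omega)
    · obtain rfl : s = t := Fin.ext h
      rw [phi_zpow_of, ← mul_assoc]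
      refine ((ih.mul_letter true (Q' := fun f => Reach s.val (2 * n) (f * Hydra.tail s (-k)) k)
        ?_ ?_ ?_).mono (step _ _) fun f hf => hf).mul_low (tail_mem_level _ _) ?_
      · simp
      · simp
      · rw [one_mul]; exact (Reach.tail ht k).mono (by omega)
      · exact fun f hf => hf.mono (by omega)
  | @letter_inv n g k s hr hs ih =>
    have hk := hr.natAbs_le
    rcases Nat.lt_succ_iff_lt_or_eq.1 hs with h | h
    · refine (ih.mono (step _ _) fun f hf => hf).mul_low
        (inv_mem (phi_zpow_mem_level _ (of_mem_level h))) ?_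
      exact fun f hf => (hf.letter_inv s h).mono (by omega)
    · obtain rfl : s = t := Fin.ext h
      rw [phi_zpow_of, mul_inv_rev, ← mul_assoc, ← mk_neg]
      refine ((ih.mul_low (Q' := fun f => Reach s.val (2 * n) (f * Hydra.tail s (-k)) k)
        (inv_mem (tail_mem_level s (-k))) ?_).mul_letter false
        (Q' := fun f => Reach s.val (2 * n) f k) ?_ ?_ ?_).mono (step _ _)
        fun f hf => hf.mono (by omega)
      · intro f hf
        rwa [inv_mul_cancel_right]
      · simp
      · simp
      · exact (Reach.id k).mono (by omega)

/-- The factor `3` per rank consists of a factor `2` from `Reach.good` and of the correction by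
`tail t (-k)`, whose powers of `a_1` have exponents of absolute value at most `|k| ≤ n`. -/
theorem Reach.powerBound {b : ℕ} (hb : b ≤ m) {n : ℕ} {g : FreeGroup (Fin m)} {k : ℤ}
    (h : Reach b n g k) : PowerBound (3 ^ b * n) g.toWord := by
  have low : ∀ {b : ℕ}, b ≤ 1 → ∀ {n : ℕ} {g : FreeGroup (Fin m)} {k : ℤ}, Reach b n g k →
      g.norm ≤ n := by
    intro b hb n g k h
    have fixed : ∀ (t : Fin m) (k : ℤ), t.val < b → (phi m ^ k) (of t) = of t :=
      fun t k ht => phi_zpow_level_one (of_mem_level (by omega)) k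
    induction h with
    | one => simp
    | stay _ ih => omega
    | up _ ih => omega
    | down _ ih => omega
    | @letter n g k t _ ht ih =>
      rw [fixed t _ ht]
      exact (FreeGroup.norm_mul_le _ _).trans (by rw [norm_of]; omega)
    | @letter_inv n g k t _ ht ih =>
      rw [fixed t _ ht]
      exact (FreeGroup.norm_mul_le _ _).trans (by rw [norm_inv_eq, norm_of]; omega)
  induction b generalizing n g k with
  | zero => exact PowerBound.of_length ((low (by omega) h).trans (by omega))
  | succ b ih =>
    rcases Nat.eq_zero_or_pos b with rfl | hb0
    · exact PowerBound.of_length ((low le_rfl h).trans (by omega))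
    have ht0 : (⟨b, hb⟩ : Fin m).val ≠ 0 := by simp only; omega
    have h3 : 3 ^ (b + 1) * n = 3 ^ b * (2 * n) + 3 ^ b * n := by ring
    have h4 : n ≤ 3 ^ b * n := Nat.le_mul_of_pos_left _ (by positivity)
    refine (Reach.good (t := ⟨b, hb⟩) ht0 h).powerBound ht0 ?_ ?_
    · intro δ f hf
      cases δ
      · have h1 : Reach b (2 * n) (f * Hydra.tail ⟨b, hb⟩ (-k)) k := by simpa using hf
        have h2 := (ih (by omega) h1).mul (powerBound_tail ⟨b, hb⟩ (-k)).inv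
        rw [mul_inv_cancel_right, Int.natAbs_neg] at h2
        have := h.natAbs_le
        exact h2.mono (by omega)
      · exact (ih (by omega) (by simpa using hf)).mono (by omega)
    · exact fun f hf => (ih (by omega) hf).mono (by omega)

theorem reach_of_list (l : List (HydraGroup m)) (hl : ∀ y ∈ l, y ∈ hydraGens m ∨ y⁻¹ ∈ hydraGens m) :
    Reach m l.length l.prod.left l.prod.right.toAdd := by
  induction l using List.reverseRecOn with
  | nil => exact Reach.one
  | append_singleton l y ih =>
    have ih := ih fun y hy => hl y (by simp [hy])
    have act : ∀ (j : Multiplicative ℤ) (g : FreeGroup (Fin m)),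
        zpowersHom (MulAut (FreeGroup (Fin m))) (phi m)⁻¹ j g = (phi m ^ (-j.toAdd)) g := by
      intro j g
      rw [zpowersHom_apply, inv_zpow, zpow_neg]
    rw [List.prod_append, List.prod_singleton, List.length_append, List.length_singleton,
      SemidirectProduct.mul_left, SemidirectProduct.mul_right, act, toAdd_mul]
    have hy := hl y (by simp)
    have gens : ∀ y ∈ hydraGens m, y = SemidirectProduct.inr (Multiplicative.ofAdd 1) ∨
        ∃ t, y = SemidirectProduct.inl (of t) := by
      rintro y (rfl | ⟨t, rfl⟩)
      exacts [Or.inl rfl, Or.inr ⟨t, rfl⟩]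
    rcases hy with hy | hy
    · rcases gens y hy with rfl | ⟨t, rfl⟩
      · simpa using ih.up
      · simpa using ih.letter t t.isLt
    · rcases gens _ hy with hy | ⟨t, hy⟩
      · rw [inv_eq_iff_eq_inv, ← _root_.map_inv] at hy
        subst hy
        simpa [← sub_eq_add_neg] using ih.down
      · rw [inv_eq_iff_eq_inv, ← _root_.map_inv] at hy
        subst hy
        simpa using ih.letter_inv t t.isLt

/-- The exponents of the powers of `a_1` in a reduced word are bounded linearly by the length of the
word in the hydra group. -/
theorem powerBound_lenH {w : Word m} (hw : IsReduced w) : PowerBound (3 ^ m * lenH w) w := by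
  have hne : {n : ℕ | ∃ l : List (HydraGroup m), l.length = n ∧
      (∀ y ∈ l, y ∈ hydraGens m ∨ y⁻¹ ∈ hydraGens m) ∧
      l.prod = SemidirectProduct.inl (FreeGroup.mk w)}.Nonempty := by
    clear hw
    induction w with
    | nil => exact ⟨0, [], rfl, by simp, by simp [← one_eq_mk]⟩
    | cons a w ih =>
      obtain ⟨n, l, hl, hgen, hprod⟩ := ih
      refine ⟨n + 1, SemidirectProduct.inl (FreeGroup.mk [a]) :: l, by simp [hl], ?_, ?_⟩
      · intro y hy
        rcases List.mem_cons.1 hy with rfl | hy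
        · obtain ⟨t, δ⟩ := a
          cases δ
          · right
            rw [mk_neg, ← _root_.map_inv, inv_inv]
            exact Or.inr ⟨t, rfl⟩
          · left
            exact Or.inr ⟨t, rfl⟩
        · exact hgen y hy
      · rw [List.prod_cons, hprod, ← _root_.map_mul, ← mk_append]; rfl
  obtain ⟨l, hl, hgen, hprod⟩ := Nat.sInf_mem hne
  have := (reach_of_list l hgen).powerBound le_rfl
  rw [hprod, SemidirectProduct.left_inl, toWord_mk_of_isReduced hw, hl] at this
  exact this

/-! ### The cancellation data of an equation -/

theorem mk_twistWord (p : ℕ) (u v : Word m) : FreeGroup.mk (twistWord p u v)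
    = FreeGroup.mk u * (phi m ^ (-(p : ℤ))) (FreeGroup.mk v) := by
  rw [twistWord, ← toWord_mk, mk_toWord, mk_append, mk_phiWord]

theorem isReduced_twistWord (p : ℕ) (u v : Word m) : IsReduced (twistWord p u v) := by
  rw [twistWord, ← toWord_mk]; exact isReduced_toWord

theorem isReduced_phiWord (k : ℤ) (w : Word m) : IsReduced (phiWord k w) := isReduced_toWord

theorem phiWord_nil (k : ℤ) : phiWord k ([] : Word m) = [] := by
  rw [phiWord_of_mul, ← one_eq_mk, _root_.map_one, toWord_one]

theorem phiWord_invRev (k : ℤ) (w : Word m) : phiWord k (invRev w) = invRev (phiWord k w) := by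
  rw [phiWord_of_mul, mk_invRev, _root_.map_inv, toWord_inv]; rfl

theorem phiWord_phiWord (k l : ℤ) (w : Word m) : phiWord k (phiWord l w) = phiWord (k + l) w := by
  rw [phiWord_of_mul, mk_phiWord, ← phi_zpow_add]; rfl

theorem phiWord_zero {w : Word m} (hw : IsReduced w) : phiWord 0 w = w := by
  rw [phiWord_of_mul, zpow_zero]; exact toWord_mk_of_isReduced hw

theorem twistedEq_iff (p : ℕ) (u₀ u₁ v₀ v₁ X : Word m) : TwistedEq p u₀ u₁ v₀ v₁ X ↔
    FreeGroup.mk X = FreeGroup.mk (twistWord p u₁ u₀) * (phi m ^ (-(p : ℤ))) (FreeGroup.mk X) *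
      (FreeGroup.mk (twistWord p v₁ v₀))⁻¹ := by
  rw [TwistedEq, mk_twistWord, mk_twistWord, mk_append, mk_append, mk_append, mk_append, mk_invRev,
    mk_invRev, _root_.map_mul, _root_.map_mul, _root_.map_inv]
  constructor
  · intro h
    calc FreeGroup.mk X = FreeGroup.mk u₁ * ((FreeGroup.mk u₁)⁻¹ * FreeGroup.mk X *
          FreeGroup.mk v₁) * (FreeGroup.mk v₁)⁻¹ := by group
      _ = _ := by rw [← h]; group
  · intro h
    conv_rhs => rw [h]
    group

/-- The words `u₁ φ^{-p}(u₀) = L z`, `v₁ φ^{-p}(v₀) = R⁻¹ ζ` and the solution `L y R` of the equation,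
decomposed so that `L` and `R` are the parts that cancel and `φ^{-p}(L y R) = z⁻¹ y ζ`. -/
structure CancelData (p : ℕ) (u₀ u₁ v₀ v₁ L y R z ζ : Word m) : Prop where
  left_eq : twistWord p u₁ u₀ = L ++ z
  right_eq : twistWord p v₁ v₀ = invRev R ++ ζ
  isReduced : IsReduced (L ++ y ++ R)
  image_eq : phiWord (-(p : ℤ)) (L ++ y ++ R) = invRev z ++ y ++ ζ
  left_infix : L <:+: phiWord (-(p : ℤ)) u₀
  right_infix : R <:+: phiWord (-(p : ℤ)) (invRev v₀)

section

variable {p : ℕ} {u₀ u₁ v₀ v₁ L y R z ζ : Word m}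

theorem CancelData.twistedEq (D : CancelData p u₀ u₁ v₀ v₁ L y R z ζ) {Y : Word m}
    (h : (phi m ^ (-(p : ℤ))) (FreeGroup.mk (L ++ Y ++ R)) = FreeGroup.mk (invRev z ++ Y ++ ζ)) :
    TwistedEq p u₀ u₁ v₀ v₁ (L ++ Y ++ R) := by
  rw [twistedEq_iff, h, D.left_eq, D.right_eq]
  simp only [mk_append, mk_invRev]
  group

theorem CancelData.twistedEq_self (D : CancelData p u₀ u₁ v₀ v₁ L y R z ζ) :
    TwistedEq p u₀ u₁ v₀ v₁ (L ++ y ++ R) :=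
  D.twistedEq (by rw [← mk_phiWord, D.image_eq])

theorem isM_nil {C : ℝ} (hC : 0 ≤ C) (p : ℕ) (u₀ u₁ v₀ v₁ : Word m) {S : Word m}
    (hS : IsReduced S) (P : Word m) : IsM C p u₀ u₁ v₀ v₁ S P [] := by
  refine ⟨0, phiWord p S, [], isReduced_phiWord _ _, IsReduced.nil, ?_, Or.inl ⟨?_, ⟨[], ?_, ?_⟩, ?_⟩⟩
  · rw [Nat.cast_zero, zero_mul]; positivity
  · simp [periodicBlock]
  · exact List.nil_infix
  · rw [phiWord_phiWord, neg_add_cancel, phiWord_zero hS, List.nil_append]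
  · rw [phiWord_nil]; exact Or.inl List.nil_infix

/-- The middle part may lie in the image of the right part. -/
theorem CancelData.formX3_of_infix (D : CancelData p u₀ u₁ v₀ v₁ L y R z ζ) {C : ℝ} (hC : 0 ≤ C)
    (i : ℕ) (h : y <:+: phiWord (-(p : ℤ)) R) : FormX3 C i p u₀ u₁ v₀ v₁ (L ++ y ++ R) := by
  refine ⟨L, [], [], y, R, D.left_infix, Or.inr (Or.inl ⟨[], IsReduced.nil, List.nil_infix, ?_⟩),
    isM_nil hC p u₀ u₁ v₀ v₁ IsReduced.nil y,
    Or.inr (Or.inl ⟨R, D.isReduced.right_of_append, h, D.right_infix⟩), D.right_infix, by simp⟩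
  rw [phiWord_nil]; exact List.nil_infix

theorem suffixChunk_of_prefix {i p : ℕ} {B : ℝ} {S' : Word m} {t : Fin m} {k : ℤ}
    (ht : t.val + 1 ≤ i) (hk : |(k : ℝ)| ≤ B) (h : S' <+: phiWord k [(t, true)]) :
    SuffixChunk i p B (invRev S') :=
  ⟨invRev S', fun _ => [], ⟨t, k, ht, hk, by rwa [invRev_invRev]⟩, fun _ _ _ => List.nil_infix,
    by simp⟩

theorem prefixChunk_of_prefix {i p : ℕ} {B : ℝ} {P : Word m} {t : Fin m} {k : ℤ}
    (ht : t.val + 1 ≤ i) (hk : |(k : ℝ)| ≤ B) (h : P <+: phiWord k [(t, true)]) :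
    PrefixChunk i p B P :=
  ⟨P, fun _ => [], ⟨t, k, ht, hk, h⟩, fun _ _ _ => List.nil_infix, by simp⟩

/-- If the middle part is cut at a place which `φ^{-p}` respects, then its two halves can be replaced
by prefixes of images of generators. -/
theorem CancelData.formX3_of_matched {y₁ y₂ : Word m}
    (D : CancelData p u₀ u₁ v₀ v₁ L (y₁ ++ y₂) R z ζ) (hm : 0 < m) (hp : 0 < p) {C : ℝ} (hC : 0 ≤ C)
    {n i : ℕ} (hn : n ≤ m) (hn1 : 1 ≤ n) (hni : n ≤ i) (hy : LettersBelow n (y₁ ++ y₂))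
    (h : phiWord (-(p : ℤ)) (L ++ y₁) = invRev z ++ y₁) {NU NV : ℕ}
    (hU : PowerBound NU (L ++ z)) (hV : PowerBound NV (invRev R ++ ζ))
    (hCU : ((4 * NU + 10 * m * p : ℕ) : ℝ) ≤ C * ((lenF u₀ : ℝ) + lenF u₁ + p))
    (hCV : ((4 * NV + 10 * m * p : ℕ) : ℝ) ≤ C * ((lenF v₀ : ℝ) + lenF v₁ + p)) :
    ∃ X, TwistedEq p u₀ u₁ v₀ v₁ X ∧ FormX3 C i p u₀ u₁ v₀ v₁ X := by
  have hr := D.isReduced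
  have hir : IsReduced (invRev z ++ (y₁ ++ y₂) ++ ζ) := by
    rw [← D.image_eq]; exact isReduced_phiWord _ _
  have hmk : (phi m ^ (-(p : ℤ))) (FreeGroup.mk (y₂ ++ R)) = FreeGroup.mk (y₂ ++ ζ) := by
    have h1 := mk_phiWord (-(p : ℤ)) (L ++ (y₁ ++ y₂) ++ R)
    have h2 := mk_phiWord (-(p : ℤ)) (L ++ y₁)
    rw [h] at h2
    rw [D.image_eq, show L ++ (y₁ ++ y₂) ++ R = (L ++ y₁) ++ (y₂ ++ R) by simp,
      show invRev z ++ (y₁ ++ y₂) ++ ζ = (invRev z ++ y₁) ++ (y₂ ++ ζ) by simp,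
      mk_append, mk_append (L ++ y₁), _root_.map_mul, ← h2] at h1
    exact (mul_left_cancel h1).symm
  have hr2 : IsReduced (y₂ ++ ζ) := hir.infix ⟨invRev z ++ y₁, [], by simp⟩
  obtain ⟨S', s, k, hs1, hs2, hs3, hs4⟩ := exists_short_common_prefix hm hp hn (invRev y₁)
    (invRev L) z (LettersBelow.invRev (hy.subset (by simp)))
    (by rw [← invRev_append]; exact isReduced_invRev (hr.infix ⟨[], y₂ ++ R, by simp⟩))
    (by
      have := isReduced_invRev (w := invRev z ++ y₁) (hir.infix ⟨[], y₂ ++ ζ, by simp⟩)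
      rwa [invRev_append, invRev_invRev] at this)
    (by rw [← invRev_append, phiWord_invRev, h, invRev_append, invRev_invRev])
    NU (hU.of_infix ⟨[], z, by simp⟩).invRev (hU.of_infix ⟨L, [], by simp⟩)
  obtain ⟨P, t, l, ht1, ht2, ht3, ht4⟩ := exists_short_common_prefix hm hp hn y₂ R ζ
    (hy.subset (by simp)) (hr.infix ⟨L ++ y₁, [], by simp⟩) hr2
    (by rw [phiWord_of_mul, hmk, toWord_mk_of_isReduced hr2])
    NV (by simpa [invRev_invRev] using (hV.of_infix ⟨[], ζ, by simp⟩ : PowerBound NV (invRev R)).invRev)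
    (hV.of_infix ⟨invRev R, [], by simp⟩)
  have hcast : ∀ (k : ℤ) (N : ℕ) (B : ℝ), k.natAbs ≤ N → (N : ℝ) ≤ B → |(k : ℝ)| ≤ B := by
    intro k N B h1 h2
    rw [← Int.cast_abs, Int.abs_eq_natAbs, Int.cast_natCast]
    exact (Nat.cast_le.2 h1).trans h2
  have hS'r : IsReduced S' := isReduced_of_infix_toWord hs2.isInfix
  refine ⟨L ++ (invRev S' ++ P) ++ R, D.twistedEq ?_, L, invRev S', [], P, R, D.left_infix,
    Or.inl (suffixChunk_of_prefix (by omega) (hcast _ _ _ hs3 hCU) hs2),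
    isM_nil hC p u₀ u₁ v₀ v₁ (isReduced_invRev hS'r) P,
    Or.inl (prefixChunk_of_prefix (by omega) (hcast _ _ _ ht3 hCV) ht2), D.right_infix, by simp⟩
  have hs5 := congrArg (·⁻¹) hs4
  simp only [← _root_.map_inv, ← mk_invRev, invRev_append, invRev_invRev] at hs5
  rw [show L ++ (invRev S' ++ P) ++ R = (L ++ invRev S') ++ (P ++ R) by simp, mk_append,
    _root_.map_mul, hs5, ht4, ← mk_append]
  simp

/-! ### Periodic solutions -/

theorem periodicBlock_zero (p : ℕ) (w : Word m) : periodicBlock p 0 w = [] := by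
  simp [periodicBlock]

theorem periodicBlock_succ (p n : ℕ) (w : Word m) :
    periodicBlock p (n + 1) w = periodicBlock p n w ++ phiWord ((p : ℤ) * n) w := by
  simp [periodicBlock, List.range_succ]

theorem exists_mul_between (l : ℕ) {d : ℕ} (hd : 0 < d) : ∃ q, l ≤ q * d ∧ q * d < l + d := by
  refine ⟨(l + d - 1) / d, ?_, ?_⟩
  · have h1 := Nat.div_add_mod (l + d - 1) d
    have h2 := Nat.mod_lt (l + d - 1) hd
    rw [mul_comm] at h1
    omega
  · have := Nat.div_mul_le_self (l + d - 1) d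
    omega

theorem numAt_toWord_mk {t : Fin m} {w : Word m} (hw : IsReduced w) :
    numAt t (FreeGroup.mk w).toWord = numAt t w := by rw [toWord_mk_of_isReduced hw]

/-- If `L` contains fewer letters of top index than `z`, then `φ^{-p}` shifts the cuts of `y` by the
difference `d` of these numbers. So `y` consists of a first block, a number of periods whose images
under `φ^{-p}` are their predecessors, and a last block in `φ^{-p}(R)`. If `φ` does not fix the
period, then the growth of powers of `a_1` bounds the number of periods; otherwise the periods can be
left out. -/
theorem CancelData.formX3_of_periodic (D : CancelData p u₀ u₁ v₀ v₁ L y R z ζ) (hp : 0 < p) {C : ℝ}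
    (hC : 0 ≤ C) (i : ℕ) (b : Fin m) (hL : LettersBelow (b.val + 1) L)
    (hy : LettersBelow (b.val + 1) y) {c y' y'' : Word m}
    (hα : phiWord (-(p : ℤ)) (L ++ y) = invRev z ++ y' ++ c)
    (hyy : y = y' ++ y'') (hy'' : y'' <:+: phiWord (-(p : ℤ)) R)
    (hd : numAt b L < numAt b z) {NU NV : ℕ} (hU : PowerBound NU (L ++ z))
    (hV : PowerBound NV (invRev R ++ ζ))
    (hCq : ∀ q : ℕ, q * p ≤ 4 * NU + 6 * NV + 20 * m * p + 2 * m + 2 →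
      (q : ℝ) * p ≤ C * ((lenH u₀ : ℝ) + lenH u₁ + lenH v₀ + lenH v₁ + p)) :
    ∃ X, TwistedEq p u₀ u₁ v₀ v₁ X ∧ FormX3 C i p u₀ u₁ v₀ v₁ X := by
  have hLip : ∀ (k : ℤ) (g : FreeGroup (Fin m)) (N : ℕ), PowerBound N g.toWord →
      k.natAbs ≤ p → PowerBound (N + 2 * m * p) ((phi m ^ k) g).toWord := by
    intro k g N hN hk
    refine (PowerBound.phi_zpow k le_rfl g (mem_level_self g) N hN).mono ?_
    gcongr
  obtain ⟨d, hd', hd0⟩ : ∃ d, numAt b z = numAt b L + d ∧ 0 < d := ⟨numAt b z - numAt b L, by omega⟩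
  set l := numAt b y' with hl
  set ψ := phi m ^ (-(p : ℤ)) with hψ
  have hr := D.isReduced
  have hLy : IsReduced (L ++ y) := hr.left_of_append
  have hir : IsReduced (invRev z ++ y ++ ζ) := by
    rw [← D.image_eq]; exact isReduced_phiWord _ _
  have hg : FreeGroup.mk (L ++ y) ∈ level m (b.val + 1) := mk_mem_level (hL.append hy)
  have hgw := toWord_mk_of_isReduced hLy
  have hnum : d + l + numAt b c = numAt b y := by
    have h1 := numAt_phi_zpow b (-(p : ℤ)) hg
    rw [← phiWord_of_mul, hα, hgw, numAt_append, numAt_append, numAt_append, numAt_invRev, hd',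
      ← hl] at h1
    omega
  set cc : ℕ → Word m := fun k => cutAt b k y with hcc
  have hccp : ∀ k, cc k <+: y := fun k => cutAt_prefix b y k
  have cut : ∀ j, j < numAt b y →
      phiWord (-(p : ℤ)) (L ++ cc j) = cutAt b (numAt b L + j) (invRev z ++ y' ++ c) := by
    intro j hj
    have h1 := cutAt_phi_zpow (t := b) (-(p : ℤ)) hg (k := numAt b L + j)
      (by rw [hgw, numAt_append]; omega)
    rwa [hgw, cutAt_append, ← phiWord_of_mul, ← phiWord_of_mul, hα] at h1
  -- the image of each cut, shifted by `d`
  have hrelw : ∀ k < l, phiWord (-(p : ℤ)) (L ++ cc (d + k)) = invRev z ++ cc k := by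
    intro k hk
    have h1 := cutAt_append b (invRev z) (y' ++ c) k
    rw [numAt_invRev] at h1
    rw [cut (d + k) (by omega), show numAt b L + (d + k) = numAt b z + k by omega,
      List.append_assoc, h1, cutAt_append_of_lt _ _ _ _ hk, hcc]
    simp only
    rw [hyy, cutAt_append_of_lt _ _ _ _ hk]
  obtain ⟨W, hW⟩ : phiWord (-(p : ℤ)) (L ++ cc 0) <+: invRev z := by
    rw [cut 0 (by omega), List.append_assoc,
      cutAt_append_of_lt _ _ _ _ (by rw [numAt_invRev]; omega)]
    exact cutAt_prefix _ _ _
  set Y : ℕ → FreeGroup (Fin m) := fun k => FreeGroup.mk (cc k) with hY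
  have hrel : ∀ k < l, ψ (FreeGroup.mk L * Y (d + k)) = (FreeGroup.mk z)⁻¹ * Y k := by
    intro k hk
    rw [← mk_append, ← mk_phiWord, hrelw k hk, mk_append, mk_invRev]
  have hshift : ∀ k k', k < l → k' < l →
      (phi m ^ (p : ℤ)) ((Y k)⁻¹ * Y k') = (Y (d + k))⁻¹ * Y (d + k') := by
    intro k k' hk hk'
    have e : ∀ k < l, Y k = FreeGroup.mk z * ψ (FreeGroup.mk L * Y (d + k)) := by
      intro k hk; rw [hrel k hk]; group
    rw [e k hk, e k' hk', show (FreeGroup.mk z * ψ (FreeGroup.mk L * Y (d + k)))⁻¹ *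
      (FreeGroup.mk z * ψ (FreeGroup.mk L * Y (d + k'))) = ψ ((Y (d + k))⁻¹ * Y (d + k')) by
        rw [_root_.map_mul, _root_.map_mul, _root_.map_mul, _root_.map_inv]; group, hψ,
      phi_zpow_apply_neg]
  -- `q` is the number of periods that take the cut `0` of `y` beyond the part `y'`.
  obtain ⟨q, hq1, hq2⟩ := exists_mul_between l hd0
  obtain ⟨P, hP⟩ := hccp (q * d)
  have hPinf : P <:+: phiWord (-(p : ℤ)) R := by
    have h1 : cc (q * d) = y' ++ cutAt b (q * d - l) y'' := by
      simp only [hcc]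
      rw [hyy]
      have := cutAt_append b y' y'' (q * d - l)
      rwa [← hl, show l + (q * d - l) = q * d by omega] at this
    rw [h1, hyy, List.append_assoc, List.append_cancel_left_eq] at hP
    have h2 : P <:+: y'' := ⟨cutAt b (q * d - l) y'', [], by rw [List.append_nil, hP]⟩
    exact h2.trans hy''
  have hyred : IsReduced y := hr.infix ⟨L, R, rfl⟩
  have hS : IsS C i p u₀ u₁ (cc 0) := by
    obtain ⟨r, hr0⟩ := hccp 0
    refine Or.inr (Or.inl ⟨L ++ cc 0, hLy.infix ⟨[], r, by rw [← hr0]; simp⟩, ⟨L, [], by simp⟩, ?_⟩)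
    rw [D.left_eq, invRev_append, ← hW]
    exact ⟨[], W ++ invRev L, by simp⟩
  have hPP : IsP C i p v₀ v₁ P :=
    Or.inr (Or.inl ⟨R, hr.right_of_append, hPinf, D.right_infix⟩)
  have hS0 : IsReduced (cc 0) := hyred.infix (hccp 0).isInfix
  -- without a full period nothing has to be inserted
  have easy : cc (q * d) = cc 0 →
      ∃ X, TwistedEq p u₀ u₁ v₀ v₁ X ∧ FormX3 C i p u₀ u₁ v₀ v₁ X := by
    intro h0
    rw [h0] at hP
    refine ⟨L ++ y ++ R, D.twistedEq_self, L, cc 0, [], P, R, D.left_infix, hS,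
      isM_nil hC p u₀ u₁ v₀ v₁ hS0 P, hPP, D.right_infix, by rw [← hP]; simp⟩
  rcases Nat.eq_zero_or_pos q with hq0 | hq0
  · exact easy (by rw [hq0, zero_mul])
  have hl0 : 0 < l := by
    have : d ≤ q * d := Nat.le_mul_of_pos_left _ hq0
    omega
  obtain ⟨w, hw⟩ : cc 0 <+: cc d := cutAt_mono b y 0 d (Nat.zero_le _)
  have hwr : IsReduced w := by
    obtain ⟨r, hr0⟩ := hccp d
    exact hyred.infix ⟨cc 0, r, by rw [hw, hr0]⟩
  have hwY : FreeGroup.mk w = (Y 0)⁻¹ * Y d := by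
    simp only [hY]; rw [← hw, mk_append]; group
  have hpow : ∀ n < q, (phi m ^ ((p : ℤ) * n)) (FreeGroup.mk w)
      = (Y (n * d))⁻¹ * Y ((n + 1) * d) := by
    intro n
    induction n with
    | zero => intro _; simp [hwY]
    | succ n ih =>
      intro hn
      have h1 : (n + 2) * d ≤ q * d := Nat.mul_le_mul_right d (by omega)
      have h2 : (n + 2) * d = (n + 1) * d + d := by ring
      have h3 : (n + 1) * d = n * d + d := by ring
      rw [show (p : ℤ) * ((n + 1 : ℕ) : ℤ) = p + p * n by push_cast; ring, phi_zpow_add,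
        ih (by omega), hshift _ _ (by omega) (by omega), add_comm d, add_comm d, ← h3, ← h2]
  have hblock : ∀ n ≤ q, cc (n * d) = cc 0 ++ periodicBlock p n w := by
    intro n
    induction n with
    | zero => intro _; simp [periodicBlock_zero]
    | succ n ih =>
      intro hn
      obtain ⟨e, he⟩ : cc (n * d) <+: cc ((n + 1) * d) := cutAt_mono b y _ _ (by
        rw [add_mul, one_mul]; omega)
      have her : IsReduced e := by
        obtain ⟨r, hr0⟩ := hccp ((n + 1) * d)
        exact hyred.infix ⟨cc (n * d), r, by rw [he, hr0]⟩
      have h1 : phiWord ((p : ℤ) * n) w = e := by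
        rw [phiWord_of_mul, hpow n (by omega)]
        simp only [hY]
        rw [← he, mk_append, inv_mul_cancel_left, toWord_mk_of_isReduced her]
      rw [periodicBlock_succ, ← he, ih (by omega), h1, List.append_assoc]
  have hψw : ψ (FreeGroup.mk w) = FreeGroup.mk (W ++ cc 0) := by
    have h1 := hrel 0 hl0
    have h2 : FreeGroup.mk w = (FreeGroup.mk L * Y 0)⁻¹ * (FreeGroup.mk L * Y (d + 0)) := by
      rw [hwY, add_zero]; group
    have h3 : (FreeGroup.mk z)⁻¹ = ψ (FreeGroup.mk L * Y 0) * FreeGroup.mk W := by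
      rw [← mk_invRev, ← hW, mk_append, mk_phiWord, mk_append]
    rw [h2, _root_.map_mul, _root_.map_inv, h1, h3, mk_append]
    simp only [hY]
    group
  have hWr : IsReduced (W ++ cc 0) := by
    obtain ⟨r, hr0⟩ := hccp 0
    refine hir.infix ⟨phiWord (-(p : ℤ)) (L ++ cc 0), r ++ ζ, ?_⟩
    rw [← hW, ← hr0]; simp
  have hψww : phiWord (-(p : ℤ)) w = W ++ cc 0 := by
    rw [phiWord_of_mul, ← hψ, hψw, toWord_mk_of_isReduced hWr]
  by_cases hfix : phi m (FreeGroup.mk w) = FreeGroup.mk w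
  · -- all periods are equal, and one solution has none of them
    have hfixk : ∀ k : ℤ, (phi m ^ k) (FreeGroup.mk w) = FreeGroup.mk w := by
      have hinv : (phi m ^ (-1 : ℤ)) (FreeGroup.mk w) = FreeGroup.mk w := by
        conv_lhs => rw [← hfix]
        have := phi_zpow_neg_apply 1 (FreeGroup.mk w)
        rwa [zpow_one] at this
      intro k
      induction k with
      | zero => simp
      | succ k ih => rw [phi_zpow_add, zpow_one, hfix, ih]
      | pred k ih => rw [sub_eq_add_neg, phi_zpow_add, hinv, ih]
    have hmkblock : ∀ n, FreeGroup.mk (periodicBlock p n w) = FreeGroup.mk w ^ n := by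
      intro n
      induction n with
      | zero => simp [periodicBlock_zero, ← one_eq_mk]
      | succ n ih =>
        rw [periodicBlock_succ, mk_append, ih, pow_succ, mk_phiWord, hfixk]
    refine ⟨L ++ (cc 0 ++ P) ++ R, D.twistedEq ?_, L, cc 0, [], P, R, D.left_infix, hS,
      isM_nil hC p u₀ u₁ v₀ v₁ hS0 P, hPP, D.right_infix, by simp⟩
    have h1 : y = cc 0 ++ (periodicBlock p q w ++ P) := by
      rw [← List.append_assoc, ← hblock q le_rfl, hP]
    have h2 := mk_phiWord (-(p : ℤ)) (L ++ y ++ R)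
    rw [D.image_eq, ← hψ, h1] at h2
    have h3 : FreeGroup.mk W = FreeGroup.mk w * (FreeGroup.mk (cc 0))⁻¹ := by
      rw [hψ, hfixk, mk_append] at hψw
      rw [hψw]; group
    have h4 : ψ (FreeGroup.mk L * FreeGroup.mk (cc 0)) = (FreeGroup.mk z)⁻¹ * FreeGroup.mk (cc 0) *
        (FreeGroup.mk w)⁻¹ := by
      have h5 : (FreeGroup.mk z)⁻¹ = ψ (FreeGroup.mk L * Y 0) * FreeGroup.mk W := by
        rw [← mk_invRev, ← hW, mk_append, mk_phiWord, mk_append]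
      rw [h5, h3]; simp only [hY]; group
    have h6 : ψ (FreeGroup.mk w) = FreeGroup.mk w := hfixk _
    obtain ⟨q, rfl⟩ : ∃ q', q = q' + 1 := ⟨q - 1, by omega⟩
    simp only [mk_append, mk_invRev, hmkblock] at h2
    have h7 : ψ (FreeGroup.mk P * FreeGroup.mk R) = FreeGroup.mk w * FreeGroup.mk P *
        FreeGroup.mk ζ := by
      have h8 : FreeGroup.mk L * (FreeGroup.mk (cc 0) * (FreeGroup.mk w ^ (q + 1) *
          FreeGroup.mk P)) * FreeGroup.mk R = (FreeGroup.mk L * FreeGroup.mk (cc 0)) *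
          FreeGroup.mk w ^ (q + 1) * (FreeGroup.mk P * FreeGroup.mk R) := by group
      rw [h8, _root_.map_mul, _root_.map_mul, _root_.map_pow, h4, h6] at h2
      have h9 := eq_inv_mul_of_mul_eq h2.symm
      rw [h9, pow_succ']
      group
    rw [show L ++ (cc 0 ++ P) ++ R = (L ++ cc 0) ++ (P ++ R) by simp, mk_append, mk_append,
      mk_append, _root_.map_mul, h4, h7]
    simp only [mk_append, mk_invRev]
    group
  · refine ⟨L ++ y ++ R, D.twistedEq_self, L, cc 0, periodicBlock p q w, P, R, D.left_infix, hS,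
      ⟨q, w, [], hwr, IsReduced.nil, hCq q ?_, Or.inl ⟨by simp, ⟨W, ?_, hψww⟩, Or.inl ?_⟩⟩, hPP,
      D.right_infix, by rw [← hP, hblock q le_rfl]; simp⟩
    · -- the number of periods is bounded by the growth of the powers of `a_1`
      have hUz : PowerBound NU (invRev z) := (hU.of_infix ⟨L, [], by simp⟩).invRev
      have hRV : PowerBound NV R := by
        have := (hV.of_infix ⟨[], ζ, by simp⟩ : PowerBound NV (invRev R)).invRev
        rwa [invRev_invRev] at this
      have bR : PowerBound (NV + 2 * m * p) (phiWord (-(p : ℤ)) R) := by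
        refine hLip _ _ _ ?_ (by omega)
        rwa [toWord_mk_of_isReduced hr.right_of_append]
      have by'' : PowerBound (NV + 2 * m * p) y'' := bR.of_infix hy''
      have bψw : PowerBound (2 * NU + 2 * m * p) (ψ (FreeGroup.mk w)).toWord := by
        rw [hψw, toWord_mk_of_isReduced hWr]
        have b1 : PowerBound NU W := hUz.of_infix ⟨phiWord (-(p : ℤ)) (L ++ cc 0), [], by
          rw [← hW]; simp⟩
        have b2 : PowerBound NU (phiWord (-(p : ℤ)) (L ++ cc 0)) := hUz.of_infix ⟨[], W, by
          rw [← hW]; simp⟩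
        have b3 := hLip (p : ℤ) (FreeGroup.mk (phiWord (-(p : ℤ)) (L ++ cc 0))) NU
          (by rwa [toWord_mk_of_isReduced (isReduced_phiWord _ _)]) (by omega)
        obtain ⟨r, hr0⟩ := hccp 0
        rw [mk_phiWord, phi_zpow_apply_neg, toWord_mk_of_isReduced
          (hLy.infix ⟨[], r, by rw [← hr0]; simp⟩)] at b3
        exact (b1.append (b3.of_infix ⟨L, [], by simp⟩)).mono (by omega)
      -- the last period, up to one application of `φ^p`
      have bend : PowerBound (3 * NV + 10 * m * p)
          ((phi m ^ ((p : ℤ) * q)) (FreeGroup.mk w)).toWord := by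
        obtain ⟨ρ, hρ⟩ : cc (l - 1) <+: y' := by
          simp only [hcc]
          rw [hyy, cutAt_append_of_lt _ _ _ _ (by omega)]
          exact cutAt_prefix _ _ _
        have hy''1 : ∀ j, l ≤ j → ∃ r, cc j = y' ++ r ∧ r <+: y'' := by
          intro j hj
          refine ⟨cutAt b (j - l) y'', ?_, cutAt_prefix _ _ _⟩
          simp only [hcc]
          rw [hyy]
          have := cutAt_append b y' y'' (j - l)
          rwa [← hl, show l + (j - l) = j by omega] at this
        obtain ⟨s₁, hs₁, t₁, ht₁⟩ := hy''1 (d + (l - 1)) (by omega)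
        have hyd'' : IsReduced y'' := hyred.infix ⟨y', [], by rw [hyy]; simp⟩
        have bt : PowerBound (NV + 2 * m * p) t₁ := by''.of_infix ⟨s₁, [], by rw [ht₁]; simp⟩
        have bρ : PowerBound (NV + 4 * m * p) ρ := by
          have e1 : ψ (FreeGroup.mk t₁) = FreeGroup.mk (ρ ++ c) := by
            have h1 := hrel (l - 1) (by omega)
            have h2 : FreeGroup.mk t₁ = (FreeGroup.mk L * Y (d + (l - 1)))⁻¹ *
                FreeGroup.mk (L ++ y) := by
              simp only [hY]
              rw [hs₁, hyy, ← ht₁]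
              simp only [mk_append]
              group
            have h3 : ψ (FreeGroup.mk (L ++ y)) = FreeGroup.mk (invRev z ++ y' ++ c) := by
              rw [← hα, mk_phiWord]
            rw [h2, _root_.map_mul, _root_.map_inv, h1, h3, ← hρ]
            simp only [mk_append, mk_invRev, hY]
            group
          have hρc : IsReduced (ρ ++ c) := by
            have := isReduced_phiWord (-(p : ℤ)) (L ++ y)
            rw [hα, ← hρ] at this
            exact this.infix ⟨invRev z ++ cc (l - 1), [], by simp⟩
          have b1 := hLip (-(p : ℤ)) (FreeGroup.mk t₁) _ (by
            rwa [toWord_mk_of_isReduced (hyd''.infix ⟨s₁, [], by rw [ht₁]; simp⟩)]) (by omega)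
          rw [← hψ, e1, toWord_mk_of_isReduced hρc] at b1
          exact (b1.mono (by
            have : 4 * m * p = 2 * m * p + 2 * m * p := by ring
            omega)).of_infix ⟨[], c, by simp⟩
        obtain ⟨q', rfl⟩ : ∃ q', q = q' + 1 := ⟨q - 1, by omega⟩
        have hq' : (q' + 1) * d = q' * d + d := by ring
        obtain ⟨s₂, hs₂, hs₂'⟩ := hy''1 ((q' + 1) * d) hq1
        obtain ⟨s₃, hs₃, hs₃'⟩ := hy''1 (d + q' * d) (by omega)
        have hst : s₃ <+: s₁ := by
          have h1 : cc (d + q' * d) <+: cc (d + (l - 1)) := cutAt_mono b y _ _ (by omega)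
          rwa [hs₃, hs₁, List.prefix_append_right_inj] at h1
        obtain ⟨r, hr0⟩ := hst
        have e1 : (phi m ^ ((p : ℤ) * ((q' + 1 : ℕ) : ℤ))) (FreeGroup.mk w)
            = FreeGroup.mk r * (phi m ^ (p : ℤ)) (FreeGroup.mk (ρ ++ s₂)) := by
          rw [show (p : ℤ) * ((q' + 1 : ℕ) : ℤ) = p + p * q' by push_cast; ring, phi_zpow_add,
            hpow q' (by omega)]
          have h1 : (Y (q' * d))⁻¹ * Y ((q' + 1) * d) = ((Y (q' * d))⁻¹ * Y (l - 1)) *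
              FreeGroup.mk (ρ ++ s₂) := by
            have h2 : Y ((q' + 1) * d) = Y (l - 1) * FreeGroup.mk (ρ ++ s₂) := by
              simp only [hY]
              rw [hs₂, ← hρ]
              simp only [mk_append]
              group
            rw [h2]; group
          have h3 : (Y (d + q' * d))⁻¹ * Y (d + (l - 1)) = FreeGroup.mk r := by
            simp only [hY]
            rw [hs₃, hs₁, ← hr0]
            simp only [mk_append]
            group
          rw [h1, _root_.map_mul, hshift _ _ (by omega) (by omega), h3]
        have hrr : PowerBound (NV + 2 * m * p) r := by
          refine by''.of_infix (List.IsInfix.trans ⟨s₃, t₁, ?_⟩ List.infix_rfl)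
          rw [hr0, ht₁]
        have hrred : IsReduced r := hyd''.infix ⟨s₃, t₁, by rw [hr0, ht₁]⟩
        have hρs : IsReduced (ρ ++ s₂) := by
          obtain ⟨x, hx⟩ := hs₂'
          refine hyred.infix ⟨cc (l - 1), x, ?_⟩
          rw [hyy, ← hρ, ← hx]; simp
        have b5 := (bρ.append (by''.of_infix hs₂'.isInfix))
        have b6 := hLip (p : ℤ) (FreeGroup.mk (ρ ++ s₂)) _
          (by rwa [toWord_mk_of_isReduced hρs]) (by omega)
        have b7 : PowerBound (NV + 2 * m * p) (FreeGroup.mk r).toWord := by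
          rwa [toWord_mk_of_isReduced hrred]
        rw [e1]
        refine (b7.mul b6).mono ?_
        have e1 : 10 * m * p = 5 * (2 * m * p) := by ring
        have e2 : 4 * m * p = 2 * (2 * m * p) := by ring
        omega
      have hne : phi m (ψ (FreeGroup.mk w)) ≠ ψ (FreeGroup.mk w) := by
        intro h
        apply hfix
        have h1 : ψ (phi m (FreeGroup.mk w)) = ψ (FreeGroup.mk w) := by
          rw [← h]
          have e1 := phi_zpow_add (-(p : ℤ)) 1 (FreeGroup.mk w)
          have e2 := phi_zpow_add 1 (-(p : ℤ)) (FreeGroup.mk w)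
          rw [zpow_one] at e1 e2
          rw [hψ, ← e1, ← e2, add_comm]
        exact ψ.injective h1
      have hgr := growth (B := 2 * NU + 3 * NV + 10 * m * p) (n := (q + 1) * p) le_rfl
        (ψ (FreeGroup.mk w)) (mem_level_self _) hne (bψw.mono (by
          have e1 : 10 * m * p = 5 * (2 * m * p) := by ring
          omega)) (by
          rw [hψ, ← phi_zpow_add, show (((q + 1) * p : ℕ) : ℤ) + -(p : ℤ) = p * q by
            push_cast; ring]
          exact bend.mono (by omega))
      have e1 : 20 * m * p = 2 * (10 * m * p) := by ring
      have e2 : (q + 1) * p = q * p + p := by ring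
      omega
    · rw [D.left_eq, invRev_append, ← hW]
      exact ⟨phiWord (-(p : ℤ)) (L ++ cc 0), invRev L, by simp⟩
    · rw [phiWord_nil]; exact List.nil_infix

/-- The case in which `z` contains at least as many letters of the top index of `y` as `L`. If
`φ^{-p}(L y)` ends inside `z⁻¹`, then `y` lies in `φ^{-p}(R)`; if the numbers agree, then a cut of `y` is
respected by `φ^{-p}`; otherwise `y` is periodic. -/
theorem CancelData.formX3_of_numAt_le (D : CancelData p u₀ u₁ v₀ v₁ L y R z ζ) (hp : 0 < p)
    {C : ℝ} (hC : 0 ≤ C) {i : ℕ} (b : Fin m) (hi : b.val + 1 ≤ i)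
    (hL : LettersBelow (b.val + 1) L) (hy : LettersBelow (b.val + 1) y) (hyb : 0 < numAt b y)
    (hd : numAt b L ≤ numAt b z) {NU NV MU MV : ℕ}
    (hU : PowerBound NU (L ++ z)) (hV : PowerBound NV (invRev R ++ ζ))
    (hU' : PowerBound MU (L ++ z)) (hV' : PowerBound MV (invRev R ++ ζ))
    (hCU : ((4 * NU + 10 * m * p : ℕ) : ℝ) ≤ C * ((lenF u₀ : ℝ) + lenF u₁ + p))
    (hCV : ((4 * NV + 10 * m * p : ℕ) : ℝ) ≤ C * ((lenF v₀ : ℝ) + lenF v₁ + p))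
    (hCq : ∀ q : ℕ, q * p ≤ 4 * MU + 6 * MV + 20 * m * p + 2 * m + 2 →
      (q : ℝ) * p ≤ C * ((lenH u₀ : ℝ) + lenH u₁ + lenH v₀ + lenH v₁ + p)) :
    ∃ X, TwistedEq p u₀ u₁ v₀ v₁ X ∧ FormX3 C i p u₀ u₁ v₀ v₁ X := by
  obtain ⟨α, c, β, h1, h2, h3⟩ := exists_cancel ((phi m ^ (-(p : ℤ))) (FreeGroup.mk (L ++ y)))
    ((phi m ^ (-(p : ℤ))) (FreeGroup.mk R))
  rw [← _root_.map_mul, ← mk_append, ← phiWord_of_mul, D.image_eq] at h3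
  rw [← phiWord_of_mul] at h1 h2
  rw [List.append_assoc, List.append_eq_append_iff] at h3
  rcases h3 with ⟨y₀, rfl, h3⟩ | ⟨a, -, h3⟩
  swap
  · refine ⟨_, D.twistedEq_self, D.formX3_of_infix hC i ?_⟩
    rw [h2, h3]
    exact ⟨invRev c ++ a, ζ, by simp⟩
  obtain ⟨c', y', y'', hα, hyy, hy''⟩ : ∃ c' y' y'', phiWord (-(p : ℤ)) (L ++ y) =
      invRev z ++ y' ++ c' ∧ y = y' ++ y'' ∧ y'' <:+: phiWord (-(p : ℤ)) R := by
    rw [List.append_eq_append_iff] at h3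
    rcases h3 with ⟨a, rfl, -⟩ | ⟨a, rfl, rfl⟩
    · exact ⟨a ++ c, y, [], by rw [h1]; simp, by simp, List.nil_infix⟩
    · exact ⟨c, y₀, a, by rw [h1], rfl, by rw [h2]; exact ⟨invRev c, ζ, by simp⟩⟩
  rcases hd.eq_or_lt with hd | hd
  · have hz : LettersBelow (b.val + 1) (invRev z) := by
      have h4 : LettersBelow (b.val + 1) (phiWord (-(p : ℤ)) (L ++ y)) :=
        phi_zpow_mem_level _ (mk_mem_level (hL.append hy))
      rw [hα] at h4
      exact h4.subset (by simp)
    have h5 := phiWord_cutAt_eq b p D.isReduced hL hy hz (by rw [numAt_invRev, hd]) hyb D.image_eq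
    obtain ⟨r, hr⟩ := cutAt_prefix b y (numAt b y - 1)
    rw [← hr] at D hy
    exact D.formX3_of_matched (by have := b.isLt; omega) hp hC b.isLt (by omega) hi hy h5 hU hV hCU hCV
  · exact D.formX3_of_periodic hp hC i b hL hy hα hyy hy'' hd hU' hV' hCq

/-! ### Inversion of the equation -/

theorem infix_invRev {u v : Word m} (h : u <:+: v) : invRev u <:+: invRev v := by
  obtain ⟨s, t, rfl⟩ := h
  exact ⟨invRev t, invRev s, by simp [invRev_append]⟩

theorem prefix_invRev {u v : Word m} (h : u <:+ v) : invRev u <+: invRev v := by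
  obtain ⟨s, rfl⟩ := h
  exact ⟨invRev s, by simp [invRev_append]⟩

/-- Inverting the equation exchanges `u₀`, `u₁` with `v₀`, `v₁`. -/
theorem CancelData.invRev (D : CancelData p u₀ u₁ v₀ v₁ L y R z ζ) :
    CancelData p v₀ v₁ u₀ u₁ (invRev R) (invRev y) (invRev L) ζ z where
  left_eq := D.right_eq
  right_eq := by rw [invRev_invRev, D.left_eq]
  isReduced := by
    have := isReduced_invRev D.isReduced
    rwa [invRev_append, invRev_append, ← List.append_assoc] at this
  image_eq := by
    have := congrArg FreeGroup.invRev D.image_eq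
    rw [← phiWord_invRev] at this
    simpa [invRev_append, invRev_invRev] using this
  left_infix := by
    have := infix_invRev D.right_infix
    rwa [phiWord_invRev, invRev_invRev] at this
  right_infix := by
    rw [phiWord_invRev]; exact infix_invRev D.left_infix

theorem TwistedEq.invRev {X : Word m} (h : TwistedEq p v₀ v₁ u₀ u₁ X) :
    TwistedEq p u₀ u₁ v₀ v₁ (FreeGroup.invRev X) := by
  have := congrArg (·⁻¹) h
  simp only [← _root_.map_inv, ← mk_invRev, invRev_append, invRev_invRev] at this
  rw [TwistedEq, List.append_assoc, List.append_assoc]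
  exact this

theorem invRev_flatMap (T : ℕ → Word m) (l : List ℕ) :
    invRev (l.flatMap T) = l.reverse.flatMap fun j => invRev (T j) := by
  induction l with
  | nil => rfl
  | cons a l ih => simp [invRev_append, ih]

theorem SuffixChunk.invRev {i : ℕ} {B : ℝ} {S : Word m} (h : SuffixChunk i p B S) :
    PrefixChunk i p B (FreeGroup.invRev S) := by
  obtain ⟨S₁, T, ⟨t, k, h1, h2, h3⟩, h4, rfl⟩ := h
  refine ⟨FreeGroup.invRev S₁, fun j => FreeGroup.invRev (T j), ⟨t, k, h1, h2, h3⟩, ?_, ?_⟩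
  · intro j hj1 hj2
    have := infix_invRev (h4 j hj1 hj2)
    rwa [← phiWord_invRev] at this
  · rw [invRev_append, invRev_flatMap, List.reverse_reverse]

theorem PrefixChunk.invRev {i : ℕ} {B : ℝ} {P : Word m} (h : PrefixChunk i p B P) :
    SuffixChunk i p B (FreeGroup.invRev P) := by
  obtain ⟨P₁, T, ⟨t, k, h1, h2, h3⟩, h4, rfl⟩ := h
  refine ⟨FreeGroup.invRev P₁, fun j => FreeGroup.invRev (T j),
    ⟨t, k, h1, h2, by rwa [invRev_invRev]⟩, ?_, ?_⟩
  · intro j hj1 hj2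
    have := infix_invRev (h4 j hj1 hj2)
    rwa [← phiWord_invRev] at this
  · rw [invRev_append, invRev_flatMap]

theorem IsS.invRev {C : ℝ} {i : ℕ} {S : Word m} (h : IsS C i p u₀ u₁ S) :
    IsP C i p u₀ u₁ (FreeGroup.invRev S) := by
  rcases h with h | ⟨S', h1, h2, h3⟩ | ⟨S', h1, h2, h3⟩
  · exact Or.inl h.invRev
  · refine Or.inr (Or.inr ⟨FreeGroup.invRev S', isReduced_invRev h1, infix_invRev h2, ?_⟩)
    have := infix_invRev h3
    rwa [invRev_invRev, ← phiWord_invRev] at this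
  · refine Or.inr (Or.inl ⟨FreeGroup.invRev S', isReduced_invRev h1, ?_, ?_⟩)
    · rw [phiWord_invRev]; exact infix_invRev h2
    · rw [phiWord_invRev]; exact infix_invRev h3

theorem IsP.invRev {C : ℝ} {i : ℕ} {P : Word m} (h : IsP C i p v₀ v₁ P) :
    IsS C i p v₀ v₁ (FreeGroup.invRev P) := by
  rcases h with h | ⟨P', h1, h2, h3⟩ | ⟨P', h1, h2, h3⟩
  · exact Or.inl h.invRev
  · refine Or.inr (Or.inr ⟨FreeGroup.invRev P', isReduced_invRev h1, ?_, ?_⟩)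
    · rw [phiWord_invRev]; exact infix_invRev h2
    · have := infix_invRev h3
      rwa [phiWord_invRev, invRev_invRev] at this
  · refine Or.inr (Or.inl ⟨FreeGroup.invRev P', isReduced_invRev h1, infix_invRev h2, ?_⟩)
    rw [phiWord_invRev]; exact infix_invRev h3

theorem IsM.invRev {C : ℝ} {S P M : Word m} (h : IsM C p v₀ v₁ u₀ u₁ S P M) :
    IsM C p u₀ u₁ v₀ v₁ (FreeGroup.invRev P) (FreeGroup.invRev S) (FreeGroup.invRev M) := by
  obtain ⟨q, w, M₂, h1, h2, h3, h4⟩ := h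
  have swap : ∀ N : Word m, (phiWord (p : ℤ) N <:+: phiWord (-(p : ℤ)) v₀ ∨
      phiWord (p : ℤ) N <:+: phiWord (-(p : ℤ)) (FreeGroup.invRev u₀)) →
      (phiWord (p : ℤ) (FreeGroup.invRev N) <:+: phiWord (-(p : ℤ)) u₀ ∨
      phiWord (p : ℤ) (FreeGroup.invRev N) <:+: phiWord (-(p : ℤ)) (FreeGroup.invRev v₀)) := by
    rintro N (h | h)
    · right
      rw [phiWord_invRev, phiWord_invRev]; exact infix_invRev h
    · left
      have := infix_invRev h
      rwa [phiWord_invRev, invRev_invRev, ← phiWord_invRev] at this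
  refine ⟨q, w, M₂, h1, h2, by linarith, ?_⟩
  rcases h4 with ⟨rfl, ⟨W, hW1, hW2⟩, h5⟩ | ⟨rfl, ⟨W, hW1, hW2⟩, h5⟩
  · exact Or.inr ⟨by rw [invRev_append], ⟨W, hW1, by rwa [invRev_invRev]⟩, swap _ h5⟩
  · refine Or.inl ⟨by rw [invRev_append, invRev_invRev, invRev_invRev], ⟨W, hW1, hW2⟩, ?_⟩
    have := swap _ h5
    rwa [invRev_invRev] at this

theorem FormX3.invRev {C : ℝ} {i : ℕ} {X : Word m} (h : FormX3 C i p v₀ v₁ u₀ u₁ X) :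
    FormX3 C i p u₀ u₁ v₀ v₁ (FreeGroup.invRev X) := by
  obtain ⟨L, S, M, P, R, h1, h2, h3, h4, h5, rfl⟩ := h
  refine ⟨FreeGroup.invRev R, FreeGroup.invRev P, FreeGroup.invRev M, FreeGroup.invRev S,
    FreeGroup.invRev L, ?_, h4.invRev, h3.invRev, h2.invRev, ?_, by simp [invRev_append]⟩
  · have := infix_invRev h5
    rwa [phiWord_invRev, invRev_invRev] at this
  · rw [phiWord_invRev]; exact infix_invRev h1

/-! ### Existence of the cancellation data -/

/-- If `u₁⁻¹ x` is reduced and `x` shares its first letter with `u₁ φ^{-p}(u₀)`, then `u₁` is absorbed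
completely by `φ^{-p}(u₀)`. -/
theorem twistWord_infix {x : Word m} (hu₁ : IsReduced u₁) (hr : IsReduced (invRev u₁ ++ x))
    (hL : L ≠ []) (h1 : L <+: twistWord p u₁ u₀) (h2 : L <+: x) :
    twistWord p u₁ u₀ <:+: phiWord (-(p : ℤ)) u₀ := by
  obtain ⟨u, c, v, hu, hv, huv⟩ := exists_cancel (FreeGroup.mk u₁)
    ((phi m ^ (-(p : ℤ))) (FreeGroup.mk u₀))
  rw [toWord_mk_of_isReduced hu₁] at hu
  rw [← phiWord_of_mul] at hv
  rw [← mk_twistWord, toWord_mk_of_isReduced (isReduced_twistWord _ _ _)] at huv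
  rw [huv] at h1 ⊢
  cases u with
  | nil => exact ⟨invRev c, [], by rw [hv]; simp⟩
  | cons l u =>
    exfalso
    cases L with
    | nil => exact hL rfl
    | cons l' L =>
      obtain ⟨s, hs⟩ := h1
      obtain ⟨t, rfl⟩ := h2
      simp only [List.cons_append, List.cons.injEq] at hs
      rw [hu, hs.1, List.cons_append, invRev_cons] at hr
      have : IsReduced ([(l.1, !l.2), l] : Word m) :=
        hr.infix ⟨invRev (u ++ c), L ++ t, by simp [FreeGroup.invRev]⟩
      simp at this

/-- The words `L` and `R` are what cancels in `(U⁻¹ x) V`, with `U = u₁ φ^{-p}(u₀)` and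
`V = v₁ φ^{-p}(v₀)`. If the two cancellations overlap in `x`, the middle part `y` is empty. -/
theorem exists_cancelData {x : Word m} (hu₁ : IsReduced u₁) (hv₁ : IsReduced v₁) (hx : IsReduced x)
    (hr : IsReduced (invRev u₁ ++ x ++ v₁)) (h : TwistedEq p u₀ u₁ v₀ v₁ x) :
    ∃ L y R, x = L ++ y ++ R ∧ L <:+: phiWord (-(p : ℤ)) u₀ ∧
      R <:+: phiWord (-(p : ℤ)) (invRev v₀) ∧
      (y = [] ∨ ∃ z ζ, CancelData p u₀ u₁ v₀ v₁ L y R z ζ ∧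
        (L = [] ∨ twistWord p u₁ u₀ <:+: phiWord (-(p : ℤ)) u₀) ∧
        (R = [] ∨ twistWord p v₁ v₀ <:+: phiWord (-(p : ℤ)) v₀)) := by
  set U := twistWord p u₁ u₀ with hU
  set V := twistWord p v₁ v₀ with hV
  have hUr : IsReduced U := isReduced_twistWord _ _ _
  have hVr : IsReduced V := isReduced_twistWord _ _ _
  have hLU : ∀ L : Word m, L <+: U → L <+: x → L = [] ∨ U <:+: phiWord (-(p : ℤ)) u₀ := by
    intro L h1 h2
    by_cases hL : L = []
    · exact Or.inl hL
    · exact Or.inr (twistWord_infix hu₁ hr.left_of_append hL h1 h2)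
  have hRV : ∀ R : Word m, invRev R <+: V → R <:+ x →
      R = [] ∨ V <:+: phiWord (-(p : ℤ)) v₀ := by
    intro R h1 h2
    by_cases hR : R = []
    · exact Or.inl hR
    · refine Or.inr (twistWord_infix (x := invRev x) hv₁ ?_ (L := invRev R) ?_ h1
        (prefix_invRev h2))
      · have := isReduced_invRev (w := x ++ v₁) (hr.infix ⟨invRev u₁, [], by simp⟩)
        rwa [invRev_append] at this
      · intro h3
        apply hR
        rw [← invRev_invRev (L₁ := R), h3]; rfl
  have infL : ∀ L : Word m, L <+: U → L <+: x → L <:+: phiWord (-(p : ℤ)) u₀ := by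
    intro L h1 h2
    rcases hLU L h1 h2 with rfl | h3
    · exact List.nil_infix
    · exact h1.isInfix.trans h3
  have infR : ∀ R : Word m, invRev R <+: V → R <:+ x →
      R <:+: phiWord (-(p : ℤ)) (invRev v₀) := by
    intro R h1 h2
    rcases hRV R h1 h2 with rfl | h3
    · exact List.nil_infix
    · have := infix_invRev (h1.isInfix.trans h3)
      rwa [invRev_invRev, ← phiWord_invRev] at this
  rw [twistedEq_iff, ← hU, ← hV] at h
  have hψ : (phi m ^ (-(p : ℤ))) (FreeGroup.mk x) =
      ((FreeGroup.mk U)⁻¹ * FreeGroup.mk x) * FreeGroup.mk V := by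
    have h0 := congrArg (fun g => (FreeGroup.mk U)⁻¹ * g * FreeGroup.mk V) h
    simp only [mul_assoc, inv_mul_cancel, inv_mul_cancel_left, mul_one] at h0
    rw [mul_assoc, h0]
  obtain ⟨z', L', x', h1, h2, h3⟩ := exists_cancel (FreeGroup.mk U)⁻¹ (FreeGroup.mk x)
  obtain ⟨T, c, ζ, h4, h5, h6⟩ := exists_cancel ((FreeGroup.mk U)⁻¹ * FreeGroup.mk x)
    (FreeGroup.mk V)
  rw [toWord_mk_of_isReduced hVr] at h5
  rw [toWord_mk_of_isReduced hx] at h2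
  rw [toWord_inv, toWord_mk_of_isReduced hUr] at h1
  have hUL : U = invRev L' ++ invRev z' := by
    rw [← invRev_append, ← h1, invRev_invRev]
  rw [h3, List.append_eq_append_iff] at h4
  rcases h4 with ⟨y, rfl, rfl⟩ | ⟨c', rfl, rfl⟩
  · have hp1 : invRev L' <+: U := ⟨invRev z', hUL.symm⟩
    have hp2 : invRev L' <+: x := ⟨y ++ c, h2.symm⟩
    have hs1 : invRev c <+: V := ⟨ζ, h5.symm⟩
    have hs2 : c <:+ x := ⟨invRev L' ++ y, by rw [h2]; simp⟩
    refine ⟨invRev L', y, c, by rw [h2]; simp, infL _ hp1 hp2, infR _ hs1 hs2,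
      Or.inr ⟨invRev z', ζ, ⟨hUL, h5, ?_, ?_, infL _ hp1 hp2, infR _ hs1 hs2⟩, hLU _ hp1 hp2,
      hRV _ hs1 hs2⟩⟩
    · rw [List.append_assoc, ← h2]; exact hx
    · rw [List.append_assoc, ← h2, phiWord_of_mul, hψ, h6, invRev_invRev]
  · refine ⟨invRev L', [], x', by rw [h2]; simp, infL _ ⟨invRev (T ++ c'), hUL.symm⟩ ⟨x', h2.symm⟩,
      infR _ ⟨invRev c' ++ ζ, ?_⟩ ⟨invRev L', h2.symm⟩, Or.inl rfl⟩
    rw [h5, invRev_append, List.append_assoc]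

/-! ### Ranks and bounds -/

theorem rank_le_iff (n : ℕ) (w : Word m) : rank w ≤ n ↔ LettersBelow n w := by
  induction w with
  | nil => simp [rank, LettersBelow]
  | cons l w ih =>
    have : rank (l :: w) = max (l.1.val + 1) (rank w) := rfl
    rw [this, max_le_iff, ih]
    simp [LettersBelow]

theorem exists_top_letter : ∀ {w : Word m}, w ≠ [] →
    ∃ b : Fin m, LettersBelow (b.val + 1) w ∧ 0 < numAt b w := by
  intro w hw
  obtain ⟨l, hl, hmax⟩ := w.toFinset.exists_max_image (fun l => l.1.val)
    ((List.toFinset_nonempty_iff w).2 hw)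
  rw [List.mem_toFinset] at hl
  refine ⟨l.1, fun k hk => Nat.lt_succ_of_le (hmax k (List.mem_toFinset.2 hk)), ?_⟩
  obtain ⟨s, t, rfl⟩ := List.append_of_mem hl
  rw [numAt_append, numAt_cons_self rfl]
  omega

theorem powerBound_twistWord {N₀ N₁ : ℕ} (hu₀ : IsReduced u₀) (hu₁ : IsReduced u₁)
    (h₀ : PowerBound N₀ u₀) (h₁ : PowerBound N₁ u₁) :
    PowerBound (N₁ + (N₀ + 2 * m * p)) (twistWord p u₁ u₀) := by
  have h2 := PowerBound.phi_zpow (-(p : ℤ)) le_rfl (FreeGroup.mk u₀) (mem_level_self _) N₀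
    (by rwa [toWord_mk_of_isReduced hu₀])
  have h3 : PowerBound N₁ (FreeGroup.mk u₁).toWord := by rwa [toWord_mk_of_isReduced hu₁]
  have h4 := h3.mul h2
  rw [← mk_twistWord, toWord_mk_of_isReduced (isReduced_twistWord _ _ _), Int.natAbs_neg,
    Int.natAbs_natCast] at h4
  exact h4

theorem powerBound_lenF {w : Word m} (hw : IsReduced w) : PowerBound (lenF w) w :=
  PowerBound.of_length (by rw [lenF, FreeGroup.norm, toWord_mk_of_isReduced hw])

theorem lenF_bound (m p a b : ℕ) : ((4 * (b + (a + 2 * m * p)) + 10 * m * p : ℕ) : ℝ)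
    ≤ 50 * 3 ^ m * ((a : ℝ) + b + p) := by
  have h1 : m ≤ 3 ^ m := (Nat.lt_pow_self (by norm_num)).le
  have h2 : 1 ≤ 3 ^ m := Nat.one_le_pow _ _ (by norm_num)
  have h3 : 4 * (b + (a + 2 * m * p)) + 10 * m * p ≤ 50 * 3 ^ m * (a + b + p) := by
    have e1 := Nat.mul_le_mul_right p h1
    have e2 := Nat.mul_le_mul_right (a + b) h2
    calc 4 * (b + (a + 2 * m * p)) + 10 * m * p = 4 * (1 * (a + b)) + 18 * (m * p) := by ring
      _ ≤ 4 * (3 ^ m * (a + b)) + 18 * (3 ^ m * p) := by gcongr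
      _ ≤ 50 * (3 ^ m * (a + b)) + 50 * (3 ^ m * p) := by gcongr <;> norm_num
      _ = _ := by ring
  exact_mod_cast h3

theorem lenH_bound (hm : 1 ≤ m) (hp : 0 < p) (a b c d q : ℕ)
    (h : q * p ≤ 4 * (3 ^ m * b + (3 ^ m * a + 2 * m * p)) +
      6 * (3 ^ m * d + (3 ^ m * c + 2 * m * p)) + 20 * m * p + 2 * m + 2) :
    (q : ℝ) * p ≤ 50 * 3 ^ m * ((a : ℝ) + b + c + d + p) := by
  have h1 : m ≤ 3 ^ m := (Nat.lt_pow_self (by norm_num)).le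
  have h3 : q * p ≤ 50 * 3 ^ m * (a + b + c + d + p) := by
    have e1 := Nat.mul_le_mul_right p h1
    have e2 : 1 * 1 ≤ m * p := Nat.mul_le_mul hm hp
    have e3 : m * 1 ≤ m * p := Nat.mul_le_mul_left m hp
    calc q * p ≤ 4 * (3 ^ m * (a + b)) + 6 * (3 ^ m * (c + d)) + 44 * (m * p) := by
          refine h.trans ?_
          ring_nf at e2 e3 ⊢
          omega
      _ ≤ 50 * (3 ^ m * (a + b)) + 50 * (3 ^ m * (c + d)) + 50 * (3 ^ m * p) := by
          gcongr <;> norm_num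
      _ = _ := by ring
  exact_mod_cast h3

/-! ### The two cases -/

/-- The case of rank `1`: write `U⁻¹ = s t`, where `U = u₁ φ^{-p}(u₀)` and `s` is the maximal prefix of
rank at most `1`. All powers of `a_1` commute and are fixed by `φ`. If `t` is empty, the empty word is
a solution; otherwise `V⁻¹ = x⁻¹ U⁻¹ x` begins with `x⁻¹ s`, so that `s (s⁻¹ x)`, which represents `x`,
has the required form. -/
theorem exists_formX1 {x : Word m} (hx1 : LettersBelow 1 x)
    (h : TwistedEq p u₀ u₁ v₀ v₁ x) :
    ∃ X, TwistedEq p u₀ u₁ v₀ v₁ X ∧ FormX1 p u₀ u₁ v₀ v₁ X := by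
  set U := twistWord p u₁ u₀ with hU
  set V := twistWord p v₁ v₀ with hV
  have hUr : IsReduced U := isReduced_twistWord _ _ _
  have hVr : IsReduced V := isReduced_twistWord _ _ _
  have hxl : FreeGroup.mk x ∈ level m 1 := mk_mem_level hx1
  have h' := h
  rw [twistedEq_iff, phi_zpow_level_one hxl, ← hU, ← hV] at h'
  obtain ⟨s, t, hst, hs, ht⟩ := exists_split_level 1 (invRev U)
  have hUst : U = invRev t ++ invRev s := by rw [← invRev_append, ← hst, invRev_invRev]
  have hsl := mk_mem_level hs
  cases t with
  | nil =>
    refine ⟨[], ?_, [], [], [], [], by simp, List.nil_suffix, rfl⟩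
    rw [twistedEq_iff, ← hU, ← hV, ← one_eq_mk, _root_.map_one]
    have hUl : FreeGroup.mk U ∈ level m 1 := by
      rw [hUst]; simpa using mk_mem_level (LettersBelow.invRev hs)
    rw [commute_level_one hUl hxl, mul_assoc] at h'
    rw [mul_one]
    exact (mul_left_cancel (h'.symm.trans (mul_one _).symm)).symm
  | cons l t =>
    set g := (FreeGroup.mk s)⁻¹ * FreeGroup.mk x with hg
    have hgl : g ∈ level m 1 := mul_mem (inv_mem hsl) hxl
    have htr : IsReduced (l :: t) := by
      have := isReduced_invRev hUr
      rw [hst] at this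
      exact this.right_of_append
    refine ⟨s ++ g.toWord, ?_, s, [], [], g.toWord, ?_, ?_, by simp⟩
    · rw [twistedEq_iff] at h ⊢
      rw [mk_append, mk_toWord, hg, mul_inv_cancel_left]
      exact h
    · intro W hW
      simp only [List.mem_cons, List.not_mem_nil, or_false] at hW
      rcases hW with rfl | rfl | rfl
      · right; rw [hst]; exact ⟨[], l :: t, by simp⟩
      · exact Or.inl List.nil_infix
      · exact Or.inl List.nil_infix
    · have e1 : (FreeGroup.mk V)⁻¹ = g⁻¹ * (FreeGroup.mk (l :: t) * FreeGroup.mk x) := by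
        have h1 : (FreeGroup.mk V)⁻¹ = (FreeGroup.mk x)⁻¹ * (FreeGroup.mk U)⁻¹ *
            FreeGroup.mk x := by
          have h2 := congrArg (fun g => (FreeGroup.mk x)⁻¹ * (FreeGroup.mk U)⁻¹ * g) h'
          simp only [mul_assoc, inv_mul_cancel_left] at h2
          rw [mul_assoc, h2]
        rw [h1, ← mk_invRev U, hst, mk_append, hg]; group
      have hrp : RP g⁻¹ (FreeGroup.mk (l :: t) * FreeGroup.mk x) := by
        refine RP_of_mem_level (inv_mem hgl) ?_
        obtain ⟨a, c, b, ha, hb, hab⟩ := exists_cancel (FreeGroup.mk (l :: t)) (FreeGroup.mk x)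
        rw [hab]
        rw [toWord_mk_of_isReduced htr] at ha
        cases a with
        | nil =>
          exfalso
          rw [List.nil_append] at ha
          have h2 : LettersBelow 1 (invRev c) := by
            have := hxl
            rw [mem_level, hb] at this
            exact this.subset (by simp)
          have h3 := LettersBelow.invRev h2
          rw [invRev_invRev, ← ha] at h3
          have h4 := h3 l (by simp)
          have h5 := ht l (by simp)
          omega
        | cons a' a =>
          simp only [List.cons_append, List.cons.injEq] at ha
          rw [← ha.1]
          simpa using ht l (by simp)
      have h6 := hrp.inv
      rw [RP, ← mul_inv_rev, ← e1, inv_inv, inv_inv, toWord_mk_of_isReduced hVr] at h6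
      exact ⟨_, h6.symm⟩

/-- The case of rank `i > 1`, for which the second and third of the three forms suffice. -/
theorem exists_form {x : Word m} {i : ℕ} (hm : 1 ≤ m) (hp : 0 < p)
    (hu₀ : IsReduced u₀) (hv₀ : IsReduced v₀) (hu₁ : IsReduced u₁) (hv₁ : IsReduced v₁)
    (hx : IsReduced x) (hi0 : 1 < i) (hi : rank x = i) (hr : IsReduced (invRev u₁ ++ x ++ v₁))
    (h : TwistedEq p u₀ u₁ v₀ v₁ x) :
    ∃ X, TwistedEq p u₀ u₁ v₀ v₁ X ∧
      (FormX3 (50 * 3 ^ m) i p u₀ u₁ v₀ v₁ X ∨ FormX4 i p u₀ v₀ x X) := by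
  obtain ⟨L, y, R, rfl, hL, hR, hy⟩ := exists_cancelData hu₁ hv₁ hx hr h
  have hxi := (rank_le_iff i _).1 hi.le
  by_cases hy0 : y = []
  · refine ⟨_, h, Or.inr ⟨rfl, L, y, R, hL, hR, rfl, ?_, [], [], [], [], ?_, IsReduced.nil,
      List.nil_infix, IsReduced.nil, List.nil_infix⟩⟩
    · rw [hy0]; show (0 : ℕ) < i; omega
    · rw [hy0, TwistedEq]; simp [← one_eq_mk]
  obtain ⟨z, ζ, D, hLU, hRV⟩ := hy.resolve_left hy0
  obtain ⟨b, hb, hb0⟩ := exists_top_letter hy0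
  have hbi : b.val + 1 ≤ i := by
    by_contra hcon
    have h1 : LettersBelow b.val y := hxi.subset (by simp) |>.mono (by omega)
    rw [numAt, lettersAt_eq_nil h1] at hb0
    simp at hb0
  have hC : (0 : ℝ) ≤ 50 * 3 ^ m := by positivity
  have bU := powerBound_twistWord (p := p) hu₀ hu₁ (powerBound_lenF hu₀) (powerBound_lenF hu₁)
  have bV := powerBound_twistWord (p := p) hv₀ hv₁ (powerBound_lenF hv₀) (powerBound_lenF hv₁)
  have bU' := powerBound_twistWord (p := p) hu₀ hu₁ (powerBound_lenH hu₀) (powerBound_lenH hu₁)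
  have bV' := powerBound_twistWord (p := p) hv₀ hv₁ (powerBound_lenH hv₀) (powerBound_lenH hv₁)
  have left : LettersBelow (b.val + 1) L → numAt b L ≤ numAt b z →
      ∃ X, TwistedEq p u₀ u₁ v₀ v₁ X ∧
        (FormX3 (50 * 3 ^ m) i p u₀ u₁ v₀ v₁ X ∨ FormX4 i p u₀ v₀ (L ++ y ++ R) X) := by
    intro h1 h2
    have e1 := D.left_eq
    have e2 := D.right_eq
    obtain ⟨X, h3, h4⟩ := D.formX3_of_numAt_le hp hC b hbi h1 hb hb0 h2 (e1 ▸ bU) (e2 ▸ bV)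
      (e1 ▸ bU') (e2 ▸ bV') (lenF_bound _ _ _ _) (lenF_bound _ _ _ _)
      fun q hq => lenH_bound hm hp _ _ _ _ q hq
    exact ⟨X, h3, Or.inl h4⟩
  have right : LettersBelow (b.val + 1) R → numAt b R ≤ numAt b ζ →
      ∃ X, TwistedEq p u₀ u₁ v₀ v₁ X ∧
        (FormX3 (50 * 3 ^ m) i p u₀ u₁ v₀ v₁ X ∨ FormX4 i p u₀ v₀ (L ++ y ++ R) X) := by
    intro h1 h2
    have D' := D.invRev
    have e1 := D'.left_eq
    have e2 := D'.right_eq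
    obtain ⟨X, h3, h4⟩ := D'.formX3_of_numAt_le hp hC b hbi (LettersBelow.invRev h1)
      (LettersBelow.invRev hb) (by rwa [numAt_invRev]) (by rwa [numAt_invRev]) (e1 ▸ bV) (e2 ▸ bU)
      (e1 ▸ bV') (e2 ▸ bU') (lenF_bound _ _ _ _) (lenF_bound _ _ _ _)
      fun q hq => lenH_bound hm hp _ _ _ _ q hq
    exact ⟨invRev X, h3.invRev, Or.inl h4.invRev⟩
  rcases hLU with rfl | hLU
  · exact left (by simp [LettersBelow]) (by simp)
  rcases hRV with rfl | hRV
  · exact right (by simp [LettersBelow]) (by simp)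
  -- From here on `U` and `V` lie in `φ^{-p}(u₀)` and `φ^{-p}(v₀)`, so that `y` solves an equation of the
  -- required kind if its rank is smaller than that of `x`.
  rcases hbi.lt_or_eq with hlt | heq
  · refine ⟨_, h, Or.inr ⟨rfl, L, y, R, hL, hR, rfl, ((rank_le_iff _ _).2 hb).trans_lt hlt, L, z,
      invRev R, ζ, ?_, ?_, ?_, ?_, ?_⟩⟩
    · rw [TwistedEq, invRev_invRev, ← mk_phiWord, D.image_eq]
    · rw [← D.left_eq]; exact isReduced_twistWord _ _ _
    · rw [← D.left_eq]; exact hLU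
    · rw [← D.right_eq]; exact isReduced_twistWord _ _ _
    · rw [← D.right_eq]; exact hRV
  · rw [← heq] at hxi
    have hLb : LettersBelow (b.val + 1) L := hxi.subset (by simp)
    have hRb : LettersBelow (b.val + 1) R := hxi.subset (by simp)
    have hnum := numAt_phi_zpow b (-(p : ℤ)) (mk_mem_level hxi)
    rw [← phiWord_of_mul, D.image_eq, toWord_mk_of_isReduced hx, numAt_append, numAt_append,
      numAt_append, numAt_append, numAt_invRev] at hnum
    -- Equal numbers of letters of top index in `L y R` and its image `z⁻¹ y ζ`.
    rcases le_or_gt (numAt b L) (numAt b z) with hle | hgt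
    · exact left hLb hle
    · exact right hRb (by omega)

end

end Hydra

theorem proposition7p1 (m : ℕ) (hm : 1 ≤ m) :
    ∃ C : ℝ, 0 < C ∧
      ∀ (i p : ℕ) (u₀ v₀ u₁ v₁ x : Hydra.Word m),
        1 ≤ i → i ≤ m → 0 < p →
        FreeGroup.IsReduced u₀ → FreeGroup.IsReduced v₀ →
        FreeGroup.IsReduced u₁ → FreeGroup.IsReduced v₁ → FreeGroup.IsReduced x →
        x ≠ [] → Hydra.rank x = i →
        FreeGroup.IsReduced (u₀ ++ x ++ FreeGroup.invRev v₀) →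
        FreeGroup.IsReduced (FreeGroup.invRev u₁ ++ x ++ v₁) →
        Hydra.TwistedEq p u₀ u₁ v₀ v₁ x →
        ∃ X : Hydra.Word m, Hydra.TwistedEq p u₀ u₁ v₀ v₁ X ∧
          (i = 1 → Hydra.FormX1 p u₀ u₁ v₀ v₁ X) ∧
          (1 < i →
            Hydra.FormX2 p u₀ v₀ x X ∨
            Hydra.FormX3 C i p u₀ u₁ v₀ v₁ X ∨
            Hydra.FormX4 i p u₀ v₀ x X) := by
  refine ⟨50 * 3 ^ m, by positivity, ?_⟩
  intro i p u₀ v₀ u₁ v₁ x hi1 _ hp hu₀ hv₀ hu₁ hv₁ hx _ hi _ hr h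
  rcases hi1.eq_or_lt with rfl | hi1
  · obtain ⟨X, h1, h2⟩ := Hydra.exists_formX1 ((Hydra.rank_le_iff 1 x).1 hi.le) h
    exact ⟨X, h1, fun _ => h2, fun h => absurd h (lt_irrefl _)⟩
  · obtain ⟨X, h1, h2⟩ := Hydra.exists_form hm hp hu₀ hv₀ hu₁ hv₁ hx hi1 hi hr h
    exact ⟨X, h1, fun h => by omega, fun _ => Or.inr h2⟩
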